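/- Let $\mathcal X,\mathcal Y$ be complex Banach spaces, $T>0$, $\alpha\in(0,1)$, $\beta>-1$, $\gamma\ge 1$. **Convolution.** Let $k:(0,\infty)\to\mathcal L(\mathcal X,\mathcal Y)$ have the Laplace transform $K(z)=\int_0^\infty e^{-zt}k(t)\,dt$ (absolutely convergent for $\operatorname{Re}z>0$), and assume that $K$ extends holomorphically to $|\arg z|<\pi$ with $\|K(z)\|\le M|z|^{-\alpha}$ there for some $M>0$, and that $K$ extends continuously to the upper and, separately, to the lower edge of the cut $(-\infty,0)$. Put $u(t)=\int_0^t k(t-s)f(s)\,ds$ and $G(x)=\dfrac{K(xe^{-i\pi})-K(xe^{i\pi})}{2\pi i}$, $x>0$. **Runge--Kutta method.** Let $(A,b,c)$ be a real $s$-stage Runge--Kutta method ($s\ge1$) with abscissae $c_i\in[0,1]$, of classical order $p\ge 1$ and stage order $q$, $1\le q\le p$. It is stiffly accurate ($b^\top=e_s^\top A$) and A-stable: with $R(z)=1+z\,b^\top(I-zA)^{-1}\mathbb 1$ one has $|R(z)|\le 1$ for $\operatorname{Re}z\le 0$, and all eigenvalues of $A$ lie in $\operatorname{Re}z>0$. If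 $\beta<0$, assume moreover that $c_i>0$ for all $i$. **Data.** Let $m=\lceil p-\beta-1\rceil$ and let $f$ admit on $[0,T]$ (on $(0,T]$ if $\beta<0$) the expansion $$f(t)=\sum_{\ell=0}^{m}\frac{f^{(\ell+\beta)}(0)}{\Gamma(\ell+\beta+1)}t^{\ell+\beta}+\frac{1}{\Gamma(m+\beta+1)}\int_0^t(t-s)^{m+\beta}f^{(m+\beta+1)}(s)\,ds ,$$ with $f^{(m+\beta+1)}\in C^0([0,T],\mathcal X)$. Here $f^{(\mu)}=\frac{d^\nu}{dt^\nu}\int_0^t\frac{(t-s)^{\nu-\mu-1}}{\Gamma(\nu-\mu)}f(s)\,ds$, $\nu=\lceil\mu\rceil$, is the Riemann--Liouville derivative (the ordinary derivative if $\mu$ is a nonnegative integer, the fractional integral of order $-\mu$ if $-1<\mu<0$), and $f^{(\mu)}(0)$ denotes its limit as $t\to0^+$. The sum is empty if $m<0$. **Scheme.** For $N\ge2$ take the graded mesh $t_n=(n\tau)^\gamma$, $\tau=T^{1/\gamma}/N$, $\tau_n=t_n-t_{n-1}$, and set $$u_n=\int_0^\infty G(x)\,y_n(x)\,dx,\qquad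 y_n(x)=\sum_{j=1}^n\Big(\prod_{l=j+1}^nR(-\tau_lx)\Big)\tau_j\,b^\top(I+\tau_jxA)^{-1}\big(f(t_{j-1}+c_i\tau_j)\big)_{i=1}^s .$$ **Theorem.** The integrals defining $u(t_n)$ and $u_n$ converge absolutely, and there is a constant $C>0$, depending only on $\alpha,\beta,\gamma,T$, $p$, $q$ and the Runge--Kutta method, such that for all such $\mathcal X,\mathcal Y,k,K,M,f$, all $N\ge 2$ and all $1\le n\le N$ $$\|u(t_n)-u_n\|_{\mathcal Y}\le CM\sum_{\ell=0}^m\log(N)\,N^{-\min\{\gamma(\alpha+\ell+\beta),\,p,\,q+1+\alpha\}}\|f^{(\ell+\beta)}(0)\|_{\mathcal X}+CM\log(N)\,N^{-\min\{p,\,q+1+\alpha\}}\|f^{(m+1+\beta)}\|_{C^0([0,t_n],\mathcal X)} .$$ In particular, if $\gamma(\alpha+\beta)\ge\min\{p,q+1+\alpha\}$ (such a $\gamma$ exists whenever $\alpha+\beta>0$), then $$\|u(t_n)-u_n\|_{\mathcal Y}\le CM\log(N)\,N^{-\min\{p,\,q+1+\alpha\}}\Big(\sum_{\ell=0}^m\|f^{(\ell+\beta)}(0)\|_{\mathcal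 X}+\|f^{(m+1+\beta)}\|_{C^0([0,t_n],\mathcal X)}\Big).$$ -/

import Mathlib

open Set Filter Topology MeasureTheory

universe u v

noncomputable section

namespace GCQ

/-! ### Runge--Kutta methods -/

/-- Butcher tableau of an `s`-stage Runge--Kutta method. -/
structure RungeKutta (s : ℕ) where
  A : Matrix (Fin s) (Fin s) ℝ
  b : Fin s → ℝ
  c : Fin s → ℝ

/-- Rooted trees, generated from the one-vertex tree by the Butcher product:
`graft u v` is the tree `u` with the root of `v` attached as a further child of the root of `u`.
(Every finite rooted tree is obtained in this way.) -/
inductive RTree : Type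
  | leaf : RTree
  | graft : RTree → RTree → RTree

namespace RTree

/-- Number of vertices. -/
def order : RTree → ℕ
  | leaf => 1
  | graft u v => u.order + v.order

/-- Product of the densities of the subtrees hanging from the root. -/
def childDensity : RTree → ℕ
  | leaf => 1
  | graft u v => u.childDensity * (v.order * v.childDensity)

/-- The density of a tree: number of vertices times the product of the
densities of the subtrees hanging from the root. -/
def density (t : RTree) : ℕ := t.order * t.childDensity

end RTree

namespace RungeKutta

variable {s : ℕ}

/-- Internal elementary weights: `φ_i(t) = ∏_{children v} ∑_j a_ij φ_j(v)`. -/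
def stageWeight (rk : RungeKutta s) : RTree → Fin s → ℝ
  | RTree.leaf, _ => 1
  | RTree.graft u v, i => rk.stageWeight u i * ∑ j, rk.A i j * rk.stageWeight v j

/-- Classical order (at least) `p`: Butcher's order conditions `∑ b_i φ_i(t) = 1 / density t`
for all rooted trees with at most `p` vertices. -/
def HasOrder (rk : RungeKutta s) (p : ℕ) : Prop :=
  ∀ t : RTree, t.order ≤ p → ∑ i, rk.b i * rk.stageWeight t i = 1 / (t.density : ℝ)

/-- Stage order (at least) `q`: `∑_j a_ij c_j^(k-1) = c_i^k / k` for `1 ≤ k ≤ q`. -/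
def HasStageOrder (rk : RungeKutta s) (q : ℕ) : Prop :=
  ∀ k : ℕ, 1 ≤ k → k ≤ q → ∀ i, ∑ j, rk.A i j * rk.c j ^ (k - 1) = rk.c i ^ k / (k : ℝ)

/-- The coefficient matrix with complex entries. -/
def matC (rk : RungeKutta s) : Matrix (Fin s) (Fin s) ℂ := rk.A.map (fun a : ℝ => (a : ℂ))

/-- The row vector `bᵀ (I - z A)⁻¹`. -/
def resolventRow (rk : RungeKutta s) (z : ℂ) : Fin s → ℂ :=
  Matrix.vecMul (fun i => (rk.b i : ℂ)) ((1 - z • rk.matC)⁻¹)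

/-- The stability function `R(z) = 1 + z bᵀ (I - z A)⁻¹ 𝟙`. -/
def stab (rk : RungeKutta s) (z : ℂ) : ℂ := 1 + z * ∑ i, rk.resolventRow z i

/-- A-stable, stiffly accurate method of classical order `p` and stage order `q`.
All eigenvalues of `A` lie in the open right half-plane (in particular `A` is invertible and
`I - z A` is invertible whenever `Re z ≤ 0`), and the abscissae lie in `[0,1]`. -/
structure Admissible {r : ℕ} (rk : RungeKutta (r + 1)) (p q : ℕ) : Prop where
  one_le_p : 1 ≤ p
  one_le_q : 1 ≤ q
  q_le_p : q ≤ p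
  order : rk.HasOrder p
  stageOrder : rk.HasStageOrder q
  spectrum_re_pos : ∀ μ ∈ spectrum ℂ rk.matC, 0 < μ.re
  aStable : ∀ z : ℂ, z.re ≤ 0 → ‖rk.stab z‖ ≤ 1
  stifflyAccurate : ∀ j, rk.b j = rk.A (Fin.last r) j
  c_mem : ∀ i, rk.c i ∈ Icc (0 : ℝ) 1

end RungeKutta

/-! ### The convolution, its transfer operator and the real-axis density -/

section Operators

variable {X Y : Type*} [NormedAddCommGroup X] [NormedSpace ℂ X]
  [NormedAddCommGroup Y] [NormedSpace ℂ Y]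

/-- `K` is the Laplace transform of `k` on the right half-plane. -/
def IsLaplaceTransform (k : ℝ → X →L[ℂ] Y) (K : ℂ → X →L[ℂ] Y) : Prop :=
  ∀ z : ℂ, 0 < z.re →
    IntegrableOn (fun t : ℝ => Complex.exp (-z * t) • k t) (Ioi 0) ∧
    K z = ∫ t in Ioi (0 : ℝ), Complex.exp (-z * t) • k t

/-- Sectorial transfer operator: holomorphic in `|arg z| < π`, bounded there by `M |z|^(-α)`, and
continuous up to the upper and up to the lower edge of the branch cut, except possibly at `0`
(the two boundary values need not agree). -/
structure IsSectorial (K : ℂ → X →L[ℂ] Y) (M α : ℝ) : Prop where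
  holomorphic : DifferentiableOn ℂ K Complex.slitPlane
  bound : ∀ z ∈ Complex.slitPlane, ‖K z‖ ≤ M * ‖z‖ ^ (-α)
  upper : ∃ Kp : ℂ → X →L[ℂ] Y,
    ContinuousOn Kp {z | 0 ≤ z.im ∧ z ≠ 0} ∧ EqOn Kp K {z | 0 < z.im}
  lower : ∃ Km : ℂ → X →L[ℂ] Y,
    ContinuousOn Km {z | z.im ≤ 0 ∧ z ≠ 0} ∧ EqOn Km K {z | z.im < 0}

/-- The boundary value `K(x e^{iπ})` on the upper edge of the cut. -/
def upperEdge (K : ℂ → X →L[ℂ] Y) (x : ℝ) : X →L[ℂ] Y :=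
  limUnder (𝓝[{z : ℂ | 0 < z.im}] (-(x : ℂ))) K

/-- The boundary value `K(x e^{-iπ})` on the lower edge of the cut. -/
def lowerEdge (K : ℂ → X →L[ℂ] Y) (x : ℝ) : X →L[ℂ] Y :=
  limUnder (𝓝[{z : ℂ | z.im < 0}] (-(x : ℂ))) K

/-- `G(x) = (K(x e^{-iπ}) - K(x e^{iπ})) / (2πi)`. -/
def density (K : ℂ → X →L[ℂ] Y) (x : ℝ) : X →L[ℂ] Y :=
  (2 * (Real.pi : ℂ) * Complex.I)⁻¹ • (lowerEdge K x - upperEdge K x)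

/-- The convolution `u(t) = ∫₀ᵗ k(t-s) f(s) ds`. -/
def conv (k : ℝ → X →L[ℂ] Y) (f : ℝ → X) (t : ℝ) : Y :=
  ∫ s in (0 : ℝ)..t, k (t - s) (f s)

/-- The Runge--Kutta solution at `t n` of `y' = -x y + f`, `y(0) = 0`, on the mesh
`t 0 < t 1 < ...` with `τ_j = t j - t (j-1)`:
`y_n(x) = ∑_{j=1}^n (∏_{l=j+1}^n R(-τ_l x)) τ_j bᵀ (I + τ_j x A)⁻¹ 𝐟_j`. -/
def rkSol {s : ℕ} (rk : RungeKutta s) (t : ℕ → ℝ) (f : ℝ → X) (x : ℝ) (n : ℕ) : X :=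
  ∑ j ∈ Finset.Icc 1 n,
    (∏ l ∈ Finset.Icc (j + 1) n, rk.stab (-((t l - t (l - 1)) * x : ℝ))) •
      ((t j - t (j - 1) : ℝ) : ℂ) •
        ∑ i, rk.resolventRow (-((t j - t (j - 1)) * x : ℝ)) i •
          f (t (j - 1) + rk.c i * (t j - t (j - 1)))

/-- The Runge--Kutta based gCQ approximation `u_n = ∫₀^∞ G(x) y_n(x) dx`. -/
def gcq {s : ℕ} (rk : RungeKutta s) (K : ℂ → X →L[ℂ] Y) (t : ℕ → ℝ) (f : ℝ → X) (n : ℕ) : Y :=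
  ∫ x in Ioi (0 : ℝ), density K x (rkSol rk t f x n)

end Operators

/-- Graded mesh `t_n = (n τ)^γ`, `τ = T^(1/γ) / N`. -/
def gradedMesh (T γ : ℝ) (N n : ℕ) : ℝ := ((n : ℝ) * (T ^ (1 / γ) / (N : ℝ))) ^ γ

/-! ### Riemann--Liouville derivatives and fractional power expansions -/

section Fractional

variable {X : Type*} [NormedAddCommGroup X] [NormedSpace ℂ X]

/-- Riemann--Liouville integral of order `σ > 0`. -/
def rlIntegral (σ : ℝ) (f : ℝ → X) (t : ℝ) : X :=
  (1 / Real.Gamma σ) • ∫ s in (0 : ℝ)..t, (t - s) ^ (σ - 1) • f s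

/-- Riemann--Liouville derivative of order `μ > -1` at `t > 0`: `(d/dt)^ν` of the
Riemann--Liouville integral of order `ν - μ`, where `ν = ⌈μ⌉`. For integer `μ` it is the usual
derivative (the integral of order `0` is the identity), for `-1 < μ < 0` it is the
Riemann--Liouville integral of order `-μ`. -/
def rlDeriv (μ : ℝ) (f : ℝ → X) (t : ℝ) : X :=
  if (⌈μ⌉₊ : ℝ) = μ then iteratedDeriv ⌈μ⌉₊ f t
  else iteratedDeriv ⌈μ⌉₊ (rlIntegral ((⌈μ⌉₊ : ℝ) - μ) f) t

/-- `f` admits on `[0,T]` the fractional power expansion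
`f(t) = ∑_{ℓ=0}^m f^{(ℓ+β)}(0) / Γ(ℓ+β+1) t^{ℓ+β} + 1/Γ(m+β+1) (t^{m+β} * f^{(m+β+1)})(t)`,
where `a ℓ = f^{(ℓ+β)}(0)` (one-sided limit at `0`) and `g = f^{(m+β+1)}`, continuous on `[0,T]`,
are Riemann--Liouville derivatives. The value `f 0` is only constrained when `0 ≤ β`. -/
structure HasFracExpansion (f : ℝ → X) (T β : ℝ) (m : ℤ) (a : ℤ → X) (g : ℝ → X) : Prop where
  coeff : ∀ l ∈ Finset.Icc (0 : ℤ) m,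
    Tendsto (rlDeriv ((l : ℝ) + β) f) (𝓝[>] 0) (𝓝 (a l))
  deriv_eq : ∀ t ∈ Ioo (0 : ℝ) T, rlDeriv ((m : ℝ) + β + 1) f t = g t
  deriv_cont : ContinuousOn g (Icc 0 T)
  expansion : ∀ t ∈ Icc (0 : ℝ) T, (t = 0 → 0 ≤ β) →
    f t = ∑ l ∈ Finset.Icc (0 : ℤ) m,
        (1 / Real.Gamma ((l : ℝ) + β + 1) * t ^ ((l : ℝ) + β)) • a l
      + (1 / Real.Gamma ((m : ℝ) + β + 1)) •
          ∫ s in (0 : ℝ)..t, (t - s) ^ ((m : ℝ) + β) • g s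

/-- The norm of `C⁰([0,t], X)`. -/
def supNorm (g : ℝ → X) (t : ℝ) : ℝ := sSup ((fun s => ‖g s‖) '' Icc 0 t)

end Fractional

end GCQ

end

/-! Deforming Cauchy's formula onto the branch cut gives `K z = ∫ G(x) / (x + z) dx`
(`IsSectorial.eq_stieltjes`), so by uniqueness of the Laplace transform `k(t) = ∫ e^{-xt} G(x) dx`
for almost every `t`. Fubini turns the convolution into `u(t) = ∫ G(x) y(x,t) dx`, where `y` solves
the scalar problem `y' = -x y + f`, `y(0) = 0` (`IsSectorial.integral_density_expConv`). The scheme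
integrates the Runge-Kutta solutions of these same problems against the same density. Since `‖G(x)‖
≤ M x^{-α}`, it remains to bound the error of the method for each `x ≥ 0` and to integrate the bound
against `x^{-α}`.

For fixed `x` the error is a sum of one-step defects, each damped by the later stability functions.
A-stability, the maximum principle and stiff accuracy give `|R(-z)| ≤ 1 / (1 + c z)`, so these
products decay like `1 / (1 + c x (t_n - t_j))` (`prod_stab_le`). In one defect all monomials up to
the stage order cancel. A monomial of degree `k` with `q < k ≤ p` survives with the factor `min(1, τ
x)^{p+1-k}`, because stiff accuracy and the order conditions annihilate its leading terms
(`exists_defect_bound`). Since `q + 1 + α < q + 2`, one may lower `p` to `min p (q + 2)` without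
changing the rate, and then at most two degrees remain.

For data `t^β` the derivatives satisfy `|y^{(k)}(t)| ≤ C t^{β+1-k} / (1 + x t)`
(`exists_powSol_bound`). The remainder of the expansion is a Riemann-Liouville integral of order at
least `p`, and it fits the same scheme with `β` replaced by `p` (`exists_rlSol_solutionBounds`). On
the graded mesh the step sizes are comparable to `t_j / j`, and summation yields the majorant
`errorWeight`.

Finally `∫ x^{-α} / (1 + λ x) dx` is a multiple of `λ^{α-1}`. With `λ` of size `t_j / j` this
produces `t_j^{α+β} j^{-ρ}`, `ρ = min(p, q + 1 + α)`, times `1/j` or `1 / max(1, n-j)`. The first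
factor is at most a constant times `N^{-min(γ(α+β), ρ)}` (`mesh_rpow_le`), and the harmonic sums
give the logarithm. -/

namespace GCQ
namespace RungeKutta

/-! ### The stage resolvent -/

section Resolvent

variable {s : ℕ}

/-- A real combination `a + b A` with nonnegative coefficients, not both zero, is invertible. -/
theorem isUnit_det_smul_add {rk : RungeKutta s}
    (h : ∀ μ ∈ spectrum ℂ rk.matC, 0 < μ.re) {a : ℂ} {b : ℂ} (hab : (b = 0 ∧ a ≠ 0) ∨
      (b ≠ 0 ∧ 0 ≤ (a / b).re)) :
    IsUnit (a • (1 : Matrix (Fin s) (Fin s) ℂ) + b • rk.matC).det := by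
  rw [← Matrix.isUnit_iff_isUnit_det]
  rcases hab with ⟨rfl, ha⟩ | ⟨hb, hab⟩
  · rw [zero_smul, add_zero]
    exact (isUnit_one).smul (Units.mk0 a ha)
  · have hn : -(a / b) ∉ spectrum ℂ rk.matC := fun hm => by
      have := h _ hm
      simp only [Complex.neg_re] at this
      linarith
    have hu : IsUnit (algebraMap ℂ (Matrix (Fin s) (Fin s) ℂ) (-(a / b)) - rk.matC) := by
      simpa [spectrum.mem_iff] using hn
    have := hu.smul (Units.mk0 (-b) (neg_ne_zero.2 hb))
    convert this using 1
    rw [Units.smul_mk0, smul_sub, Algebra.algebraMap_eq_smul_one, smul_smul]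
    have : -b * -(a / b) = a := by field_simp
    rw [this, neg_smul, sub_neg_eq_add]

/-- The matrix `(I - z A)⁻¹`. -/
noncomputable def stageInv (rk : RungeKutta s) (z : ℂ) : Matrix (Fin s) (Fin s) ℂ :=
  (1 - z • rk.matC)⁻¹

theorem isUnit_det_one_sub {rk : RungeKutta s} (h : ∀ μ ∈ spectrum ℂ rk.matC, 0 < μ.re)
    {z : ℂ} (hz : z.re ≤ 0) : IsUnit (1 - z • rk.matC).det := by
  have := isUnit_det_smul_add h (a := 1) (b := -z) (by
    rcases eq_or_ne z 0 with rfl | hz0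
    · simp
    · right
      refine ⟨neg_ne_zero.2 hz0, ?_⟩
      rw [one_div, Complex.inv_re, Complex.neg_re]
      have := Complex.normSq_nonneg (-z)
      exact div_nonneg (by linarith) this)
  rwa [one_smul, neg_smul, ← sub_eq_add_neg] at this

theorem stageInv_mul {rk : RungeKutta s} (h : ∀ μ ∈ spectrum ℂ rk.matC, 0 < μ.re)
    {z : ℂ} (hz : z.re ≤ 0) : rk.stageInv z * (1 - z • rk.matC) = 1 :=
  Matrix.nonsing_inv_mul _ (isUnit_det_one_sub h hz)

theorem mul_stageInv {rk : RungeKutta s} (h : ∀ μ ∈ spectrum ℂ rk.matC, 0 < μ.re)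
    {z : ℂ} (hz : z.re ≤ 0) : (1 - z • rk.matC) * rk.stageInv z = 1 :=
  Matrix.mul_nonsing_inv _ (isUnit_det_one_sub h hz)

theorem stageInv_comm {rk : RungeKutta s} (h : ∀ μ ∈ spectrum ℂ rk.matC, 0 < μ.re)
    {z : ℂ} (hz : z.re ≤ 0) : rk.matC * rk.stageInv z = rk.stageInv z * rk.matC := by
  have h1 := stageInv_mul h hz
  have h2 := mul_stageInv h hz
  calc rk.matC * rk.stageInv z
      = (rk.stageInv z * (1 - z • rk.matC)) * (rk.matC * rk.stageInv z) := by rw [h1, one_mul]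
    _ = rk.stageInv z * rk.matC * ((1 - z • rk.matC) * rk.stageInv z) := by
        simp only [Matrix.mul_assoc, Matrix.sub_mul, Matrix.mul_sub, Matrix.one_mul,
          Matrix.smul_mul, Matrix.mul_smul]
    _ = _ := by rw [h2, mul_one]

theorem stageInv_eq {rk : RungeKutta s} (h : ∀ μ ∈ spectrum ℂ rk.matC, 0 < μ.re)
    {z : ℂ} (hz : z.re ≤ 0) : rk.stageInv z = 1 + z • (rk.matC * rk.stageInv z) := by
  have h2 := mul_stageInv h hz
  rw [Matrix.sub_mul, Matrix.one_mul, Matrix.smul_mul, sub_eq_iff_eq_add] at h2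
  exact h2

theorem continuousOn_stageInv {rk : RungeKutta s} (h : ∀ μ ∈ spectrum ℂ rk.matC, 0 < μ.re) :
    ContinuousOn (fun z => rk.stageInv z) {z : ℂ | z.re ≤ 0} := by
  intro z hz
  apply ContinuousAt.continuousWithinAt
  have hu := isUnit_det_one_sub h hz
  have hc : Continuous fun z : ℂ => (1 - z • rk.matC) := by fun_prop
  have : (fun z => rk.stageInv z) =
      fun z => ((1 - z • rk.matC).det)⁻¹ • (1 - z • rk.matC).adjugate := by
    funext z
    rw [stageInv, Matrix.inv_def, Ring.inverse_eq_inv']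
  rw [this]
  exact ((hc.matrix_det.continuousAt).inv₀ hu.ne_zero).smul hc.matrix_adjugate.continuousAt

/-- `(1 + z) (I + z A)⁻¹` is bounded on `[0, ∞)`, with all entries continuous in `1 / (1 + z)`. -/
theorem exists_continuousOn_stageInv {rk : RungeKutta s}
    (h : ∀ μ ∈ spectrum ℂ rk.matC, 0 < μ.re) :
    ∃ V : ℝ → Matrix (Fin s) (Fin s) ℂ, ContinuousOn V (Icc 0 1) ∧
      ∀ z : ℝ, 0 ≤ z → rk.stageInv (-(z : ℂ)) = ((1 + z : ℝ) : ℂ)⁻¹ • V (1 + z)⁻¹ := by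
  -- The substitution `t = 1 / (1 + z)` compactifies `[0, ∞)`: `I + z A = (1 + z) (t I + (1 - t)
  -- A)`. At the new endpoint `t = 0` the matrix is `A`, which is invertible because its spectrum
  -- avoids `0`.
  refine ⟨fun t => ((t : ℂ) • 1 + (1 - t : ℂ) • rk.matC)⁻¹, ?_, ?_⟩
  · intro t ht
    apply ContinuousAt.continuousWithinAt
    have hu : IsUnit ((t : ℂ) • (1 : Matrix (Fin s) (Fin s) ℂ) + (1 - t : ℂ) • rk.matC).det := by
      apply isUnit_det_smul_add h
      rcases eq_or_ne t 1 with rfl | ht1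
      · left; simp
      · right
        have h1 : (1 - t : ℂ) = ((1 - t : ℝ) : ℂ) := by push_cast; ring
        rw [h1, ← Complex.ofReal_div, Complex.ofReal_re]
        exact ⟨by rw [Complex.ofReal_ne_zero]; exact sub_ne_zero.2 ht1.symm,
          div_nonneg ht.1 (by linarith [ht.2])⟩
    have hc : Continuous fun t : ℝ =>
        ((t : ℂ) • (1 : Matrix (Fin s) (Fin s) ℂ) + (1 - t : ℂ) • rk.matC) := by fun_prop
    have : (fun t : ℝ => ((t : ℂ) • (1 : Matrix (Fin s) (Fin s) ℂ) + (1 - t : ℂ) • rk.matC)⁻¹) =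
        fun t : ℝ => (((t : ℂ) • (1 : Matrix (Fin s) (Fin s) ℂ) + (1 - t : ℂ) • rk.matC).det)⁻¹ •
          ((t : ℂ) • (1 : Matrix (Fin s) (Fin s) ℂ) + (1 - t : ℂ) • rk.matC).adjugate := by
      funext z
      rw [Matrix.inv_def, Ring.inverse_eq_inv']
    rw [this]
    exact ((hc.matrix_det.continuousAt).inv₀ hu.ne_zero).smul hc.matrix_adjugate.continuousAt
  · intro z hz
    have hz1 : (1 + z : ℝ) ≠ 0 := by positivity
    have hz2 : (1 + z : ℂ) ≠ 0 := by exact_mod_cast hz1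
    have hu := isUnit_det_one_sub h (z := -(z : ℂ)) (by simpa using hz)
    rw [stageInv]
    apply Matrix.inv_eq_left_inv
    have e : (1 - (-(z : ℂ)) • rk.matC) = (1 + z : ℂ) •
        ((((1 + z)⁻¹ : ℝ) : ℂ) • (1 : Matrix (Fin s) (Fin s) ℂ) +
          (1 - (((1 + z)⁻¹ : ℝ) : ℂ)) • rk.matC) := by
      rw [smul_add, smul_smul, smul_smul]
      push_cast
      rw [mul_inv_cancel₀ hz2, mul_sub, mul_inv_cancel₀ hz2]
      simp
    have hv : IsUnit ((((1 + z)⁻¹ : ℝ) : ℂ) • (1 : Matrix (Fin s) (Fin s) ℂ) +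
          (1 - (((1 + z)⁻¹ : ℝ) : ℂ)) • rk.matC).det := by
      rw [e, Matrix.det_smul, IsUnit.mul_iff] at hu
      exact hu.2
    rw [e, Matrix.smul_mul, Matrix.mul_smul, smul_smul, Matrix.nonsing_inv_mul _ hv]
    push_cast
    rw [inv_mul_cancel₀ hz2, one_smul]

theorem exists_stageInv_bound {rk : RungeKutta s}
    (h : ∀ μ ∈ spectrum ℂ rk.matC, 0 < μ.re) :
    ∃ C : ℝ, 0 < C ∧ ∀ z : ℝ, 0 ≤ z → ∀ i j, ‖rk.stageInv (-(z : ℂ)) i j‖ ≤ C / (1 + z) := by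
  obtain ⟨V, hV, hVW⟩ := exists_continuousOn_stageInv h
  have hb : ∀ i j, ∃ C, ∀ t ∈ Icc (0 : ℝ) 1, ‖V t i j‖ ≤ C := fun i j =>
    isCompact_Icc.exists_bound_of_continuousOn
      ((continuous_id.matrix_elem i j).comp_continuousOn hV)
  choose C hC using hb
  have hC0 : ∀ i j, 0 ≤ C i j := fun i j =>
    (norm_nonneg _).trans (hC i j 0 ⟨le_rfl, zero_le_one⟩)
  refine ⟨1 + ∑ i, ∑ j, C i j, by
    have : 0 ≤ ∑ i, ∑ j, C i j := Finset.sum_nonneg fun i _ => Finset.sum_nonneg fun j _ => hC0 i j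
    linarith, fun z hz i j => ?_⟩
  have hz1 : (0 : ℝ) < 1 + z := by positivity
  have hm : (1 + z)⁻¹ ∈ Icc (0 : ℝ) 1 := ⟨by positivity, inv_le_one_of_one_le₀ (by linarith)⟩
  rw [hVW z hz, Matrix.smul_apply, smul_eq_mul, norm_mul, norm_inv, Complex.norm_real,
    Real.norm_of_nonneg hz1.le, div_eq_inv_mul]
  gcongr
  calc ‖V (1 + z)⁻¹ i j‖ ≤ C i j := hC i j _ hm
    _ ≤ ∑ j, C i j := Finset.single_le_sum (fun j _ => hC0 i j) (Finset.mem_univ j)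
    _ ≤ ∑ i, ∑ j, C i j := Finset.single_le_sum
        (fun i _ => Finset.sum_nonneg fun j _ => hC0 i j) (Finset.mem_univ i)
    _ ≤ _ := by linarith

end Resolvent

/-! ### Order conditions -/

section Order

/-- The bushy tree with `k` leaves. -/
def bushy : ℕ → RTree
  | 0 => RTree.leaf
  | k + 1 => RTree.graft (bushy k) RTree.leaf

theorem order_bushy (k : ℕ) : (bushy k).order = k + 1 := by
  induction k with
  | zero => rfl
  | succ k ih => simp [bushy, RTree.order, ih]

theorem childDensity_bushy (k : ℕ) : (bushy k).childDensity = 1 := by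
  induction k with
  | zero => rfl
  | succ k ih => simp [bushy, RTree.order, RTree.childDensity, ih]

variable {r : ℕ} {rk : RungeKutta (r + 1)} {p q : ℕ}

theorem Admissible.sum_A (h : rk.Admissible p q) (i) : ∑ j, rk.A i j = rk.c i := by
  simpa using h.stageOrder 1 le_rfl h.one_le_q i

theorem Admissible.stageWeight_bushy (h : rk.Admissible p q) (k : ℕ) (i) :
    rk.stageWeight (bushy k) i = rk.c i ^ k := by
  induction k with
  | zero => simp [bushy, stageWeight]
  | succ k ih => simp [bushy, stageWeight, ih, h.sum_A, pow_succ]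

/-- The order condition of the bushy tree, whose density is `k + 1`. Bushy trees, and bushy trees
hung from a new root, are the only trees whose conditions enter the convergence proof. -/
theorem Admissible.sum_b_pow (h : rk.Admissible p q) {k : ℕ} (hk : k + 1 ≤ p) :
    ∑ i, rk.b i * rk.c i ^ k = 1 / ((k : ℝ) + 1) := by
  have := h.order (bushy k) (by rw [order_bushy]; exact hk)
  simp only [h.stageWeight_bushy] at this
  rw [this, RTree.density, order_bushy, childDensity_bushy]
  push_cast
  ring

theorem Admissible.sum_b_A_pow (h : rk.Admissible p q) {k : ℕ} (hk : k + 2 ≤ p) :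
    ∑ i, rk.b i * ∑ j, rk.A i j * rk.c j ^ k = 1 / (((k : ℝ) + 2) * ((k : ℝ) + 1)) := by
  have := h.order (RTree.graft RTree.leaf (bushy k)) (by
    rw [RTree.order, order_bushy, RTree.order]; omega)
  simp only [stageWeight, h.stageWeight_bushy, one_mul] at this
  rw [this, RTree.density, RTree.order, RTree.childDensity, order_bushy, childDensity_bushy]
  simp only [RTree.order, RTree.childDensity]
  push_cast
  congr 1
  ring

/-- By stiff accuracy the last row sum of `A` is the sum of the weights `b`, which is `1` by the
first order condition. -/
theorem Admissible.c_last (h : rk.Admissible p q) : rk.c (Fin.last r) = 1 := by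
  rw [← h.sum_A, ← Finset.sum_congr rfl fun j _ => h.stifflyAccurate j]
  simpa using h.sum_b_pow (k := 0) (by simpa using h.one_le_p)

/-- Lowering the order keeps admissibility. -/
theorem Admissible.mono (h : rk.Admissible p q) {p' : ℕ} (hq : q ≤ p') (hp : p' ≤ p) :
    rk.Admissible p' q :=
  { h with
    one_le_p := h.one_le_q.trans hq
    q_le_p := hq
    order := fun t ht => h.order t (ht.trans hp) }

/-- The defect of the `k`-th monomial in the stage equations. -/
noncomputable def stageDefect (rk : RungeKutta (r + 1)) (k : ℕ) (i : Fin (r + 1)) : ℝ :=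
  rk.c i ^ k - k * ∑ j, rk.A i j * rk.c j ^ (k - 1)

theorem Admissible.stageDefect_eq_zero (h : rk.Admissible p q) {k : ℕ} (h1 : 1 ≤ k) (hk : k ≤ q)
    (i) : rk.stageDefect k i = 0 := by
  have : (k : ℝ) ≠ 0 := by positivity
  rw [stageDefect, h.stageOrder k h1 hk]
  field_simp
  ring

/-- Stiff accuracy makes the last stage the quadrature rule with weights `b`, which is exact up to
the classical order and not only up to the stage order. -/
theorem Admissible.stageDefect_last (h : rk.Admissible p q) {k : ℕ} (h1 : 1 ≤ k) (hk : k ≤ p) :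
    rk.stageDefect k (Fin.last r) = 0 := by
  obtain ⟨k, rfl⟩ : ∃ l, k = l + 1 := ⟨k - 1, by omega⟩
  have := h.sum_b_pow hk
  simp only [h.stifflyAccurate] at this
  have hk0 : (k : ℝ) + 1 ≠ 0 := by positivity
  rw [stageDefect, h.c_last, Nat.add_sub_cancel, this]
  push_cast
  field_simp
  simp

/-- The last row of `A` is `b`, so the two order conditions `∑ b_i c_i^k = 1/(k+1)` and `k ∑ b_i
a_ij c_j^(k-1) = 1/(k+1)` cancel each other. This is a second cancellation, available one degree
below the order. -/
theorem Admissible.sum_A_stageDefect (h : rk.Admissible p q) {k : ℕ} (h1 : 1 ≤ k)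
    (hk : k + 1 ≤ p) : ∑ i, rk.A (Fin.last r) i * rk.stageDefect k i = 0 := by
  obtain ⟨k, rfl⟩ : ∃ l, k = l + 1 := ⟨k - 1, by omega⟩
  have e1 := h.sum_b_pow hk
  have e2 := h.sum_b_A_pow (k := k) (by omega)
  simp only [h.stifflyAccurate] at e1 e2
  have hk0 : (k : ℝ) + 1 ≠ 0 := by positivity
  have hk1 : (k : ℝ) + 2 ≠ 0 := by positivity
  have e3 : ∀ i, rk.A (Fin.last r) i * rk.stageDefect (k + 1) i =
      rk.A (Fin.last r) i * rk.c i ^ (k + 1) - (k + 1) *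
      (rk.A (Fin.last r) i * ∑ j, rk.A i j * rk.c j ^ k) := fun i => by
    rw [stageDefect, Nat.add_sub_cancel]; push_cast; ring
  simp only [e3]
  rw [Finset.sum_sub_distrib, ← Finset.mul_sum, e1, e2]
  push_cast
  field_simp
  ring

end Order

/-! ### The last row of the resolvent and the stability function -/

section LastRow

variable {r : ℕ} {rk : RungeKutta (r + 1)} {p q : ℕ}

/-- Stiff accuracy `bᵀ = eᵀ A` with the last unit vector `e`; all later identities for the last row
of the resolvent rest on it. -/
theorem Admissible.matC_mul_stageInv_last (h : rk.Admissible p q) (z : ℂ) (k : Fin (r + 1)) :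
    (rk.matC * rk.stageInv z) (Fin.last r) k = rk.resolventRow z k := by
  rw [Matrix.mul_apply, resolventRow, Matrix.vecMul, dotProduct]
  refine Finset.sum_congr rfl fun i _ => ?_
  rw [h.stifflyAccurate]
  rfl

theorem Admissible.resolventRow_eq (h : rk.Admissible p q) {z : ℂ} (hz : z.re ≤ 0)
    (k : Fin (r + 1)) :
    rk.resolventRow z k = ∑ i, rk.stageInv z (Fin.last r) i * (rk.A i k : ℂ) := by
  rw [← h.matC_mul_stageInv_last, stageInv_comm h.spectrum_re_pos hz, Matrix.mul_apply]
  rfl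

theorem Admissible.stageInv_last (h : rk.Admissible p q) {z : ℂ} (hz : z.re ≤ 0)
    (k : Fin (r + 1)) : rk.stageInv z (Fin.last r) k =
      (1 : Matrix (Fin (r + 1)) (Fin (r + 1)) ℂ) (Fin.last r) k + z * rk.resolventRow z k := by
  conv_lhs => rw [stageInv_eq h.spectrum_re_pos hz]
  rw [Matrix.add_apply, Matrix.smul_apply, h.matC_mul_stageInv_last, smul_eq_mul]

/-- The last component of `(I - z A)⁻¹ d`. -/
theorem Admissible.sum_stageInv_last (h : rk.Admissible p q) {z : ℂ} (hz : z.re ≤ 0)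
    (d : Fin (r + 1) → ℝ) :
    ∑ i, rk.stageInv z (Fin.last r) i * (d i : ℂ) = (d (Fin.last r) : ℂ) +
      z * ∑ i, rk.resolventRow z i * (d i : ℂ) := by
  simp only [h.stageInv_last hz, add_mul, mul_assoc]
  rw [Finset.sum_add_distrib, ← Finset.mul_sum]
  congr 1
  simp [Matrix.one_apply]

/-- The resolvent row applied to a vector, expanded to first order. -/
theorem Admissible.sum_resolventRow (h : rk.Admissible p q) {z : ℂ} (hz : z.re ≤ 0)
    (d : Fin (r + 1) → ℝ) :
    ∑ i, rk.resolventRow z i * (d i : ℂ) = ((∑ i, rk.A (Fin.last r) i * d i : ℝ) : ℂ) +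
      z * ∑ i, rk.resolventRow z i * ((∑ j, rk.A i j * d j : ℝ) : ℂ) := by
  have e := h.sum_stageInv_last hz (fun i => ∑ j, rk.A i j * d j)
  rw [← e]
  simp only [h.resolventRow_eq hz]
  push_cast
  simp only [Finset.sum_mul, Finset.mul_sum, mul_assoc]
  rw [Finset.sum_comm]

/-- For a stiffly accurate method `R(z)` is the last entry of `(I - z A)⁻¹ 𝟙`, so `R` inherits the
decay of the resolvent at infinity. -/
theorem Admissible.stab_eq (h : rk.Admissible p q) {z : ℂ} (hz : z.re ≤ 0) :
    rk.stab z = ∑ i, rk.stageInv z (Fin.last r) i := by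
  have := h.sum_stageInv_last hz fun _ => 1
  simp only [Complex.ofReal_one, mul_one] at this
  rw [this, stab]

end LastRow

/-! ### Bounds on the negative real axis: resolvent row, stability function, defects -/

section Bounds

variable {r : ℕ} {rk : RungeKutta (r + 1)} {p q : ℕ}

theorem Admissible.exists_resolventRow_bound (h : rk.Admissible p q) :
    ∃ C : ℝ, 0 < C ∧ ∀ z : ℝ, 0 ≤ z →
      (∀ i, ‖rk.resolventRow (-(z : ℂ)) i‖ ≤ C / (1 + z)) ∧
      (∀ i, ‖rk.stageInv (-(z : ℂ)) (Fin.last r) i‖ ≤ C / (1 + z)) := by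
  obtain ⟨C, hC, hb⟩ := exists_stageInv_bound h.spectrum_re_pos
  have hS : 0 ≤ ∑ i, ∑ k, |rk.A i k| := by positivity
  refine ⟨C * (1 + ∑ i, ∑ k, |rk.A i k|), by positivity, fun z hz => ⟨fun k => ?_, fun i => ?_⟩⟩
  · have hz1 : (0 : ℝ) < 1 + z := by positivity
    rw [h.resolventRow_eq (by simpa using hz)]
    calc _ ≤ ∑ i, ‖rk.stageInv (-(z : ℂ)) (Fin.last r) i * (rk.A i k : ℂ)‖ := norm_sum_le _ _
      _ ≤ ∑ i, C / (1 + z) * ∑ k, |rk.A i k| := by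
          refine Finset.sum_le_sum fun i _ => ?_
          rw [norm_mul, Complex.norm_real, Real.norm_eq_abs]
          gcongr
          · exact hb z hz _ _
          · exact Finset.single_le_sum (f := fun k => |rk.A i k|)
              (fun _ _ => abs_nonneg _) (Finset.mem_univ k)
      _ = C * (∑ i, ∑ k, |rk.A i k|) / (1 + z) := by rw [← Finset.mul_sum]; ring
      _ ≤ _ := by gcongr; linarith
  · have hz1 : (0 : ℝ) < 1 + z := by positivity
    refine (hb z hz _ _).trans ?_
    gcongr
    nlinarith

theorem Admissible.differentiableOn_stab (h : rk.Admissible p q) :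
    DifferentiableOn ℂ rk.stab {z : ℂ | z.re < 0} := by
  have hc : ∀ i j, Differentiable ℂ fun z : ℂ => (1 - z • rk.matC) i j := fun i j => by
    simp only [Matrix.sub_apply, Matrix.smul_apply]
    fun_prop
  have hd : ∀ M : ℂ → Matrix (Fin (r + 1)) (Fin (r + 1)) ℂ,
      (∀ i j, Differentiable ℂ fun z => M z i j) → Differentiable ℂ fun z => (M z).det := by
    intro M hM
    simp only [Matrix.det_apply]
    have := hM
    fun_prop
  have hadj : ∀ i j, Differentiable ℂ fun z : ℂ => (1 - z • rk.matC).adjugate i j := by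
    intro i j
    simp only [Matrix.adjugate_apply]
    apply hd
    intro k l
    simp only [Matrix.updateRow_apply]
    split_ifs
    · fun_prop
    · exact hc k l
  intro z hz
  have hz' : z.re ≤ 0 := le_of_lt hz
  have hu := (isUnit_det_one_sub h.spectrum_re_pos hz').ne_zero
  have e : ∀ w, rk.stab w = 1 + w * ∑ j, ∑ i, (rk.b i : ℂ) *
      (((1 - w • rk.matC).det)⁻¹ * (1 - w • rk.matC).adjugate i j) := by
    intro w
    simp only [stab, resolventRow, Matrix.vecMul, dotProduct, Matrix.inv_def,
      Ring.inverse_eq_inv', Matrix.smul_apply, smul_eq_mul]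
  have hdet := hd _ hc
  have : DifferentiableAt ℂ rk.stab z := by
    rw [funext e]
    have h1 : DifferentiableAt ℂ (fun w : ℂ => ((1 - w • rk.matC).det)⁻¹) z :=
      (hdet z).inv hu
    refine (differentiableAt_const _).add (differentiableAt_id.mul ?_)
    refine DifferentiableAt.fun_sum fun j _ => DifferentiableAt.fun_sum fun i _ => ?_
    exact (differentiableAt_const _).mul (h1.mul (hadj i j z))
  exact this.differentiableWithinAt

/-- Decay of the stability function along the negative real axis. -/
theorem Admissible.exists_stab_le_div (h : rk.Admissible p q) :
    ∃ C : ℝ, 0 < C ∧ ∀ z : ℝ, 0 ≤ z → ‖rk.stab (-(z : ℂ))‖ ≤ C / (1 + z) := by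
  obtain ⟨C, hC, hb⟩ := h.exists_resolventRow_bound
  refine ⟨(r + 1) * C, by positivity, fun z hz => ?_⟩
  rw [h.stab_eq (by simpa using hz)]
  refine (norm_sum_le _ _).trans ((Finset.sum_le_sum fun i _ => (hb z hz).2 i).trans ?_)
  simp
  rw [mul_div_assoc]

/-- Modulus `1` at an interior point would make `R` constant on the left half-plane by the maximum
principle, against its decay at infinity. -/
theorem Admissible.stab_lt_one (h : rk.Admissible p q) {z : ℝ} (hz : 0 < z) :
    ‖rk.stab (-(z : ℂ))‖ < 1 := by
  refine lt_of_le_of_ne (h.aStable _ (by simpa using hz.le)) fun h1 => ?_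
  have hconv : IsPreconnected {w : ℂ | w.re < 0} := (convex_halfSpace_re_lt 0).isPreconnected
  have hopen : IsOpen {w : ℂ | w.re < 0} := isOpen_lt Complex.continuous_re continuous_const
  have hm : IsMaxOn (norm ∘ rk.stab) {w : ℂ | w.re < 0} (-(z : ℂ)) := by
    intro w hw
    simp only [mem_ofPred_eq, Function.comp_apply, h1]
    exact h.aStable w (le_of_lt hw)
  have := Complex.eqOn_of_isPreconnected_of_isMaxOn_norm hconv hopen h.differentiableOn_stab
    (by simpa using hz) hm
  obtain ⟨C, hC, hb⟩ := h.exists_stab_le_div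
  -- At `-C` the decay bound reads `C / (1 + C) < 1`.
  have h2 := this (x := -((C : ℝ) : ℂ)) (by simpa using hC)
  have h3 := hb C hC.le
  rw [h2, Function.const_apply, h1, le_div_iff₀ (by positivity)] at h3
  linarith

/-- Consistency to first order with an explicit remainder; the linear coefficient is the last
abscissa, which equals `1`. -/
theorem Admissible.stab_expansion (h : rk.Admissible p q) {z : ℝ} (hz : 0 ≤ z) :
    rk.stab (-(z : ℂ)) = 1 - z + (z : ℂ) ^ 2 * ∑ i, rk.resolventRow (-(z : ℂ)) i * (rk.c i : ℂ) := by
  have hz' : (-(z : ℂ)).re ≤ 0 := by simpa using hz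
  have e := h.sum_resolventRow hz' fun _ => 1
  simp only [Complex.ofReal_one, mul_one] at e
  rw [stab, e]
  simp only [h.sum_A, h.c_last]
  push_cast
  ring

/-- The stability function decays on the negative real axis like that of implicit Euler. -/
theorem Admissible.exists_stab_bound (h : rk.Admissible p q) :
    ∃ c : ℝ, 0 < c ∧ c ≤ 1 ∧ ∀ z : ℝ, 0 ≤ z → ‖rk.stab (-(z : ℂ))‖ ≤ 1 / (1 + c * z) := by
  obtain ⟨C, hC, hb⟩ := h.exists_stab_le_div
  obtain ⟨C₁, hC₁, hb₁⟩ := h.exists_resolventRow_bound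
  set S : ℝ := (r + 1) * C₁ + 1 with hS
  have hS1 : 1 ≤ S := by
    have : (0 : ℝ) ≤ (r + 1) * C₁ := by positivity
    linarith
  have hquad : ∀ z : ℝ, 0 ≤ z → z ≤ 1 → ‖rk.stab (-(z : ℂ))‖ ≤ 1 - z + S * z ^ 2 := by
    intro z hz hz1
    rw [h.stab_expansion hz]
    have e1 : ‖(1 : ℂ) - z‖ = 1 - z := by
      rw [← Complex.ofReal_one, ← Complex.ofReal_sub, Complex.norm_real,
        Real.norm_of_nonneg (by linarith)]
    have e2 : ‖∑ i, rk.resolventRow (-(z : ℂ)) i * (rk.c i : ℂ)‖ ≤ S := by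
      refine (norm_sum_le _ _).trans ?_
      have : ∀ i ∈ Finset.univ, ‖rk.resolventRow (-(z : ℂ)) i * (rk.c i : ℂ)‖ ≤ C₁ := by
        intro i _
        rw [norm_mul, Complex.norm_real, Real.norm_of_nonneg (h.c_mem i).1]
        have h1 := (hb₁ z hz).1 i
        have h2 : C₁ / (1 + z) ≤ C₁ := div_le_self hC₁.le (by linarith)
        calc _ ≤ C₁ * 1 := mul_le_mul (h1.trans h2) (h.c_mem i).2 (h.c_mem i).1 hC₁.le
          _ = _ := mul_one _
      refine (Finset.sum_le_sum this).trans ?_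
      simp [hS]
    calc _ ≤ ‖(1 : ℂ) - z‖ + ‖(z : ℂ) ^ 2 * ∑ i, rk.resolventRow (-(z : ℂ)) i * (rk.c i : ℂ)‖ :=
          norm_add_le _ _
      _ ≤ (1 - z) + z ^ 2 * S := by
          rw [e1, norm_mul, norm_pow, Complex.norm_real, Real.norm_of_nonneg hz]
          gcongr
      _ = _ := by ring
  -- Up to `z₁` the quadratic term `S z²` is at most `z / 2`, whence `|R(-z)| ≤ 1 - z / 2`.
  set z₁ : ℝ := 1 / (2 * S) with hz₁
  have hz₁0 : 0 < z₁ := by positivity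
  have hz₁1 : z₁ ≤ 1 := by rw [hz₁, div_le_one (by positivity)]; linarith
  -- uniform strict bound away from zero
  obtain ⟨κ, hκ0, hκ1, hκ⟩ : ∃ κ : ℝ, 0 < κ ∧ κ < 1 ∧ ∀ z : ℝ, z₁ ≤ z → ‖rk.stab (-(z : ℂ))‖ ≤ κ := by
    have hcont : ContinuousOn (fun z : ℝ => ‖rk.stab (-(z : ℂ))‖) (Icc z₁ (z₁ + 2 * C)) := by
      refine (h.differentiableOn_stab.continuousOn.comp (t := {z : ℂ | z.re < 0})
        (f := fun z : ℝ => -(z : ℂ)) (by fun_prop) ?_).norm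
      intro z hz
      simp only [mem_ofPred_eq, Complex.neg_re, Complex.ofReal_re]
      linarith [hz.1]
    -- Past `z₁ + 2 C` the decay bound already gives `1 / 2`; before that, compactness turns the
    -- pointwise strict inequality into a uniform one.
    obtain ⟨x, hx, hmax⟩ := isCompact_Icc.exists_isMaxOn
      (nonempty_Icc.2 (by linarith : z₁ ≤ z₁ + 2 * C)) hcont
    refine ⟨max (‖rk.stab (-(x : ℂ))‖) (1 / 2), by positivity,
      max_lt (h.stab_lt_one (hz₁0.trans_le hx.1)) (by norm_num), fun z hz => ?_⟩
    by_cases hzl : z ≤ z₁ + 2 * C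
    · exact le_max_of_le_left (hmax ⟨hz, hzl⟩)
    · refine le_max_of_le_right ((hb z (by linarith)).trans ?_)
      rw [div_le_iff₀ (by linarith)]
      linarith
  -- Near zero `c ≤ 1/2` makes `(1 - z/2)(1 + c z) ≤ 1`. Beyond `z₁` one has `|R| ≤ κ` and `z |R| ≤
  -- C`, so `c ≤ (1 - κ) / C` is what `|R| (1 + c z) ≤ 1` requires.
  refine ⟨min (1 / 2) ((1 - κ) / C), lt_min (by norm_num) (div_pos (by linarith) hC),
    (min_le_left _ _).trans (by norm_num), fun z hz => ?_⟩
  have hc0 : 0 < min (1 / 2) ((1 - κ) / C) := lt_min (by norm_num) (div_pos (by linarith) hC)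
  have hpos : 0 < 1 + min (1 / 2) ((1 - κ) / C) * z := by positivity
  rw [le_div_iff₀ hpos]
  rcases le_total z z₁ with hz1 | hz1
  · have hq := hquad z hz (hz1.trans hz₁1)
    have h2 : S * z ≤ 1 / 2 := by
      calc S * z ≤ S * z₁ := by gcongr
        _ = 1 / 2 := by rw [hz₁]; field_simp
    have h3 : ‖rk.stab (-(z : ℂ))‖ ≤ 1 - z / 2 := by nlinarith
    have h4 : min (1 / 2) ((1 - κ) / C) * z ≤ 1 / 2 * z := by
      gcongr; exact min_le_left _ _
    have h5 : 0 ≤ 1 - z / 2 := by linarith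
    calc _ ≤ (1 - z / 2) * (1 + 1 / 2 * z) := by gcongr
      _ ≤ 1 := by nlinarith [sq_nonneg z]
  · have h1 := hκ z hz1
    have h2 := hb z hz
    have h3 : z * ‖rk.stab (-(z : ℂ))‖ ≤ C := by
      rw [le_div_iff₀ (by linarith)] at h2
      nlinarith [norm_nonneg (rk.stab (-(z : ℂ)))]
    have h4 : min (1 / 2) ((1 - κ) / C) * (z * ‖rk.stab (-(z : ℂ))‖) ≤ (1 - κ) / C * C := by
      gcongr
      exact min_le_right _ _
    rw [div_mul_cancel₀ _ hC.ne'] at h4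
    linarith

/-- Bound for the amplification factor of the defect of the `k`-th monomial. -/
theorem Admissible.exists_defect_bound (h : rk.Admissible p q) (hp : p ≤ q + 2) :
    ∃ C : ℝ, 0 < C ∧ ∀ k ∈ Finset.Ioc q p, ∀ z : ℝ, 0 ≤ z →
      ‖∑ i, rk.stageInv (-(z : ℂ)) (Fin.last r) i * (rk.stageDefect k i : ℂ)‖ ≤
        C * (min 1 z) ^ (p + 1 - k) / (1 + z) := by
  obtain ⟨C, hC, hb⟩ := h.exists_resolventRow_bound
  -- bounds for row times a vector
  have hrow : ∀ (w : ℝ → Fin (r + 1) → ℂ) (d : Fin (r + 1) → ℝ),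
      (∀ z, 0 ≤ z → ∀ i, ‖w z i‖ ≤ C / (1 + z)) → ∀ z, 0 ≤ z →
      ‖∑ i, w z i * (d i : ℂ)‖ ≤ C * (∑ i, |d i|) / (1 + z) := by
    intro w d hw z hz
    refine (norm_sum_le _ _).trans ?_
    rw [Finset.mul_sum, Finset.sum_div]
    refine Finset.sum_le_sum fun i _ => ?_
    rw [norm_mul, Complex.norm_real, Real.norm_eq_abs]
    calc _ ≤ C / (1 + z) * |d i| := by gcongr; exact hw z hz i
      _ = _ := by ring
  let Ad : ℕ → Fin (r + 1) → ℝ := fun k i => ∑ j, rk.A i j * rk.stageDefect k j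
  let S : ℝ := ∑ k ∈ Finset.Ioc q p,
    (∑ i, |rk.stageDefect k i| + ∑ i, |Ad k i|)
  have hSk : ∀ k ∈ Finset.Ioc q p, (∑ i, |rk.stageDefect k i| + ∑ i, |Ad k i|) ≤ S := by
    intro k hk
    exact Finset.single_le_sum
      (f := fun k => (∑ i, |rk.stageDefect k i| + ∑ i, |Ad k i|))
      (fun k _ => by positivity) hk
  have hS0 : 0 ≤ S := Finset.sum_nonneg fun k _ => by positivity
  refine ⟨C * (S + 1), by positivity, fun k hk z hz => ?_⟩
  have hz' : (-(z : ℂ)).re ≤ 0 := by simpa using hz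
  have hz1 : (0 : ℝ) < 1 + z := by positivity
  rw [Finset.mem_Ioc] at hk
  have hSk' := hSk k (Finset.mem_Ioc.2 hk)
  have hA0 : 0 ≤ ∑ i, |Ad k i| := by positivity
  have hD0 : 0 ≤ ∑ i, |rk.stageDefect k i| := by positivity
  -- the crude bound, good for large arguments
  have hcrude := hrow (fun z => rk.stageInv (-(z : ℂ)) (Fin.last r)) (rk.stageDefect k)
    (fun z hz i => (hb z hz).2 i) z hz
  have hcrude' : ‖∑ i, rk.stageInv (-(z : ℂ)) (Fin.last r) i * (rk.stageDefect k i : ℂ)‖ ≤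
      C * (S + 1) / (1 + z) := by
    refine hcrude.trans ?_
    gcongr
    linarith
  rcases le_total 1 z with h1 | h1
  · rw [min_eq_left h1, one_pow, mul_one]
    exact hcrude'
  rw [min_eq_right h1, h.sum_stageInv_last hz', h.stageDefect_last (by omega) hk.2,
    Complex.ofReal_zero, zero_add, norm_mul, norm_neg, Complex.norm_real, Real.norm_of_nonneg hz]
  -- Because `p ≤ q + 2`, the exponent is `1` (for `k = p`) or `2` (for `k = p - 1`). One factor `z`
  -- has just come from the vanishing last defect; the second comes from `sum_A_stageDefect`.
  rcases eq_or_ne (p + 1 - k) 1 with hk1 | hk1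
  · rw [hk1, pow_one]
    have := hrow (fun z => rk.resolventRow (-(z : ℂ))) (rk.stageDefect k)
      (fun z hz i => (hb z hz).1 i) z hz
    calc _ ≤ z * (C * (∑ i, |rk.stageDefect k i|) / (1 + z)) := by gcongr
      _ ≤ z * (C * (S + 1) / (1 + z)) := by gcongr; linarith
      _ = _ := by ring
  · have hk2 : p + 1 - k = 2 := by omega
    rw [hk2, h.sum_resolventRow hz', h.sum_A_stageDefect (by omega) (by omega),
      Complex.ofReal_zero, zero_add, norm_mul, norm_neg, Complex.norm_real,
      Real.norm_of_nonneg hz]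
    have := hrow (fun z => rk.resolventRow (-(z : ℂ))) (Ad k) (fun z hz i => (hb z hz).1 i) z hz
    calc _ ≤ z * (z * (C * (∑ i, |Ad k i|) / (1 + z))) := by gcongr
      _ ≤ z * (z * (C * (S + 1) / (1 + z))) := by gcongr; linarith
      _ = _ := by ring

end Bounds

end RungeKutta
end GCQ

namespace GCQ

/-! ### Taylor expansion along a chain of derivatives -/

section Taylor

variable {E : Type*} [NormedAddCommGroup E] [NormedSpace ℝ E]

/-- The remainder is measured by the oscillation of the last member `v p`, which need not be
differentiable; a Lipschitz bound on it therefore yields order `p + 1`. The induction is the mean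
value inequality applied to function minus polynomial, with no factorial gained. -/
theorem norm_taylor_le (p : ℕ) : ∀ (v : ℕ → ℝ → E) {t₀ t₁ B : ℝ}, t₀ ≤ t₁ →
    (∀ k < p, ∀ t ∈ Icc t₀ t₁, HasDerivAt (v k) (v (k + 1) t) t) →
    (∀ t ∈ Icc t₀ t₁, ‖v p t - v p t₀‖ ≤ B) → ∀ t ∈ Icc t₀ t₁,
    ‖v 0 t - ∑ k ∈ Finset.range (p + 1), ((t - t₀) ^ k / (k.factorial : ℝ)) • v k t₀‖ ≤
      B * (t₁ - t₀) ^ p := by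
  induction p with
  | zero =>
    intro v t₀ t₁ B h01 _ hB t ht
    simpa using hB t ht
  | succ p ih =>
    intro v t₀ t₁ B h01 hv hB t ht
    have hI := ih (fun k => v (k + 1)) h01 (fun k hk t ht => hv (k + 1) (by omega) t ht) hB
    have hB0 : 0 ≤ B := (norm_nonneg _).trans (hB t ht)
    set F : ℝ → E := fun t => v 0 t -
      ∑ k ∈ Finset.range (p + 2), ((t - t₀) ^ k / (k.factorial : ℝ)) • v k t₀ with hF
    have hpow : ∀ k : ℕ, ∀ u : ℝ, HasDerivAt
        (fun s : ℝ => ((s - t₀) ^ (k + 1) / ((k + 1).factorial : ℝ)) • v (k + 1) t₀)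
        (((u - t₀) ^ k / (k.factorial : ℝ)) • v (k + 1) t₀) u := by
      intro k u
      have h1 : HasDerivAt (fun s : ℝ => (s - t₀) ^ (k + 1)) (((k + 1 : ℕ) : ℝ) * (u - t₀) ^ k) u := by
        simpa using ((hasDerivAt_id u).sub_const t₀).fun_pow (k + 1)
      convert (h1.div_const ((k + 1).factorial : ℝ)).smul_const (v (k + 1) t₀) using 2
      rw [Nat.factorial_succ]
      have : ((k + 1 : ℕ) : ℝ) ≠ 0 := by positivity
      have : (k.factorial : ℝ) ≠ 0 := by positivity
      push_cast at *
      field_simp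
    have hFd : ∀ u ∈ Icc t₀ t₁, HasDerivAt F (v 1 u -
        ∑ k ∈ Finset.range (p + 1), ((u - t₀) ^ k / (k.factorial : ℝ)) • v (k + 1) t₀) u := by
      intro u hu
      have h1 : HasDerivAt (fun s : ℝ => ∑ k ∈ Finset.range (p + 2),
          ((s - t₀) ^ k / (k.factorial : ℝ)) • v k t₀)
          (∑ k ∈ Finset.range (p + 1), ((u - t₀) ^ k / (k.factorial : ℝ)) • v (k + 1) t₀) u := by
        simp only [Finset.sum_range_succ' _ (p + 1)]
        have h2 := (HasDerivAt.fun_sum (u := Finset.range (p + 1)) fun k _ => hpow k u).add_const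
          ((1 : ℝ) • v 0 t₀)
        simpa using h2
      exact (hv 0 (by omega) u hu).sub h1
    have hF0 : F t₀ = 0 := by
      simp only [hF, sub_self]
      rw [Finset.sum_range_succ']
      simp
    have := (convex_Icc t₀ t₁).norm_image_sub_le_of_norm_hasDerivWithin_le
      (f := F) (fun u hu => (hFd u hu).hasDerivWithinAt) (fun u hu => hI u hu)
      (left_mem_Icc.2 h01) ht
    rw [hF0, sub_zero] at this
    refine this.trans ?_
    rw [Real.norm_of_nonneg (by linarith [ht.1]), pow_succ, ← mul_assoc]
    have : 0 ≤ t₁ - t₀ := by linarith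
    gcongr
    exact ht.2

end Taylor

/-! ### One step of the method -/

section Step

variable {E : Type*} [NormedAddCommGroup E] [NormedSpace ℂ E]
variable {r : ℕ} {rk : RungeKutta (r + 1)} {p q : ℕ}

open RungeKutta

/-- Applying the last row of `(I + z A)⁻¹` to the stage residuals `Y - y₀ 𝟙 - A V` and eliminating
`V = F - z Y` gives exactly the defect of the step. Hence stage errors enter only through this row.
-/
theorem RungeKutta.Admissible.step_identity (h : rk.Admissible p q) {z : ℝ} (hz : 0 ≤ z)
    (Y V F : Fin (r + 1) → E) (y₀ : E) (hV : ∀ i, V i = F i - (z : ℂ) • Y i) :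
    Y (Fin.last r) - rk.stab (-(z : ℂ)) • y₀ - ∑ i, rk.resolventRow (-(z : ℂ)) i • F i =
      ∑ i, rk.stageInv (-(z : ℂ)) (Fin.last r) i • (Y i - y₀ - ∑ j, (rk.A i j : ℂ) • V j) := by
  have hz' : (-(z : ℂ)).re ≤ 0 := by simpa using hz
  have e1 : ∑ i, rk.stageInv (-(z : ℂ)) (Fin.last r) i • ∑ j, (rk.A i j : ℂ) • V j =
      ∑ j, rk.resolventRow (-(z : ℂ)) j • V j := by
    simp only [Finset.smul_sum, smul_smul]
    rw [Finset.sum_comm]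
    refine Finset.sum_congr rfl fun j _ => ?_
    rw [← Finset.sum_smul, h.resolventRow_eq hz']
  have e2 : ∑ i, rk.stageInv (-(z : ℂ)) (Fin.last r) i • Y i =
      Y (Fin.last r) - ∑ i, rk.resolventRow (-(z : ℂ)) i • (z : ℂ) • Y i := by
    simp only [h.stageInv_last hz', add_smul, smul_smul]
    rw [Finset.sum_add_distrib, sub_eq_add_neg, ← Finset.sum_neg_distrib]
    congr 1
    · simp [Matrix.one_apply]
    · refine Finset.sum_congr rfl fun i _ => ?_
      rw [← neg_smul]
      congr 1
      ring
  simp only [smul_sub, Finset.sum_sub_distrib]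
  rw [e1, e2, ← Finset.sum_smul, ← h.stab_eq hz']
  simp only [hV, smul_sub, Finset.sum_sub_distrib]
  abel

/-- Inserting Taylor polynomials in the stage residual leaves `stageDefect k` times `w k / k!`,
which vanishes for `k ≤ q`; the Taylor remainders, bounded by `B`, are estimated crudely. The
constant precedes the space `E`, so it is uniform over all spaces in which the data may lie. -/
theorem RungeKutta.Admissible.exists_step_bound (h : rk.Admissible p q) (hp : p ≤ q + 2) :
    ∃ C : ℝ, 0 < C ∧ ∀ (E : Type u) [NormedAddCommGroup E] [NormedSpace ℂ E] (z : ℝ), 0 ≤ z →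
      ∀ (Y V F : Fin (r + 1) → E) (y₀ : E) (w : ℕ → E) (B : ℝ),
      (∀ i, V i = F i - (z : ℂ) • Y i) →
      (∀ i, ‖Y i - y₀ - ∑ k ∈ Finset.Ioc 0 p, (rk.c i ^ k / (k.factorial : ℝ)) • w k‖ ≤ B) →
      (∀ i, ‖V i - ∑ k ∈ Finset.Ioc 0 p, (k * rk.c i ^ (k - 1) / (k.factorial : ℝ)) • w k‖ ≤ B) →
      ‖Y (Fin.last r) - rk.stab (-(z : ℂ)) • y₀ - ∑ i, rk.resolventRow (-(z : ℂ)) i • F i‖ ≤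
        C / (1 + z) * (∑ k ∈ Finset.Ioc q p, (min 1 z) ^ (p + 1 - k) * ‖w k‖ + B) := by
  obtain ⟨C₁, hC₁, hb₁⟩ := h.exists_resolventRow_bound
  obtain ⟨C₂, hC₂, hb₂⟩ := h.exists_defect_bound hp
  set S : ℝ := ∑ i, (1 + ∑ j, |rk.A i j|) with hS
  have hS0 : 0 ≤ S := by positivity
  refine ⟨C₂ + C₁ * S, by positivity, ?_⟩
  intro E _ _ z hz Y V F y₀ w B hV hY hV'
  have hz1 : 0 < 1 + z := by positivity
  have hB : 0 ≤ B := (norm_nonneg _).trans (hY 0)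
  rw [h.step_identity hz Y V F y₀ hV]
  set P : Fin (r + 1) → E := fun i =>
    ∑ k ∈ Finset.Ioc 0 p, (rk.c i ^ k / (k.factorial : ℝ)) • w k with hP
  set Q : Fin (r + 1) → E := fun i =>
    ∑ k ∈ Finset.Ioc 0 p, (k * rk.c i ^ (k - 1) / (k.factorial : ℝ)) • w k with hQ
  have hPQ : ∀ i, P i - ∑ j, (rk.A i j : ℂ) • Q j =
      ∑ k ∈ Finset.Ioc q p, (rk.stageDefect k i : ℂ) • ((k.factorial : ℝ)⁻¹ • w k) := by
    intro i
    have e1 : ∑ j, (rk.A i j : ℂ) • Q j = ∑ k ∈ Finset.Ioc 0 p,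
        ((k * ∑ j, rk.A i j * rk.c j ^ (k - 1)) / (k.factorial : ℝ)) • w k := by
      simp only [hQ, Complex.coe_smul, Finset.smul_sum, smul_smul]
      rw [Finset.sum_comm]
      refine Finset.sum_congr rfl fun k _ => ?_
      rw [← Finset.sum_smul, Finset.mul_sum, Finset.sum_div]
      congr 1
      exact Finset.sum_congr rfl fun j _ => by ring
    rw [e1, hP, ← Finset.sum_sub_distrib]
    symm
    refine (Finset.sum_subset (Finset.Ioc_subset_Ioc_left (Nat.zero_le q)) fun k hk hk' => ?_).trans
      (Finset.sum_congr rfl fun k _ => ?_)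
    · rw [Finset.mem_Ioc] at hk hk'
      rw [h.stageDefect_eq_zero (by omega) (by omega), Complex.ofReal_zero, zero_smul]
    · rw [Complex.coe_smul, smul_smul, ← sub_smul, stageDefect]
      congr 1
      ring
  have hsplit : ∀ i, Y i - y₀ - ∑ j, (rk.A i j : ℂ) • V j =
      (∑ k ∈ Finset.Ioc q p, (rk.stageDefect k i : ℂ) • ((k.factorial : ℝ)⁻¹ • w k)) +
      ((Y i - y₀ - P i) - ∑ j, (rk.A i j : ℂ) • (V j - Q j)) := by
    intro i
    rw [← hPQ]
    simp only [smul_sub, Finset.sum_sub_distrib]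
    abel
  have hrem : ∀ i, ‖(Y i - y₀ - P i) - ∑ j, (rk.A i j : ℂ) • (V j - Q j)‖ ≤
      (1 + ∑ j, |rk.A i j|) * B := by
    intro i
    refine (norm_sub_le _ _).trans ?_
    rw [add_mul, one_mul, Finset.sum_mul]
    refine add_le_add (hY i) ((norm_sum_le _ _).trans (Finset.sum_le_sum fun j _ => ?_))
    rw [norm_smul, Complex.norm_real, Real.norm_eq_abs]
    exact mul_le_mul_of_nonneg_left (hV' j) (abs_nonneg _)
  simp only [hsplit, smul_add, Finset.sum_add_distrib]
  have e2 : ∑ i, rk.stageInv (-(z : ℂ)) (Fin.last r) i •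
      ∑ k ∈ Finset.Ioc q p, (rk.stageDefect k i : ℂ) • ((k.factorial : ℝ)⁻¹ • w k) =
      ∑ k ∈ Finset.Ioc q p, (∑ i, rk.stageInv (-(z : ℂ)) (Fin.last r) i * (rk.stageDefect k i : ℂ)) •
        ((k.factorial : ℝ)⁻¹ • w k) := by
    simp only [Finset.smul_sum, Finset.sum_smul, smul_smul]
    exact Finset.sum_comm
  rw [e2]
  have b1 : ‖∑ k ∈ Finset.Ioc q p,
      (∑ i, rk.stageInv (-(z : ℂ)) (Fin.last r) i * (rk.stageDefect k i : ℂ)) •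
        ((k.factorial : ℝ)⁻¹ • w k)‖ ≤
      C₂ / (1 + z) * ∑ k ∈ Finset.Ioc q p, (min 1 z) ^ (p + 1 - k) * ‖w k‖ := by
    rw [Finset.mul_sum]
    refine (norm_sum_le _ _).trans (Finset.sum_le_sum fun k hk => ?_)
    have hf : (1 : ℝ) ≤ (k.factorial : ℝ) := by exact_mod_cast k.factorial_pos
    have hm : 0 ≤ min 1 z := le_min zero_le_one hz
    rw [norm_smul, norm_smul, norm_inv, Real.norm_of_nonneg (by linarith)]
    calc _ ≤ (C₂ * (min 1 z) ^ (p + 1 - k) / (1 + z)) * (1 * ‖w k‖) := by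
          gcongr
          · exact hb₂ k hk z hz
          · exact inv_le_one_of_one_le₀ hf
      _ = _ := by ring
  have b2 : ‖∑ i, rk.stageInv (-(z : ℂ)) (Fin.last r) i •
      ((Y i - y₀ - P i) - ∑ j, (rk.A i j : ℂ) • (V j - Q j))‖ ≤ C₁ * S / (1 + z) * B := by
    refine (norm_sum_le _ _).trans ?_
    calc _ ≤ ∑ i, C₁ / (1 + z) * ((1 + ∑ j, |rk.A i j|) * B) := by
          refine Finset.sum_le_sum fun i _ => ?_
          rw [norm_smul]
          gcongr
          · exact (hb₁ z hz).2 i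
          · exact hrem i
      _ = _ := by rw [← Finset.mul_sum, ← Finset.sum_mul]; ring
  refine (norm_add_le _ _).trans ((add_le_add b1 b2).trans ?_)
  have hsum : 0 ≤ ∑ k ∈ Finset.Ioc q p, (min 1 z) ^ (p + 1 - k) * ‖w k‖ :=
    Finset.sum_nonneg fun k _ => mul_nonneg (pow_nonneg (le_min zero_le_one hz) _) (norm_nonneg _)
  have : 0 ≤ C₁ * S / (1 + z) * ∑ k ∈ Finset.Ioc q p, (min 1 z) ^ (p + 1 - k) * ‖w k‖ := by
    positivity
  have : 0 ≤ C₂ / (1 + z) * B := by positivity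
  have e3 : (C₂ + C₁ * S) / (1 + z) = C₂ / (1 + z) + C₁ * S / (1 + z) := by ring
  rw [e3]
  linarith

/-- Defect of one Runge--Kutta step applied to a solution of `y' = -x y + f`. -/
noncomputable def localDefect (rk : RungeKutta (r + 1)) (x t τ : ℝ) (y f : ℝ → E) : E :=
  y (t + τ) - rk.stab (-((τ * x : ℝ) : ℂ)) • y t -
    (τ : ℂ) • ∑ i, rk.resolventRow (-((τ * x : ℝ) : ℂ)) i • f (t + rk.c i * τ)

theorem RungeKutta.Admissible.exists_localDefect_bound (h : rk.Admissible p q) (hp : p ≤ q + 2) :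
    ∃ C : ℝ, 0 < C ∧ ∀ (E : Type u) [NormedAddCommGroup E] [NormedSpace ℂ E] (x t τ B : ℝ)
      (v : ℕ → ℝ → E) (f : ℝ → E), 0 ≤ x → 0 ≤ τ →
      (∀ k < p, ∀ s ∈ Icc t (t + τ), HasDerivAt (v k) (v (k + 1) s) s) →
      (∀ s ∈ Icc t (t + τ), v 1 s = f s - x • v 0 s) →
      (∀ s ∈ Icc t (t + τ), ‖v p s - v p t‖ ≤ B) →
      ‖localDefect rk x t τ (v 0) f‖ ≤ C / (1 + τ * x) *
        (∑ k ∈ Finset.Ioc q p, (min 1 (τ * x)) ^ (p + 1 - k) * (τ ^ k * ‖v k t‖) + τ ^ p * B) := by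
  obtain ⟨C, hC, hb⟩ := h.exists_step_bound.{u} hp
  refine ⟨C, hC, ?_⟩
  intro E _ _ x t τ B v f hx hτ hv hode hB
  have hnode : ∀ i, t + rk.c i * τ ∈ Icc t (t + τ) := fun i =>
    ⟨by nlinarith [(h.c_mem i).1], by nlinarith [(h.c_mem i).2]⟩
  obtain ⟨p, rfl⟩ : ∃ l, p = l + 1 := ⟨p - 1, by have := h.one_le_p; omega⟩
  have hIoc : Finset.Ioc 0 (p + 1) = Finset.Ico 1 (p + 1 + 1) := by
    ext k; simp only [Finset.mem_Ioc, Finset.mem_Ico]; omega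
  -- The stage values need the expansion of `v 0`, the stage slopes that of `v 1` to one degree
  -- less; the slopes carry an additional factor `τ`, so both remainders are bounded by `τ^(p+1) B`.
  have hT1 := norm_taylor_le (p + 1) v (by linarith : t ≤ t + τ) hv hB
  have hT2 := norm_taylor_le p (fun k => v (k + 1)) (by linarith : t ≤ t + τ)
    (fun k hk => hv (k + 1) (by omega)) hB
  have key := hb E (τ * x) (by positivity) (fun i => v 0 (t + rk.c i * τ))
    (fun i => (τ : ℂ) • v 1 (t + rk.c i * τ)) (fun i => (τ : ℂ) • f (t + rk.c i * τ)) (v 0 t)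
    (fun k => τ ^ k • v k t) (τ ^ (p + 1) * B) ?_ ?_ ?_
  · rw [localDefect]
    have e : t + rk.c (Fin.last r) * τ = t + τ := by rw [h.c_last, one_mul]
    rw [e] at key
    convert key using 3
    · rw [Finset.smul_sum]
      refine Finset.sum_congr rfl fun i _ => ?_
      rw [smul_comm]
    · refine Finset.sum_congr rfl fun k _ => ?_
      rw [norm_smul, norm_pow, Real.norm_of_nonneg hτ]
  · intro i
    rw [hode _ (hnode i), smul_sub]
    congr 1
    rw [Complex.coe_smul, Complex.coe_smul, smul_smul]
  · intro i
    have := hT1 _ (hnode i)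
    rw [Finset.sum_range_succ'] at this
    rw [hIoc, Finset.sum_Ico_eq_sum_range, mul_comm (τ ^ (p + 1))]
    convert this using 2
    · simp only [pow_zero, Nat.factorial_zero, Nat.cast_one, div_one, one_smul, Nat.add_sub_cancel]
      rw [add_comm (∑ k ∈ Finset.range (p + 1), _) (v 0 t), ← sub_sub]
      congr 1
      refine Finset.sum_congr rfl fun k _ => ?_
      rw [smul_smul, add_comm 1 k]
      congr 1
      ring
    · ring
  · intro i
    have := hT2 _ (hnode i)
    rw [hIoc, Finset.sum_Ico_eq_sum_range]
    have e : (τ : ℂ) • v 1 (t + rk.c i * τ) - ∑ k ∈ Finset.range (p + 1 + 1 - 1),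
        (((1 + k : ℕ) : ℝ) * rk.c i ^ (1 + k - 1) / ((1 + k).factorial : ℝ)) •
          (τ ^ (1 + k) • v (1 + k) t) =
        τ • (v 1 (t + rk.c i * τ) - ∑ k ∈ Finset.range (p + 1),
          ((t + rk.c i * τ - t) ^ k / (k.factorial : ℝ)) • v (k + 1) t) := by
      rw [smul_sub, Complex.coe_smul, Finset.smul_sum, Nat.add_sub_cancel]
      congr 1
      refine Finset.sum_congr rfl fun k _ => ?_
      rw [smul_smul, smul_smul, add_comm 1 k, Nat.add_sub_cancel, Nat.factorial_succ]
      congr 1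
      have : ((k + 1 : ℕ) : ℝ) ≠ 0 := by positivity
      have : (k.factorial : ℝ) ≠ 0 := by positivity
      push_cast at *
      field_simp
      ring
    rw [e, norm_smul, Real.norm_of_nonneg hτ]
    calc _ ≤ τ * (B * (t + τ - t) ^ p) := by gcongr
      _ = _ := by rw [add_sub_cancel_left]; ring

/-- Crude bound for the defect of a single step. -/
theorem RungeKutta.Admissible.exists_localDefect_crude (h : rk.Admissible p q) :
    ∃ C : ℝ, 0 < C ∧ ∀ (E : Type u) [NormedAddCommGroup E] [NormedSpace ℂ E] (x τ B : ℝ)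
      (y f : ℝ → E), 0 ≤ x → 0 ≤ τ → y 0 = 0 → ‖y τ‖ ≤ B * τ / (1 + τ * x) →
      (∀ i, ‖f (rk.c i * τ)‖ ≤ B) →
      ‖localDefect rk x 0 τ y f‖ ≤ C * B * τ / (1 + τ * x) := by
  obtain ⟨C, hC, hb⟩ := h.exists_resolventRow_bound
  refine ⟨1 + (r + 1) * C, by positivity, ?_⟩
  intro E _ _ x τ B y f hx hτ h0 hy hf
  have hB : 0 ≤ B := (norm_nonneg _).trans (hf 0)
  have hz : 0 < 1 + τ * x := by positivity
  rw [localDefect, h0, smul_zero, sub_zero, zero_add]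
  refine (norm_sub_le _ _).trans ?_
  have : ‖(τ : ℂ) • ∑ i, rk.resolventRow (-((τ * x : ℝ) : ℂ)) i • f (0 + rk.c i * τ)‖ ≤
      τ * ((r + 1) * (C / (1 + τ * x) * B)) := by
    rw [norm_smul, Complex.norm_real, Real.norm_of_nonneg hτ]
    gcongr
    refine (norm_sum_le _ _).trans ?_
    have : ∀ i ∈ Finset.univ, ‖rk.resolventRow (-((τ * x : ℝ) : ℂ)) i • f (0 + rk.c i * τ)‖ ≤
        C / (1 + τ * x) * B := by
      intro i _
      rw [norm_smul, zero_add]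
      gcongr
      · exact (hb (τ * x) (by positivity)).1 i
      · exact hf i
    refine (Finset.sum_le_sum this).trans ?_
    simp
  refine (add_le_add hy this).trans (le_of_eq ?_)
  field_simp

end Step

end GCQ

namespace GCQ

/-! ### The graded mesh -/

section Mesh

variable {T γ : ℝ} {N : ℕ}

theorem gradedMesh_eq (hT : 0 < T) (hγ : 1 ≤ γ) (n : ℕ) :
    gradedMesh T γ N n = T * ((n : ℝ) / N) ^ γ := by
  have hγ0 : γ ≠ 0 := by positivity
  rw [gradedMesh, mul_div_left_comm, Real.mul_rpow (by positivity) (by positivity),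
    ← Real.rpow_mul hT.le, one_div_mul_cancel hγ0, Real.rpow_one]

theorem gradedMesh_zero (hγ : 1 ≤ γ) : gradedMesh T γ N 0 = 0 := by
  rw [gradedMesh, Nat.cast_zero, zero_mul, Real.zero_rpow (by positivity)]

theorem gradedMesh_pos (hT : 0 < T) (hγ : 1 ≤ γ) (hN : 1 ≤ N) {n : ℕ} (hn : 1 ≤ n) :
    0 < gradedMesh T γ N n := by
  rw [gradedMesh_eq hT hγ]
  positivity

theorem gradedMesh_nonneg (hT : 0 < T) (hγ : 1 ≤ γ) (n : ℕ) : 0 ≤ gradedMesh T γ N n := by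
  rw [gradedMesh_eq hT hγ]
  positivity

theorem gradedMesh_mono (hT : 0 < T) (hγ : 1 ≤ γ) : Monotone (gradedMesh T γ N) := by
  intro m n hmn
  rw [gradedMesh_eq hT hγ, gradedMesh_eq hT hγ]
  gcongr

theorem gradedMesh_le (hT : 0 < T) (hγ : 1 ≤ γ) {n : ℕ} (hn : n ≤ N) :
    gradedMesh T γ N n ≤ T := by
  rw [gradedMesh_eq hT hγ]
  have : ((n : ℝ) / N) ^ γ ≤ 1 := Real.rpow_le_one (by positivity)
    (div_le_one_of_le₀ (by exact_mod_cast hn) (by positivity)) (by positivity)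
  nlinarith

theorem gradedMesh_ratio (hT : 0 < T) (hγ : 1 ≤ γ) {i j : ℕ} (hj : 1 ≤ j) :
    gradedMesh T γ N i = ((i : ℝ) / j) ^ γ * gradedMesh T γ N j := by
  rw [gradedMesh_eq hT hγ, gradedMesh_eq hT hγ, mul_left_comm, ← Real.mul_rpow (by positivity)
    (by positivity)]
  congr 2
  have : (j : ℝ) ≠ 0 := by positivity
  field_simp

/-- For `γ ≥ 1` the mesh is a convex function of the index vanishing at `0`, so it lies below its
chords from the origin. -/
theorem gradedMesh_le_ratio (hT : 0 < T) (hγ : 1 ≤ γ) {i j : ℕ} (hj : 1 ≤ j) (hij : i ≤ j) :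
    gradedMesh T γ N i ≤ (i : ℝ) / j * gradedMesh T γ N j := by
  rw [gradedMesh_ratio hT hγ hj (i := i)]
  gcongr
  · exact gradedMesh_nonneg hT hγ j
  · have h1 : (i : ℝ) / j ≤ 1 := div_le_one_of_le₀ (by exact_mod_cast hij) (by positivity)
    calc _ ≤ ((i : ℝ) / j) ^ (1 : ℝ) :=
          Real.rpow_le_rpow_of_exponent_ge' (by positivity) h1 zero_le_one hγ
      _ = _ := Real.rpow_one _

/-- By convexity every step after `t_j` is at least the slope `t_j / j`. This turns elapsed time
into a number of steps in the damping factor. -/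
theorem gradedMesh_sub_ge (hT : 0 < T) (hγ : 1 ≤ γ) {j n : ℕ} (hj : 1 ≤ j) (hjn : j ≤ n) :
    gradedMesh T γ N j / j * ((n : ℝ) - j) ≤ gradedMesh T γ N n - gradedMesh T γ N j := by
  have h := gradedMesh_le_ratio (N := N) hT hγ (hj.trans hjn) hjn
  have hj0 : (0 : ℝ) < j := by positivity
  have hn0 : (0 : ℝ) < n := by exact_mod_cast hj.trans hjn
  rw [div_mul_eq_mul_div, le_div_iff₀ hn0] at h
  rw [div_mul_eq_mul_div, div_le_iff₀ hj0]
  linarith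

theorem gradedMesh_step_ge (hT : 0 < T) (hγ : 1 ≤ γ) {j : ℕ} (hj : 1 ≤ j) :
    gradedMesh T γ N j / j ≤ gradedMesh T γ N j - gradedMesh T γ N (j - 1) := by
  have h := gradedMesh_le_ratio (N := N) hT hγ hj (Nat.sub_le j 1)
  have hj0 : (0 : ℝ) < j := by positivity
  rw [div_mul_eq_mul_div, le_div_iff₀ hj0] at h
  rw [div_le_iff₀ hj0]
  push_cast [Nat.cast_sub hj] at h
  linarith

/-- Bernoulli's inequality for `(1 - 1/j)^γ`. -/
theorem gradedMesh_step_le (hT : 0 < T) (hγ : 1 ≤ γ) {j : ℕ} (hj : 1 ≤ j) :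
    gradedMesh T γ N j - gradedMesh T γ N (j - 1) ≤ γ * (gradedMesh T γ N j / j) := by
  have hj0 : (0 : ℝ) < j := by positivity
  have hj1 : (1 : ℝ) ≤ j := by exact_mod_cast hj
  have h1 := one_add_mul_self_le_rpow_one_add (s := -(1 / (j : ℝ)))
    (by rw [neg_le_neg_iff, div_le_one hj0]; exact hj1) hγ
  have e : ((j - 1 : ℕ) : ℝ) / j = 1 + -(1 / (j : ℝ)) := by
    rw [Nat.cast_sub hj]; field_simp; push_cast; ring
  rw [gradedMesh_ratio hT hγ hj (i := j - 1), e]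
  have := mul_le_mul_of_nonneg_right h1 (gradedMesh_nonneg (N := N) hT hγ j)
  have e2 : γ * (gradedMesh T γ N j / j) = (γ * (1 / j)) * gradedMesh T γ N j := by ring
  rw [e2]
  linarith

/-- From the second step on, the two ends of a step are comparable, so powers of `t_{j-1}` may be
replaced by powers of `t_j`. The first step, starting at `0`, needs separate treatment. -/
theorem gradedMesh_pred_ge (hT : 0 < T) (hγ : 1 ≤ γ) {j : ℕ} (hj : 2 ≤ j) :
    (1 / 2) ^ γ * gradedMesh T γ N j ≤ gradedMesh T γ N (j - 1) := by
  rw [gradedMesh_ratio hT hγ (by omega : 1 ≤ j) (i := j - 1)]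
  refine mul_le_mul_of_nonneg_right ?_ (gradedMesh_nonneg hT hγ j)
  · have hj0 : (2 : ℝ) ≤ j := by exact_mod_cast hj
    have hj1 : (0 : ℝ) < j := by linarith
    have : (1 : ℝ) / 2 ≤ ((j - 1 : ℕ) : ℝ) / j := by
      rw [le_div_iff₀ hj1, Nat.cast_sub (by omega)]
      push_cast
      linarith
    exact Real.rpow_le_rpow (by norm_num) this (by linarith)

end Mesh

/-! ### Accumulation of local defects -/

section Accumulation

variable {E : Type*} [NormedAddCommGroup E] [NormedSpace ℂ E] {s : ℕ}

theorem rkSol_succ (rk : RungeKutta s) (t : ℕ → ℝ) (f : ℝ → E) (x : ℝ) (n : ℕ) :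
    rkSol rk t f x (n + 1) =
      rk.stab (-(((t (n + 1) - t n) * x : ℝ) : ℂ)) • rkSol rk t f x n +
      ((t (n + 1) - t n : ℝ) : ℂ) •
        ∑ i, rk.resolventRow (-(((t (n + 1) - t n) * x : ℝ) : ℂ)) i •
          f (t n + rk.c i * (t (n + 1) - t n)) := by
  rw [rkSol, Finset.sum_Icc_succ_top (by omega), rkSol]
  refine congrArg₂ (· + ·) ?_ ?_
  · rw [Finset.smul_sum]
    refine Finset.sum_congr rfl fun j hj => ?_
    rw [Finset.mem_Icc] at hj
    rw [Finset.prod_Icc_succ_top (by omega), smul_smul _ _ (_ • _), mul_comm]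
    rfl
  · rw [Finset.Icc_eq_empty (by omega), Finset.prod_empty, one_smul]
    rfl

/-- The error obeys the recursion of the method with the local defect as source; unrolling it
propagates each defect by the later stability functions. -/
theorem norm_sub_rkSol_le {r : ℕ} (rk : RungeKutta (r + 1)) (t : ℕ → ℝ) (y f : ℝ → E) (x : ℝ)
    (h0 : y (t 0) = 0) (n : ℕ) :
    ‖y (t n) - rkSol rk t f x n‖ ≤ ∑ j ∈ Finset.Icc 1 n,
      (∏ l ∈ Finset.Icc (j + 1) n, ‖rk.stab (-(((t l - t (l - 1)) * x : ℝ) : ℂ))‖) *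
        ‖localDefect rk x (t (j - 1)) (t j - t (j - 1)) y f‖ := by
  induction n with
  | zero => simp [rkSol, h0]
  | succ n ih =>
    have e : y (t (n + 1)) - rkSol rk t f x (n + 1) =
        rk.stab (-(((t (n + 1) - t n) * x : ℝ) : ℂ)) • (y (t n) - rkSol rk t f x n) +
          localDefect rk x (t n) (t (n + 1) - t n) y f := by
      rw [rkSol_succ, localDefect, add_sub_cancel, smul_sub]
      abel
    rw [e, Finset.sum_Icc_succ_top (by omega)]
    refine (norm_add_le _ _).trans (add_le_add ?_ ?_)
    · rw [norm_smul]
      refine (mul_le_mul_of_nonneg_left ih (norm_nonneg _)).trans (le_of_eq ?_)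
      rw [Finset.mul_sum]
      refine Finset.sum_congr rfl fun j hj => ?_
      rw [Finset.mem_Icc] at hj
      rw [Finset.prod_Icc_succ_top (by omega)]
      simp only [Nat.add_sub_cancel]
      ring
    · rw [Finset.Icc_eq_empty (by omega), Finset.prod_empty, one_mul]
      simp

/-- Since `(1 + a)(1 + b) ≥ 1 + a + b` for nonnegative `a`, `b`, the product depends only on the
total elapsed time. First-order decay in `x` is all that is kept, and it suffices against `x^{-α}`.
-/
theorem prod_stab_le {r : ℕ} {rk : RungeKutta (r + 1)} {c : ℝ} (hc : 0 < c)
    (hb : ∀ z : ℝ, 0 ≤ z → ‖rk.stab (-(z : ℂ))‖ ≤ 1 / (1 + c * z)) {t : ℕ → ℝ} (ht : Monotone t)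
    {x : ℝ} (hx : 0 ≤ x) {j n : ℕ} (hjn : j ≤ n) :
    ∏ l ∈ Finset.Icc (j + 1) n, ‖rk.stab (-(((t l - t (l - 1)) * x : ℝ) : ℂ))‖ ≤
      1 / (1 + c * x * (t n - t j)) := by
  induction n, hjn using Nat.le_induction with
  | base => simp
  | succ n hjn ih =>
    rw [Finset.prod_Icc_succ_top (by omega), Nat.add_sub_cancel]
    have h1 : 0 ≤ t (n + 1) - t n := sub_nonneg.2 (ht (Nat.le_succ n))
    have h2 : 0 ≤ t n - t j := sub_nonneg.2 (ht hjn)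
    have h3 : 0 ≤ c * x * (t n - t j) := by positivity
    have h4 : 0 ≤ c * ((t (n + 1) - t n) * x) := by positivity
    refine (mul_le_mul ih (hb _ (by positivity)) (norm_nonneg _) (by positivity)).trans ?_
    rw [div_mul_div_comm, one_mul]
    apply one_div_le_one_div_of_le
    · have : 0 ≤ t (n + 1) - t j := by linarith
      positivity
    · nlinarith [mul_nonneg h3 h4]

end Accumulation

/-! ### Pointwise bound for the global error -/

/-- Elementary comparison of powers of comparable numbers. -/
theorem rpow_le_of_comparable {a s t : ℝ} (ha : 0 < a) (ha1 : a ≤ 1) (ht : 0 < t)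
    (h1 : a * t ≤ s) (h2 : s ≤ t) (e : ℝ) : s ^ e ≤ a ^ (-|e|) * t ^ e := by
  have hs : 0 < s := lt_of_lt_of_le (by positivity) h1
  have h3 : (1 : ℝ) ≤ a ^ (-|e|) :=
    Real.one_le_rpow_of_pos_of_le_one_of_nonpos ha ha1 (neg_nonpos.2 (abs_nonneg e))
  rcases le_total 0 e with he | he
  · calc s ^ e ≤ t ^ e := Real.rpow_le_rpow hs.le h2 he
      _ ≤ _ := le_mul_of_one_le_left (by positivity) h3
  · rw [abs_of_nonpos he, neg_neg, ← Real.mul_rpow ha.le ht.le]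
    exact Real.rpow_le_rpow_of_nonpos (by positivity) h1 he

/-- Here `v` stands for `(t_j / j) x`, so that `j v = x t_j`. The top degree `k = p` trades its
factor `v` for `1/j`. The only other case is `k = q + 1`, `p = q + 2`, where the second factor `v`
is kept as `v / (1 + v)^2`, to be spent later on the damping. -/
theorem defect_weight_le {p q k : ℕ} (hk : k ∈ Finset.Ioc q p) (hp : p ≤ q + 2) {j v : ℝ}
    (hj : 1 ≤ j) (hv : 0 ≤ v) :
    (j ^ k)⁻¹ * (min 1 v) ^ (p + 1 - k) / (1 + j * v) ≤
      (j ^ (p + 1))⁻¹ + 4 * (j ^ (q + 2))⁻¹ * (v / (1 + v) ^ 2) := by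
  rw [Finset.mem_Ioc] at hk
  have hj0 : 0 < j := by linarith
  have hm0 : 0 ≤ min 1 v := le_min zero_le_one hv
  have hden : 0 < 1 + j * v := by positivity
  rcases eq_or_ne k p with rfl | hkp
  · have e : k + 1 - k = 1 := by omega
    have h1 : min 1 v / (1 + j * v) ≤ j⁻¹ := by
      rw [div_le_iff₀ hden]
      calc min 1 v ≤ v := min_le_right _ _
        _ = j⁻¹ * (j * v) := by field_simp
        _ ≤ j⁻¹ * (1 + j * v) := by gcongr; linarith
    calc _ = (j ^ k)⁻¹ * (min 1 v / (1 + j * v)) := by rw [e, pow_one]; ring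
      _ ≤ (j ^ k)⁻¹ * j⁻¹ := by gcongr
      _ = (j ^ (k + 1))⁻¹ := by rw [pow_succ, mul_inv]
      _ ≤ _ := le_add_of_nonneg_right (by positivity)
  · obtain ⟨rfl, rfl⟩ : k = q + 1 ∧ p = q + 2 := by omega
    have e : q + 2 + 1 - (q + 1) = 2 := by omega
    have h1 : min 1 v ^ 2 / (1 + j * v) ≤ j⁻¹ * (4 * (v / (1 + v) ^ 2)) := by
      rw [div_le_iff₀ hden]
      have h2 : min 1 v ^ 2 ≤ 4 * (v / (1 + v) ^ 2) * v := by
        rw [mul_assoc, div_mul_eq_mul_div, mul_div_assoc', le_div_iff₀ (by positivity)]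
        rcases le_total v 1 with h | h
        · rw [min_eq_right h]
          have : (1 + v) ^ 2 ≤ 4 := by nlinarith
          have h3 := mul_le_mul_of_nonneg_left this (sq_nonneg v)
          linarith
        · rw [min_eq_left h]; nlinarith
      calc _ ≤ 4 * (v / (1 + v) ^ 2) * v := h2
        _ = j⁻¹ * (4 * (v / (1 + v) ^ 2)) * (j * v) := by field_simp
        _ ≤ _ := by gcongr; linarith
    calc _ = (j ^ (q + 1))⁻¹ * (min 1 v ^ 2 / (1 + j * v)) := by rw [e]; ring
      _ ≤ (j ^ (q + 1))⁻¹ * (j⁻¹ * (4 * (v / (1 + v) ^ 2))) := by gcongr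
      _ = 4 * (j ^ (q + 2))⁻¹ * (v / (1 + v) ^ 2) := by
          rw [pow_succ j (q + 1), mul_inv]; ring
      _ ≤ _ := le_add_of_nonneg_left (by positivity)

/-- A solution `v 0` of `y' = -x y + f`, `y 0 = 0` with chain of derivatives `v k` obeying the
bounds that hold for right-hand sides behaving like `t ^ β` near the origin. -/
structure HasSolutionBounds {E : Type*} [NormedAddCommGroup E] [NormedSpace ℂ E] {s : ℕ}
    (rk : RungeKutta s) (p q : ℕ) (β S x D : ℝ) (v : ℕ → ℝ → E) (f : ℝ → E) : Prop where
  hasDerivAt : ∀ k < p, ∀ t > 0, HasDerivAt (v k) (v (k + 1) t) t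
  ode : ∀ t > 0, v 1 t = f t - x • v 0 t
  zero : v 0 0 = 0
  bound_zero : ∀ t ∈ Ioc 0 S, ‖v 0 t‖ ≤ D * (t ^ (β + 1) / (1 + x * t))
  bound : ∀ k ∈ Finset.Ioc q p, ∀ t ∈ Ioc 0 S, ‖v k t‖ ≤ D * (t ^ (β + 1 - k) / (1 + x * t))
  lipschitz : ∀ s ∈ Ioc 0 S, ∀ t ∈ Icc s S,
    ‖v p t - v p s‖ ≤ D * ((s ^ (β - p) + t ^ (β - p)) * (t - s))
  node : ∀ i, ∀ t ∈ Ioc 0 S, ‖f (rk.c i * t)‖ ≤ D * t ^ β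

/-- The majorant of the global error, summand `j`. -/
noncomputable def errorWeight (T γ β c : ℝ) (p q N n j : ℕ) (x : ℝ) : ℝ :=
  gradedMesh T γ N j ^ (β + 1) *
    (((j : ℝ) ^ (p + 1))⁻¹ *
        (1 / (1 + c * max 1 ((n : ℝ) - j) * (gradedMesh T γ N j / j) * x)) +
      ((j : ℝ) ^ (q + 2))⁻¹ * (c * max 1 ((n : ℝ) - j))⁻¹ *
        (1 / (1 + gradedMesh T γ N j / j * x)))

theorem HasSolutionBounds.const_nonneg {E : Type*} [NormedAddCommGroup E] [NormedSpace ℂ E] {r : ℕ}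
    {rk : RungeKutta (r + 1)} {p q : ℕ} {β S x D : ℝ} {v : ℕ → ℝ → E} {f : ℝ → E}
    (hv : HasSolutionBounds rk p q β S x D v f) (hS : 0 < S) : 0 ≤ D :=
  nonneg_of_mul_nonneg_left ((norm_nonneg _).trans (hv.node 0 S ⟨hS, le_rfl⟩))
    (Real.rpow_pos_of_pos hS β)

/-- Weighted bound for the defect of the first step. -/
theorem RungeKutta.Admissible.exists_firstDefect_bound {r : ℕ} {rk : RungeKutta (r + 1)} {p q : ℕ}
    (h : rk.Admissible p q) (β : ℝ) :
    ∃ C : ℝ, 0 < C ∧ ∀ (E : Type u) [NormedAddCommGroup E] [NormedSpace ℂ E]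
      (x D S τ : ℝ) (v : ℕ → ℝ → E) (f : ℝ → E), 0 ≤ x → 0 < τ → τ ≤ S →
      HasSolutionBounds rk p q β S x D v f →
      ‖localDefect rk x 0 τ (v 0) f‖ ≤ C * D * (τ ^ (β + 1) / (1 + τ * x)) := by
  obtain ⟨C, hC, hb⟩ := h.exists_localDefect_crude.{u}
  refine ⟨C, hC, ?_⟩
  intro E _ _ x D S τ v f hx hτ hτS hv
  have hmem : τ ∈ Ioc 0 S := ⟨hτ, hτS⟩
  have := hb E x τ (D * τ ^ β) (v 0) f hx hτ.le hv.zero (by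
    refine (hv.bound_zero _ hmem).trans (le_of_eq ?_)
    rw [Real.rpow_add_one hτ.ne', mul_comm x]
    ring) (fun i => hv.node i _ hmem)
  refine this.trans (le_of_eq ?_)
  rw [Real.rpow_add_one hτ.ne']
  ring

/-- Bound for the `k`-th term of the Taylor expansion of the defect. -/
theorem defect_term_le {p q k : ℕ} (hk : k ∈ Finset.Ioc q p) (hp : p ≤ q + 2)
    {β γ a s t τ x D j V : ℝ} (hγ : 1 ≤ γ) (ha : 0 < a) (ha1 : a ≤ 1) (hs : 0 < s)
    (h1 : a * t ≤ s) (h2 : s ≤ t) (hj : 1 ≤ j) (hx : 0 ≤ x) (hτ : 0 ≤ τ)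
    (hτ2 : τ ≤ γ * (t / j)) (hD : 0 ≤ D) (hV0 : 0 ≤ V)
    (hV : V ≤ D * (s ^ (β + 1 - k) / (1 + x * s))) :
    (min 1 (τ * x)) ^ (p + 1 - k) * (τ ^ k * V) ≤
      4 * (γ ^ (p + 1 - k) * (γ ^ k * a ^ (-|β + 1 - k|) * a⁻¹)) * (D * (t ^ (β + 1) *
        ((j ^ (p + 1))⁻¹ + (j ^ (q + 2))⁻¹ * (t / j * x / (1 + t / j * x) ^ 2)))) := by
  have ht : 0 < t := hs.trans_le h2
  have hj0 : 0 < j := by linarith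
  have hγ0 : 0 < γ := by linarith
  set lam : ℝ := t / j with hlam
  have hlam0 : 0 < lam := by positivity
  set w : ℝ := lam * x with hw
  have hw0 : 0 ≤ w := by positivity
  have hzw : τ * x ≤ γ * w := by
    rw [hw, ← mul_assoc]; exact mul_le_mul_of_nonneg_right hτ2 hx
  have hxt : x * t = j * w := by rw [hw, hlam]; field_simp
  set Q : ℝ := (j ^ (p + 1))⁻¹ + (j ^ (q + 2))⁻¹ * (w / (1 + w) ^ 2) with hQ
  have b1 : min 1 (τ * x) ≤ γ * min 1 w := by
    rcases le_total 1 w with h | h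
    · rw [min_eq_left h]; exact (min_le_left _ _).trans (by linarith)
    · rw [min_eq_right h]; exact (min_le_right _ _).trans hzw
  have b3 := rpow_le_of_comparable ha ha1 ht h1 h2 (β + 1 - k)
  have b4 : 1 / (1 + x * s) ≤ a⁻¹ * (1 / (1 + j * w)) := by
    rw [← hxt, ← one_div, div_mul_div_comm, one_mul]
    apply one_div_le_one_div_of_le (by positivity)
    nlinarith
  have hpre : lam ^ k * t ^ (β + 1 - k) = t ^ (β + 1) * (j ^ k)⁻¹ := by
    rw [hlam, div_pow, Real.rpow_sub ht, Real.rpow_natCast]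
    field_simp
  have hmz : 0 ≤ min 1 (τ * x) := le_min zero_le_one (by positivity)
  have hmw : 0 ≤ min 1 w := le_min zero_le_one hw0
  have b5 : V ≤ D * (a ^ (-|β + 1 - k|) * t ^ (β + 1 - k) * (a⁻¹ * (1 / (1 + j * w)))) := by
    refine hV.trans ?_
    rw [div_eq_mul_one_div]
    have : 0 ≤ s ^ (β + 1 - k) := (Real.rpow_pos_of_pos hs _).le
    refine mul_le_mul_of_nonneg_left (mul_le_mul b3 b4 (by positivity) (by positivity)) hD
  calc _ ≤ (γ * min 1 w) ^ (p + 1 - k) * ((γ * lam) ^ k *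
        (D * (a ^ (-|β + 1 - k|) * t ^ (β + 1 - k) * (a⁻¹ * (1 / (1 + j * w)))))) := by
        refine mul_le_mul (pow_le_pow_left₀ hmz b1 _) (mul_le_mul (pow_le_pow_left₀ hτ hτ2 _)
          b5 hV0 (by positivity)) (by positivity) (by positivity)
    _ = γ ^ (p + 1 - k) * min 1 w ^ (p + 1 - k) * (γ ^ k *
              (D * (a ^ (-|β + 1 - k|) * (lam ^ k * t ^ (β + 1 - k)) *
                (a⁻¹ * (1 / (1 + j * w)))))) := by rw [mul_pow, mul_pow]; ring
    _ = γ ^ (p + 1 - k) * (γ ^ k * a ^ (-|β + 1 - k|) * a⁻¹) * (D * (t ^ (β + 1) *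
        ((j ^ k)⁻¹ * min 1 w ^ (p + 1 - k) / (1 + j * w)))) := by rw [hpre]; ring
    _ ≤ γ ^ (p + 1 - k) * (γ ^ k * a ^ (-|β + 1 - k|) * a⁻¹) * (D * (t ^ (β + 1) * (4 * Q))) := by
        have hA : 0 ≤ γ ^ (p + 1 - k) * (γ ^ k * a ^ (-|β + 1 - k|) * a⁻¹) := by positivity
        have ht' : 0 ≤ t ^ (β + 1) := by positivity
        refine mul_le_mul_of_nonneg_left (mul_le_mul_of_nonneg_left
          (mul_le_mul_of_nonneg_left ?_ ht') hD) hA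
        refine (defect_weight_le hk hp hj hw0).trans ?_
        rw [hQ, mul_add, ← mul_assoc]
        have : 0 ≤ (j ^ (p + 1))⁻¹ := by positivity
        linarith
    _ = _ := by ring

/-- Weighted bound for the defect of the steps after the first one. -/
theorem RungeKutta.Admissible.exists_laterDefect_bound {r : ℕ} {rk : RungeKutta (r + 1)} {p q : ℕ}
    (h : rk.Admissible p q) (hp : p ≤ q + 2) (β : ℝ) {γ a : ℝ} (hγ : 1 ≤ γ) (ha : 0 < a)
    (ha1 : a ≤ 1) :
    ∃ C : ℝ, 0 < C ∧ ∀ (E : Type u) [NormedAddCommGroup E] [NormedSpace ℂ E]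
      (x D S s t j : ℝ) (v : ℕ → ℝ → E) (f : ℝ → E), 0 ≤ x → 0 < s → a * t ≤ s → s ≤ t →
      t ≤ S → 1 ≤ j → t / j ≤ t - s → t - s ≤ γ * (t / j) →
      HasSolutionBounds rk p q β S x D v f →
      ‖localDefect rk x s (t - s) (v 0) f‖ ≤ C * D * (t ^ (β + 1) *
        ((j ^ (p + 1))⁻¹ + (j ^ (q + 2))⁻¹ * (t / j * x / (1 + t / j * x) ^ 2)) /
          (1 + t / j * x)) := by
  obtain ⟨C, hC, hloc⟩ := h.exists_localDefect_bound.{u} hp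
  have hγ0 : 0 < γ := by linarith
  set A : ℕ → ℝ := fun k => γ ^ (p + 1 - k) * (γ ^ k * a ^ (-|β + 1 - k|) * a⁻¹) with hA
  have hA0 : ∀ k, 0 < A k := fun k => by positivity
  set L : ℝ := γ ^ (p + 1) * (2 * a ^ (-|β - p|)) with hL
  have hL0 : 0 < L := by positivity
  have hsA : 0 ≤ ∑ k ∈ Finset.Ioc q p, 4 * A k :=
    Finset.sum_nonneg fun k _ => (mul_pos four_pos (hA0 k)).le
  refine ⟨C * (∑ k ∈ Finset.Ioc q p, 4 * A k + L), by positivity, ?_⟩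
  intro E _ _ x D S s t j v f hx hs hs1 hs2 hS1 hj hτ1 hτ2 hv
  have ht : 0 < t := hs.trans_le hs2
  have hD : 0 ≤ D := hv.const_nonneg (ht.trans_le hS1)
  set τ : ℝ := t - s with hτ
  have hj0 : 0 < j := by linarith
  have hτ0 : 0 ≤ τ := by rw [hτ]; linarith
  have hsτ : s + τ = t := by rw [hτ]; ring
  have hsp : ∀ u ∈ Icc s (s + τ), 0 < u := fun u hu => hs.trans_le hu.1
  have hB : ∀ u ∈ Icc s (s + τ), ‖v p u - v p s‖ ≤
      D * (2 * a ^ (-|β - p|) * t ^ (β - p) * τ) := by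
    intro u hu
    have hu2 : u ≤ t := by rw [← hsτ]; exact hu.2
    refine (hv.lipschitz s ⟨hs, hs2.trans hS1⟩ u ⟨hu.1, hu2.trans hS1⟩).trans ?_
    have b1 := rpow_le_of_comparable ha ha1 ht hs1 hs2 (β - p)
    have b2 := rpow_le_of_comparable ha ha1 ht (hs1.trans hu.1) hu2 (β - p)
    have b3 : u - s ≤ τ := by linarith [hu.2]
    have b4 : 0 ≤ u - s := by linarith [hu.1]
    refine mul_le_mul_of_nonneg_left (mul_le_mul ?_ b3 b4 (by positivity)) hD
    linarith
  refine (hloc E x s τ _ v f hx hτ0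
    (fun k hk u hu => hv.hasDerivAt k hk u (hsp u hu)) (fun u hu => hv.ode u (hsp u hu)) hB).trans ?_
  set w : ℝ := t / j * x with hw
  have hw0 : 0 ≤ w := by positivity
  have hwz : w ≤ τ * x := mul_le_mul_of_nonneg_right hτ1 hx
  set Q : ℝ := (j ^ (p + 1))⁻¹ + (j ^ (q + 2))⁻¹ * (w / (1 + w) ^ 2) with hQ
  have hQ0 : 0 ≤ Q := by positivity
  have hlast : τ ^ p * (D * (2 * a ^ (-|β - p|) * t ^ (β - p) * τ)) ≤
      L * (D * (t ^ (β + 1) * Q)) := by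
    have hpre : (t / j) ^ (p + 1) * t ^ (β - p) = t ^ (β + 1) * (j ^ (p + 1))⁻¹ := by
      have : β - p = β + 1 - ((p + 1 : ℕ) : ℝ) := by push_cast; ring
      rw [this, div_pow, Real.rpow_sub ht, Real.rpow_natCast]
      field_simp
    calc _ = τ ^ (p + 1) * (D * (2 * a ^ (-|β - p|) * t ^ (β - p))) := by ring
      _ ≤ (γ * (t / j)) ^ (p + 1) * (D * (2 * a ^ (-|β - p|) * t ^ (β - p))) :=
          mul_le_mul_of_nonneg_right (pow_le_pow_left₀ hτ0 hτ2 _) (by positivity)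
      _ = L * (D * ((t / j) ^ (p + 1) * t ^ (β - p))) := by rw [hL]; ring
      _ = L * (D * (t ^ (β + 1) * (j ^ (p + 1))⁻¹)) := by rw [hpre]
      _ ≤ _ := by
          have : (j ^ (p + 1))⁻¹ ≤ Q := le_add_of_nonneg_right (by positivity)
          have ht' : 0 ≤ t ^ (β + 1) := by positivity
          exact mul_le_mul_of_nonneg_left (mul_le_mul_of_nonneg_left
            (mul_le_mul_of_nonneg_left this ht') hD) hL0.le
  have hsum : ∑ k ∈ Finset.Ioc q p, (min 1 (τ * x)) ^ (p + 1 - k) * (τ ^ k * ‖v k s‖) ≤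
      ∑ k ∈ Finset.Ioc q p, 4 * A k * (D * (t ^ (β + 1) * Q)) :=
    Finset.sum_le_sum fun k hk => defect_term_le hk hp hγ ha ha1 hs hs1 hs2 hj hx hτ0 hτ2 hD
      (norm_nonneg _) (hv.bound k hk s ⟨hs, hs2.trans hS1⟩)
  have hm : 0 ≤ min 1 (τ * x) := le_min zero_le_one (by positivity)
  calc _ ≤ C / (1 + w) * (∑ k ∈ Finset.Ioc q p, 4 * A k * (D * (t ^ (β + 1) * Q)) +
        L * (D * (t ^ (β + 1) * Q))) := by
        refine mul_le_mul ?_ (add_le_add hsum hlast) (by positivity) (by positivity)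
        exact div_le_div_of_nonneg_left hC.le (by positivity) (by linarith)
    _ = _ := by
        rw [← Finset.sum_mul]
        ring

/-- With no later step (`d = 0`) there is no propagated damping, and the factor `1 / (1 + w)` of the
step itself takes over; hence `max 1 d`. In the `Q₂` term the spare `w` is exchanged for the
summable factor `1 / (c max 1 d)`, leaving `1 / (1 + w)` for integrability in `x`. -/
theorem damping_le {c d w Q₁ Q₂ : ℝ} (hc : 0 < c) (hc1 : c ≤ 1) (hd : 0 ≤ d) (hw : 0 ≤ w)
    (hQ₁ : 0 ≤ Q₁) (hQ₂ : 0 ≤ Q₂) :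
    1 / (1 + c * d * w) * ((Q₁ + Q₂ * (w / (1 + w) ^ 2)) / (1 + w)) ≤
      Q₁ * (1 / (1 + c * max 1 d * w)) + Q₂ * (c * max 1 d)⁻¹ * (1 / (1 + w)) := by
  set m : ℝ := max 1 d with hm
  have hm1 : 1 ≤ m := le_max_left _ _
  have hm0 : 0 < m := by linarith
  have hkey : 1 / (1 + c * d * w) * (1 / (1 + w)) ≤ 1 / (1 + c * m * w) := by
    rw [div_mul_div_comm, one_mul]
    apply one_div_le_one_div_of_le (by positivity)
    have : c * m * w ≤ c * d * w + w := by
      rcases max_cases 1 d with ⟨h1, h2⟩ | ⟨h1, h2⟩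
      · rw [hm, h1]
        have : 0 ≤ c * d * w := by positivity
        nlinarith
      · rw [hm, h1]; linarith
    have : 0 ≤ c * d * w * w := by positivity
    nlinarith
  have hkey2 : w / (1 + w) ^ 2 * (1 / (1 + c * m * w)) ≤ (c * m)⁻¹ * (1 / (1 + w)) := by
    have b1 : w * (1 / (1 + c * m * w)) ≤ (c * m)⁻¹ := by
      rw [mul_one_div, div_le_iff₀ (by positivity)]
      have : (c * m)⁻¹ * (1 + c * m * w) = (c * m)⁻¹ + w := by field_simp
      rw [this]
      exact le_add_of_nonneg_left (by positivity)
    have b2 : 1 / (1 + w) ^ 2 ≤ 1 / (1 + w) := by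
      apply one_div_le_one_div_of_le (by positivity)
      nlinarith
    calc _ = (w * (1 / (1 + c * m * w))) * (1 / (1 + w) ^ 2) := by ring
      _ ≤ _ := mul_le_mul b1 b2 (by positivity) (by positivity)
  calc _ = (Q₁ + Q₂ * (w / (1 + w) ^ 2)) * (1 / (1 + c * d * w) * (1 / (1 + w))) := by ring
    _ ≤ (Q₁ + Q₂ * (w / (1 + w) ^ 2)) * (1 / (1 + c * m * w)) :=
        mul_le_mul_of_nonneg_left hkey (by positivity)
    _ = Q₁ * (1 / (1 + c * m * w)) + Q₂ * (w / (1 + w) ^ 2 * (1 / (1 + c * m * w))) := by ring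
    _ ≤ Q₁ * (1 / (1 + c * m * w)) + Q₂ * ((c * m)⁻¹ * (1 / (1 + w))) := by
        have := mul_le_mul_of_nonneg_left hkey2 hQ₂
        linarith
    _ = _ := by ring

theorem RungeKutta.Admissible.exists_globalError_bound {r : ℕ} {rk : RungeKutta (r + 1)} {p q : ℕ}
    (h : rk.Admissible p q) (hp : p ≤ q + 2) (β : ℝ) {γ : ℝ} (hγ : 1 ≤ γ) :
    ∃ C c : ℝ, 0 < C ∧ 0 < c ∧ ∀ (E : Type u) [NormedAddCommGroup E] [NormedSpace ℂ E]
      (T x D : ℝ) (N n : ℕ) (v : ℕ → ℝ → E) (f : ℝ → E), 0 < T → 0 ≤ x → 1 ≤ N → 1 ≤ n →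
      HasSolutionBounds rk p q β (gradedMesh T γ N n) x D v f →
      ‖v 0 (gradedMesh T γ N n) - rkSol rk (gradedMesh T γ N) f x n‖ ≤
        C * D * ∑ j ∈ Finset.Icc 1 n, errorWeight T γ β c p q N n j x := by
  obtain ⟨c, hc, hc1, hstab⟩ := h.exists_stab_bound
  have ha0 : (0 : ℝ) < (1 / 2) ^ γ := by positivity
  have ha1 : (1 / 2 : ℝ) ^ γ ≤ 1 := Real.rpow_le_one (by norm_num) (by norm_num) (by linarith)
  obtain ⟨C₁, hC₁, hfirst⟩ := h.exists_firstDefect_bound.{u} β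
  obtain ⟨C₂, hC₂, hlater⟩ := h.exists_laterDefect_bound.{u} hp β hγ ha0 ha1
  refine ⟨C₁ + C₂, c, by positivity, hc, ?_⟩
  intro E _ _ T x D N n v f hT hx hN hn hv
  set t := gradedMesh T γ N with ht
  have htm : Monotone t := gradedMesh_mono hT hγ
  have htpos : ∀ {j}, 1 ≤ j → 0 < t j := fun hj => gradedMesh_pos hT hγ hN hj
  have ht0 : t 0 = 0 := gradedMesh_zero hγ
  have hD : 0 ≤ D := hv.const_nonneg (htpos hn)
  refine (norm_sub_rkSol_le rk t (v 0) f x (by rw [ht0, hv.zero]) n).trans ?_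
  rw [Finset.mul_sum]
  refine Finset.sum_le_sum fun j hj => ?_
  rw [Finset.mem_Icc] at hj
  obtain ⟨hj1, hjn⟩ := hj
  have hjR : (1 : ℝ) ≤ j := by exact_mod_cast hj1
  have hj0 : (0 : ℝ) < j := by linarith
  have htj := htpos hj1
  have hw0 : 0 ≤ t j / j * x := by positivity
  have hdef : ‖localDefect rk x (t (j - 1)) (t j - t (j - 1)) (v 0) f‖ ≤ (C₁ + C₂) * D *
      (t j ^ (β + 1) * (((j : ℝ) ^ (p + 1))⁻¹ +
        ((j : ℝ) ^ (q + 2))⁻¹ * (t j / j * x / (1 + t j / j * x) ^ 2)) / (1 + t j / j * x)) := by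
    have hnn : 0 ≤ t j ^ (β + 1) * (((j : ℝ) ^ (p + 1))⁻¹ +
        ((j : ℝ) ^ (q + 2))⁻¹ * (t j / j * x / (1 + t j / j * x) ^ 2)) / (1 + t j / j * x) := by
      positivity
    -- For `j = 1` the step starts at `0`, where no derivative bounds are available. The crude
    -- defect bound is enough there, because `j^{-(p+1)} = 1`.
    rcases eq_or_lt_of_le hj1 with rfl | hj2
    · have := hfirst E x D (t n) (t 1) v f hx htj (htm hjn) hv
      rw [Nat.sub_self, ht0, sub_zero]
      refine this.trans ?_
      simp only [Nat.cast_one, one_pow, inv_one, div_one, one_mul] at hw0 ⊢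
      refine mul_le_mul (mul_le_mul_of_nonneg_right (by linarith) hD) ?_ (by positivity)
        (by positivity)
      refine div_le_div_of_nonneg_right (le_mul_of_one_le_right (by positivity) ?_) (by positivity)
      exact le_add_of_nonneg_right (by positivity)
    · have := hlater E x D (t n) (t (j - 1)) (t j) j v f hx (htpos (by omega))
        (gradedMesh_pred_ge hT hγ hj2) (htm (Nat.sub_le j 1)) (htm hjn) hjR
        (gradedMesh_step_ge hT hγ hj1) (gradedMesh_step_le hT hγ hj1) hv
      exact this.trans (mul_le_mul_of_nonneg_right
        (mul_le_mul_of_nonneg_right (by linarith) hD) hnn)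
  have hnj : (0 : ℝ) ≤ (n : ℝ) - j := by
    rw [sub_nonneg]; exact_mod_cast hjn
  have hdamp : ∏ l ∈ Finset.Icc (j + 1) n, ‖rk.stab (-(((t l - t (l - 1)) * x : ℝ) : ℂ))‖ ≤
      1 / (1 + c * ((n : ℝ) - j) * (t j / j * x)) := by
    refine (prod_stab_le hc hstab htm hx hjn).trans ?_
    have h1 : t j / j * ((n : ℝ) - j) ≤ t n - t j := gradedMesh_sub_ge hT hγ hj1 hjn
    apply one_div_le_one_div_of_le (by positivity)
    have : c * x * (t j / j * ((n : ℝ) - j)) ≤ c * x * (t n - t j) := by gcongr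
    linarith
  have hfin := damping_le hc hc1 hnj hw0 (Q₁ := ((j : ℝ) ^ (p + 1))⁻¹)
    (Q₂ := ((j : ℝ) ^ (q + 2))⁻¹) (by positivity) (by positivity)
  have hpre : 0 ≤ (C₁ + C₂) * D * t j ^ (β + 1) := by positivity
  refine (mul_le_mul hdamp hdef (norm_nonneg _) (by positivity)).trans ?_
  rw [errorWeight, ← ht]
  refine (le_of_eq ?_).trans ((mul_le_mul_of_nonneg_left hfin hpre).trans (le_of_eq ?_))
  · ring
  · ring

end GCQ

namespace GCQ

/-! ### Integrating the error majorant against `x ^ (-α)` -/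

section Weights

variable {α : ℝ}

theorem integrableOn_rpow_div_one_add (hα0 : 0 < α) (hα1 : α < 1) :
    IntegrableOn (fun x : ℝ => x ^ (-α) * (1 / (1 + x))) (Ioi 0) := by
  have hm : ∀ s : Set ℝ, AEStronglyMeasurable (fun x : ℝ => x ^ (-α) * (1 / (1 + x)))
      (volume.restrict s) := fun s => by
    apply Measurable.aestronglyMeasurable
    fun_prop
  rw [← Ioc_union_Ioi_eq_Ioi (zero_le_one (α := ℝ))]
  refine IntegrableOn.union ?_ ?_
  · have h1 : IntegrableOn (fun x : ℝ => x ^ (-α)) (Ioc 0 1) := by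
      have := intervalIntegral.intervalIntegrable_rpow' (a := 0) (b := 1) (r := -α) (by linarith)
      rwa [intervalIntegrable_iff_integrableOn_Ioc_of_le zero_le_one] at this
    refine Integrable.mono' h1 (hm _) ?_
    filter_upwards [ae_restrict_mem measurableSet_Ioc] with x hx
    have hx0 : 0 < x := hx.1
    rw [Real.norm_of_nonneg (by positivity)]
    refine mul_le_of_le_one_right (by positivity) ?_
    rw [div_le_one (by positivity)]
    linarith
  · have h1 : IntegrableOn (fun x : ℝ => x ^ (-α - 1)) (Ioi 1) :=
      integrableOn_Ioi_rpow_of_lt (by linarith) zero_lt_one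
    refine Integrable.mono' h1 (hm _) ?_
    filter_upwards [ae_restrict_mem measurableSet_Ioi] with x hx
    have hx0 : 0 < x := lt_trans zero_lt_one hx
    rw [Real.norm_of_nonneg (by positivity), Real.rpow_sub_one hx0.ne',
      div_eq_mul_one_div (x ^ (-α)) x]
    gcongr
    linarith

/-- The integral `∫₀^∞ x ^ (-α) / (1 + x) dx`. -/
noncomputable def weightIntegral (α : ℝ) : ℝ := ∫ x in Ioi (0 : ℝ), x ^ (-α) * (1 / (1 + x))

theorem weightIntegral_nonneg : 0 ≤ weightIntegral α := by
  refine setIntegral_nonneg measurableSet_Ioi fun x hx => ?_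
  have : (0 : ℝ) < x := hx
  positivity

theorem rpow_div_one_add_mul_eq {l x : ℝ} (hl : 0 < l) (hx : 0 < x) :
    x ^ (-α) * (1 / (1 + l * x)) = l ^ α * ((l * x) ^ (-α) * (1 / (1 + l * x))) := by
  rw [Real.mul_rpow hl.le hx.le, ← mul_assoc, ← mul_assoc, ← Real.rpow_add hl]
  simp

theorem integrableOn_rpow_div_one_add_mul (hα0 : 0 < α) (hα1 : α < 1) {l : ℝ} (hl : 0 < l) :
    IntegrableOn (fun x : ℝ => x ^ (-α) * (1 / (1 + l * x))) (Ioi 0) := by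
  have h1 : IntegrableOn (fun x : ℝ => (l * x) ^ (-α) * (1 / (1 + l * x))) (Ioi 0) := by
    have := (integrableOn_Ioi_comp_mul_left_iff
      (fun x : ℝ => x ^ (-α) * (1 / (1 + x))) 0 hl).2
      (by rw [mul_zero]; exact integrableOn_rpow_div_one_add hα0 hα1)
    exact this
  exact IntegrableOn.congr_fun (h1.const_mul (l ^ α))
    (fun x hx => (rpow_div_one_add_mul_eq hl hx).symm) measurableSet_Ioi

/-- Scaling `x ↦ λ x`. All powers of the step size gained by integrating over `x` come from this
factor `λ^{α-1}`. -/
theorem integral_rpow_div_one_add_mul {l : ℝ} (hl : 0 < l) :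
    ∫ x in Ioi (0 : ℝ), x ^ (-α) * (1 / (1 + l * x)) = l ^ (α - 1) * weightIntegral α := by
  rw [setIntegral_congr_fun measurableSet_Ioi fun x hx => rpow_div_one_add_mul_eq hl hx,
    integral_const_mul]
  have := integral_comp_mul_left_Ioi (fun x : ℝ => x ^ (-α) * (1 / (1 + x))) 0 hl
  rw [this, mul_zero, smul_eq_mul, ← mul_assoc, Real.rpow_sub_one hl.ne']
  rfl

theorem sum_inv_le (n : ℕ) : ∑ j ∈ Finset.Icc 1 n, ((j : ℝ))⁻¹ ≤ 1 + Real.log n := by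
  have := harmonic_le_one_add_log n
  rw [harmonic_eq_sum_Icc] at this
  push_cast at this
  exact this

theorem sum_inv_max_sub_le {n : ℕ} (hn : 1 ≤ n) :
    ∑ j ∈ Finset.Icc 1 n, (max 1 ((n : ℝ) - j))⁻¹ ≤ 2 + Real.log n := by
  obtain ⟨n, rfl⟩ : ∃ l, n = l + 1 := ⟨n - 1, by omega⟩
  rw [Finset.sum_Icc_succ_top (by omega)]
  have h1 : ∑ j ∈ Finset.Icc 1 n, (max 1 (((n + 1 : ℕ) : ℝ) - j))⁻¹ =
      ∑ j ∈ Finset.Icc 1 n, ((j : ℝ))⁻¹ := by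
    refine Finset.sum_bij' (fun j _ => n + 1 - j) (fun j _ => n + 1 - j) ?_ ?_ ?_ ?_ ?_
    · intro j hj; rw [Finset.mem_Icc] at *; omega
    · intro j hj; rw [Finset.mem_Icc] at *; omega
    · intro j hj; rw [Finset.mem_Icc] at hj; omega
    · intro j hj; rw [Finset.mem_Icc] at hj; omega
    · intro j hj
      rw [Finset.mem_Icc] at hj
      rw [Nat.cast_sub (by omega), max_eq_right]
      have : (j : ℝ) + 1 ≤ ((n + 1 : ℕ) : ℝ) := by exact_mod_cast Nat.succ_le_succ hj.2
      linarith
  rw [h1]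
  have h2 := sum_inv_le n
  have h3 : Real.log n ≤ Real.log ((n + 1 : ℕ) : ℝ) := by
    rcases Nat.eq_zero_or_pos n with rfl | hn
    · simp
    · exact Real.log_le_log (by positivity) (by push_cast; linarith)
  simp only [sub_self]
  norm_num at *
  linarith

end Weights

/-- Weighted arithmetic-geometric mean. It splits the mixed weight in `j` and `n - j` into two terms
with harmonic sums. -/
theorem rpow_mul_rpow_le_inv_add_inv {α a b : ℝ} (hα0 : 0 < α) (hα1 : α < 1) (ha : 1 ≤ a)
    (hb : 1 ≤ b) : a ^ (-α) * b ^ (α - 1) ≤ a⁻¹ + b⁻¹ := by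
  have h := Real.geom_mean_le_arith_mean2_weighted hα0.le (by linarith : 0 ≤ 1 - α)
    (p₁ := a⁻¹) (p₂ := b⁻¹) (by positivity) (by positivity) (by ring)
  rw [Real.inv_rpow (by linarith), Real.inv_rpow (by linarith), ← Real.rpow_neg (by linarith),
    ← Real.rpow_neg (by linarith), neg_sub] at h
  refine h.trans (add_le_add ?_ ?_)
  · exact mul_le_of_le_one_left (by positivity) hα1.le
  · exact mul_le_of_le_one_left (by positivity) (by linarith)

/-- Up to `T^e` the left side is `N^{-γ e} j^{γ e - ρ}`, monotone in `j`. Bounding it by its value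
at `j = 1` or at `j = N`, according to the sign of the exponent, produces the minimum in the rate.
-/
theorem mesh_rpow_le {T γ ρ e : ℝ} {N j : ℕ} (hT : 0 < T) (hγ : 1 ≤ γ) (hj : 1 ≤ j)
    (hjN : j ≤ N) :
    gradedMesh T γ N j ^ e * (j : ℝ) ^ (-ρ) ≤ T ^ e * (N : ℝ) ^ (-(min (γ * e) ρ)) := by
  have hj0 : (0 : ℝ) < j := by positivity
  have hN0 : (0 : ℝ) < N := by exact_mod_cast hj.trans hjN
  have hj1 : (1 : ℝ) ≤ j := by exact_mod_cast hj
  have hjN' : (j : ℝ) ≤ N := by exact_mod_cast hjN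
  rw [gradedMesh_eq hT hγ, Real.mul_rpow hT.le (by positivity), ← Real.rpow_mul (by positivity),
    mul_assoc]
  gcongr
  rw [Real.div_rpow hj0.le hN0.le, div_mul_eq_mul_div, ← Real.rpow_add hj0, div_eq_mul_inv,
    ← Real.rpow_neg hN0.le]
  rcases le_total (γ * e) ρ with h | h
  · rw [min_eq_left h]
    refine mul_le_of_le_one_left (by positivity) ?_
    exact Real.rpow_le_one_of_one_le_of_nonpos hj1 (by linarith)
  · rw [min_eq_right h]
    calc _ ≤ (N : ℝ) ^ (γ * e + -ρ) * (N : ℝ) ^ (-(γ * e)) := by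
          gcongr
          linarith
      _ = _ := by rw [← Real.rpow_add hN0]; congr 1; ring

/-! ### Integrals of the error majorant and their sum over the steps -/

section ErrorWeight

variable {T γ α β c : ℝ} {p q N n j : ℕ}

theorem integrableOn_errorWeight (hα0 : 0 < α) (hα1 : α < 1) (hT : 0 < T) (hγ : 1 ≤ γ)
    (hc : 0 < c) (hj : 1 ≤ j) (hN : 1 ≤ N) :
    IntegrableOn (fun x => x ^ (-α) * errorWeight T γ β c p q N n j x) (Ioi 0) := by
  have ht := gradedMesh_pos hT hγ hN hj
  have hj0 : (0 : ℝ) < j := by positivity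
  have hm : 0 < max 1 ((n : ℝ) - j) := lt_max_of_lt_left zero_lt_one
  have h1 := integrableOn_rpow_div_one_add_mul hα0 hα1
    (l := c * max 1 ((n : ℝ) - j) * (gradedMesh T γ N j / j)) (by positivity)
  have h2 := integrableOn_rpow_div_one_add_mul hα0 hα1
    (l := gradedMesh T γ N j / j) (by positivity)
  refine IntegrableOn.congr_fun
    ((h1.const_mul (gradedMesh T γ N j ^ (β + 1) * ((j : ℝ) ^ (p + 1))⁻¹)).add
    (h2.const_mul (gradedMesh T γ N j ^ (β + 1) * (((j : ℝ) ^ (q + 2))⁻¹ *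
      (c * max 1 ((n : ℝ) - j))⁻¹)))) (fun x _ => ?_) measurableSet_Ioi
  simp only [errorWeight, Pi.add_apply]
  ring

theorem integral_errorWeight (hα0 : 0 < α) (hα1 : α < 1) (hT : 0 < T) (hγ : 1 ≤ γ)
    (hc : 0 < c) (hj : 1 ≤ j) (hN : 1 ≤ N) :
    ∫ x in Ioi (0 : ℝ), x ^ (-α) * errorWeight T γ β c p q N n j x =
      gradedMesh T γ N j ^ (β + 1) * (((j : ℝ) ^ (p + 1))⁻¹ *
        (c * max 1 ((n : ℝ) - j) * (gradedMesh T γ N j / j)) ^ (α - 1) +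
        ((j : ℝ) ^ (q + 2))⁻¹ * (c * max 1 ((n : ℝ) - j))⁻¹ *
          (gradedMesh T γ N j / j) ^ (α - 1)) * weightIntegral α := by
  have ht := gradedMesh_pos hT hγ hN hj
  have hj0 : (0 : ℝ) < j := by positivity
  have hm : 0 < max 1 ((n : ℝ) - j) := lt_max_of_lt_left zero_lt_one
  have hl1 : 0 < c * max 1 ((n : ℝ) - j) * (gradedMesh T γ N j / j) := by positivity
  have hl2 : 0 < gradedMesh T γ N j / j := by positivity
  have h1 := integrableOn_rpow_div_one_add_mul hα0 hα1 hl1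
  have h2 := integrableOn_rpow_div_one_add_mul hα0 hα1 hl2
  have e : ∀ x : ℝ, x ^ (-α) * errorWeight T γ β c p q N n j x =
      gradedMesh T γ N j ^ (β + 1) * ((j : ℝ) ^ (p + 1))⁻¹ * (x ^ (-α) * (1 / (1 +
        c * max 1 ((n : ℝ) - j) * (gradedMesh T γ N j / j) * x))) +
      gradedMesh T γ N j ^ (β + 1) * (((j : ℝ) ^ (q + 2))⁻¹ * (c * max 1 ((n : ℝ) - j))⁻¹) *
        (x ^ (-α) * (1 / (1 + gradedMesh T γ N j / j * x))) := by
    intro x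
    simp only [errorWeight]
    ring
  simp only [e]
  rw [integral_add (h1.const_mul _) (h2.const_mul _), integral_const_mul, integral_const_mul,
    integral_rpow_div_one_add_mul hl1, integral_rpow_div_one_add_mul hl2]
  ring

theorem integral_errorWeight_le (hα0 : 0 < α) (hα1 : α < 1) (hT : 0 < T) (hγ : 1 ≤ γ)
    (hc : 0 < c) (hj : 1 ≤ j) (hjn : j ≤ n) (hnN : n ≤ N) :
    ∫ x in Ioi (0 : ℝ), x ^ (-α) * errorWeight T γ β c p q N n j x ≤
      (c ^ (α - 1) + c⁻¹) * weightIntegral α * T ^ (α + β) *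
        (N : ℝ) ^ (-(min (γ * (α + β)) (min (p : ℝ) (q + 1 + α)))) *
          ((j : ℝ)⁻¹ + 2 * (max 1 ((n : ℝ) - j))⁻¹) := by
  have hN : 1 ≤ N := hj.trans (hjn.trans hnN)
  have ht := gradedMesh_pos hT hγ hN hj
  have hj0 : (0 : ℝ) < j := by positivity
  have hj1 : (1 : ℝ) ≤ j := by exact_mod_cast hj
  set m := max 1 ((n : ℝ) - j) with hmdef
  have hm1 : 1 ≤ m := le_max_left _ _
  have hm : 0 < m := by linarith
  set ρ : ℝ := min (p : ℝ) (q + 1 + α) with hρ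
  set t := gradedMesh T γ N j with htdef
  have hW := weightIntegral_nonneg (α := α)
  rw [integral_errorWeight hα0 hα1 hT hγ hc hj hN, ← hmdef, ← htdef]
  -- The factor `j^{1-α}` turns `j^{-(p+1)}` into `j^{-p} j^{-α}` and `j^{-(q+2)}` into
  -- `j^{-(q+1+α)}`: the two competing rates of the theorem.
  have hlam : t ^ (β + 1) * (t / j) ^ (α - 1) = t ^ (α + β) * (j : ℝ) ^ (1 - α) := by
    rw [Real.div_rpow ht.le hj0.le, mul_div_assoc', ← Real.rpow_add ht, div_eq_mul_inv,
      ← Real.rpow_neg hj0.le]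
    congr 2 <;> ring
  have e1 : t ^ (β + 1) * (((j : ℝ) ^ (p + 1))⁻¹ * (c * m * (t / j)) ^ (α - 1)) ≤
      c ^ (α - 1) * (t ^ (α + β) * (j : ℝ) ^ (-ρ)) * ((j : ℝ)⁻¹ + m⁻¹) := by
    have : t ^ (β + 1) * (((j : ℝ) ^ (p + 1))⁻¹ * (c * m * (t / j)) ^ (α - 1)) =
        c ^ (α - 1) * (t ^ (α + β) * (j : ℝ) ^ (-(p : ℝ))) *
          ((j : ℝ) ^ (-α) * m ^ (α - 1)) := by
      rw [Real.mul_rpow (by positivity) (by positivity), Real.mul_rpow hc.le hm.le]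
      calc _ = c ^ (α - 1) * m ^ (α - 1) * ((j : ℝ) ^ (p + 1))⁻¹ *
            (t ^ (β + 1) * (t / j) ^ (α - 1)) := by ring
        _ = c ^ (α - 1) * m ^ (α - 1) * t ^ (α + β) *
            (((j : ℝ) ^ (p + 1))⁻¹ * (j : ℝ) ^ (1 - α)) := by rw [hlam]; ring
        _ = c ^ (α - 1) * m ^ (α - 1) * t ^ (α + β) *
            ((j : ℝ) ^ (-(p : ℝ)) * (j : ℝ) ^ (-α)) := by
            rw [← Real.rpow_natCast, ← Real.rpow_neg hj0.le, ← Real.rpow_add hj0,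
              ← Real.rpow_add hj0]
            congr 2
            push_cast
            ring
        _ = _ := by ring
    rw [this]
    have h1 := rpow_mul_rpow_le_inv_add_inv hα0 hα1 hj1 hm1
    gcongr
    exact min_le_left _ _
  have e2 : t ^ (β + 1) * (((j : ℝ) ^ (q + 2))⁻¹ * (c * m)⁻¹ * (t / j) ^ (α - 1)) ≤
      c⁻¹ * (t ^ (α + β) * (j : ℝ) ^ (-ρ)) * m⁻¹ := by
    have : t ^ (β + 1) * (((j : ℝ) ^ (q + 2))⁻¹ * (c * m)⁻¹ * (t / j) ^ (α - 1)) =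
        c⁻¹ * (t ^ (α + β) * (j : ℝ) ^ (-((q : ℝ) + 1 + α))) * m⁻¹ := by
      calc _ = (c * m)⁻¹ * ((j : ℝ) ^ (q + 2))⁻¹ *
            (t ^ (β + 1) * (t / j) ^ (α - 1)) := by ring
        _ = (c * m)⁻¹ * t ^ (α + β) *
            (((j : ℝ) ^ (q + 2))⁻¹ * (j : ℝ) ^ (1 - α)) := by rw [hlam]; ring
        _ = (c * m)⁻¹ * t ^ (α + β) * (j : ℝ) ^ (-((q : ℝ) + 1 + α)) := by
            rw [← Real.rpow_natCast, ← Real.rpow_neg hj0.le, ← Real.rpow_add hj0]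
            congr 2
            push_cast
            ring
        _ = _ := by rw [mul_inv]; ring
    rw [this]
    gcongr
    exact min_le_right _ _
  have e3 := mesh_rpow_le (ρ := ρ) (e := α + β) hT hγ hj (hjn.trans hnN)
  rw [← htdef] at e3
  have hP : 0 ≤ t ^ (α + β) * (j : ℝ) ^ (-ρ) := by positivity
  have hc1 : 0 < c ^ (α - 1) := by positivity
  calc _ = (t ^ (β + 1) * (((j : ℝ) ^ (p + 1))⁻¹ * (c * m * (t / j)) ^ (α - 1)) +
        t ^ (β + 1) * (((j : ℝ) ^ (q + 2))⁻¹ * (c * m)⁻¹ * (t / j) ^ (α - 1))) *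
          weightIntegral α := by ring
    _ ≤ (c ^ (α - 1) * (t ^ (α + β) * (j : ℝ) ^ (-ρ)) * ((j : ℝ)⁻¹ + m⁻¹) +
          c⁻¹ * (t ^ (α + β) * (j : ℝ) ^ (-ρ)) * m⁻¹) * weightIntegral α := by gcongr
    _ ≤ ((c ^ (α - 1) + c⁻¹) * (t ^ (α + β) * (j : ℝ) ^ (-ρ)) *
          ((j : ℝ)⁻¹ + 2 * m⁻¹)) * weightIntegral α := by
        gcongr
        set P := t ^ (α + β) * (j : ℝ) ^ (-ρ) with hPdef
        have h1 : 0 ≤ c ^ (α - 1) * P * m⁻¹ := by positivity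
        have h2 : 0 ≤ c⁻¹ * P * ((j : ℝ)⁻¹ + m⁻¹) := by positivity
        linarith
    _ ≤ ((c ^ (α - 1) + c⁻¹) * (T ^ (α + β) * (N : ℝ) ^ (-(min (γ * (α + β)) ρ))) *
          ((j : ℝ)⁻¹ + 2 * m⁻¹)) * weightIntegral α := by gcongr
    _ = _ := by ring

theorem exists_integral_sum_errorWeight_le (α β γ T : ℝ) (p q : ℕ) {c : ℝ} (hα0 : 0 < α)
    (hα1 : α < 1) (hT : 0 < T) (hγ : 1 ≤ γ) (hc : 0 < c) :
    ∃ C : ℝ, 0 < C ∧ ∀ N n : ℕ, 2 ≤ N → 1 ≤ n → n ≤ N →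
      IntegrableOn (fun x => x ^ (-α) * ∑ j ∈ Finset.Icc 1 n, errorWeight T γ β c p q N n j x)
        (Ioi 0) ∧
      ∫ x in Ioi (0 : ℝ), x ^ (-α) * ∑ j ∈ Finset.Icc 1 n, errorWeight T γ β c p q N n j x ≤
        C * (Real.log N * (N : ℝ) ^ (-(min (γ * (α + β)) (min (p : ℝ) (q + 1 + α))))) := by
  have hW := weightIntegral_nonneg (α := α)
  have hlog2 : 0 < Real.log 2 := Real.log_pos one_lt_two
  set K : ℝ := (c ^ (α - 1) + c⁻¹) * weightIntegral α * T ^ (α + β) with hK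
  have hK0 : 0 ≤ K := by positivity
  -- The harmonic sums give `5 + 3 log N`; as `N ≥ 2`, the `5` is at most `5 log N / log 2`. The
  -- final `1` only ensures positivity, `K` being known to be nonnegative.
  refine ⟨K * (5 / Real.log 2 + 3) + 1, by positivity, fun N n hN hn hnN => ?_⟩
  have hint : ∀ j ∈ Finset.Icc 1 n,
      IntegrableOn (fun x => x ^ (-α) * errorWeight T γ β c p q N n j x) (Ioi 0) := fun j hj =>
    integrableOn_errorWeight hα0 hα1 hT hγ hc (Finset.mem_Icc.1 hj).1 (by omega)
  simp only [Finset.mul_sum]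
  refine ⟨integrable_finsetSum _ hint, ?_⟩
  rw [integral_finsetSum _ hint]
  set R : ℝ := (N : ℝ) ^ (-(min (γ * (α + β)) (min (p : ℝ) (q + 1 + α)))) with hR
  have hR0 : 0 ≤ R := by positivity
  have hlogn : Real.log n ≤ Real.log N :=
    Real.log_le_log (by positivity) (by exact_mod_cast hnN)
  have hlogN : Real.log 2 ≤ Real.log N := Real.log_le_log two_pos (by exact_mod_cast hN)
  calc _ ≤ ∑ j ∈ Finset.Icc 1 n, K * R * ((j : ℝ)⁻¹ + 2 * (max 1 ((n : ℝ) - j))⁻¹) :=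
        Finset.sum_le_sum fun j hj => integral_errorWeight_le hα0 hα1 hT hγ hc
          (Finset.mem_Icc.1 hj).1 (Finset.mem_Icc.1 hj).2 hnN
    _ = K * R * (∑ j ∈ Finset.Icc 1 n, (j : ℝ)⁻¹ +
          2 * ∑ j ∈ Finset.Icc 1 n, (max 1 ((n : ℝ) - j))⁻¹) := by
        rw [← Finset.mul_sum, Finset.sum_add_distrib, ← Finset.mul_sum]
    _ ≤ K * R * ((1 + Real.log N) + 2 * (2 + Real.log N)) := by
        have h1 := sum_inv_le n
        have h2 := sum_inv_max_sub_le hn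
        have : 0 ≤ K * R := by positivity
        gcongr
        · linarith
        · linarith
    _ ≤ K * R * ((5 / Real.log 2 + 3) * Real.log N) := by
        have : 5 ≤ 5 / Real.log 2 * Real.log N := by
          rw [div_mul_eq_mul_div, le_div_iff₀ hlog2]
          linarith
        gcongr
        linarith
    _ = K * (5 / Real.log 2 + 3) * (Real.log N * R) := by ring
    _ ≤ _ := by
        have : 0 ≤ Real.log N * R := mul_nonneg (hlog2.le.trans hlogN) hR0
        gcongr
        linarith

end ErrorWeight

end GCQ

namespace GCQ

/-! ### Duhamel integrals for `y' = -x y + g` -/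

section Duhamel

variable {E : Type*} [NormedAddCommGroup E] [NormedSpace ℝ E]

/-- The solution of `y' = -x y + g`, `y 0 = 0`. -/
noncomputable def expConv (x : ℝ) (g : ℝ → E) (t : ℝ) : E :=
  ∫ s in (0 : ℝ)..t, Real.exp (-(x * (t - s))) • g s

theorem expConv_zero_right (x : ℝ) (g : ℝ → E) : expConv x g 0 = 0 := by simp [expConv]

theorem expConv_eq (x : ℝ) (g : ℝ → E) (t : ℝ) :
    expConv x g t = Real.exp (-(x * t)) • ∫ s in (0 : ℝ)..t, Real.exp (x * s) • g s := by
  rw [expConv, ← intervalIntegral.integral_smul]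
  refine intervalIntegral.integral_congr fun s _ => ?_
  simp only [smul_smul]
  rw [← Real.exp_add]
  ring_nf

theorem intervalIntegrable_exp_smul {x a b : ℝ} {g : ℝ → E} (hg : IntervalIntegrable g volume a b) :
    IntervalIntegrable (fun s => Real.exp (x * s) • g s) volume a b :=
  hg.continuousOn_smul (by fun_prop)

theorem hasDerivAt_expConv [CompleteSpace E] {x t : ℝ} {g : ℝ → E} (ht : 0 < t)
    (hi : IntervalIntegrable g volume 0 t) (hc : ContinuousOn g (Ioi 0)) :
    HasDerivAt (expConv x g) (g t - x • expConv x g t) t := by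
  have hc' : ContinuousOn (fun s => Real.exp (x * s) • g s) (Ioi 0) := by
    have : ContinuousOn (fun s : ℝ => Real.exp (x * s)) (Ioi 0) := by fun_prop
    exact this.smul hc
  have h1 := intervalIntegral.integral_hasDerivAt_right (intervalIntegrable_exp_smul (x := x) hi)
    (hc'.stronglyMeasurableAtFilter isOpen_Ioi t ht) (hc'.continuousAt (Ioi_mem_nhds ht))
  have h2 : HasDerivAt (fun u : ℝ => Real.exp (-(x * u))) (Real.exp (-(x * t)) * (-x)) t := by
    have h3 : HasDerivAt (fun u : ℝ => -(x * u)) (-x) t := by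
      simpa using ((hasDerivAt_id t).const_mul x).fun_neg
    exact h3.exp
  rw [funext (expConv_eq x g)]
  refine (h2.fun_smul h1).congr_deriv ?_
  rw [smul_smul (Real.exp (-(x * t))) (Real.exp (x * t)), ← Real.exp_add, neg_add_cancel,
    Real.exp_zero, one_smul, smul_smul, sub_eq_add_neg, ← neg_smul]
  congr 2
  ring

theorem continuousOn_expConv {x T : ℝ} (hT : 0 ≤ T) {g : ℝ → E}
    (hi : IntervalIntegrable g volume 0 T) : ContinuousOn (expConv x g) (Icc 0 T) := by
  rw [funext (expConv_eq x g)]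
  have h1 := intervalIntegral.continuousOn_primitive_interval' (intervalIntegrable_exp_smul (x := x) hi)
    left_mem_uIcc
  rw [uIcc_of_le hT] at h1
  have : ContinuousOn (fun t : ℝ => Real.exp (-(x * t))) (Icc 0 T) := by fun_prop
  exact this.smul h1

theorem duhamel [CompleteSpace E] {x a b : ℝ} (hab : a ≤ b) {y g : ℝ → E}
    (hy : ContinuousOn y (Icc a b)) (hd : ∀ t ∈ Ioo a b, HasDerivAt y (g t - x • y t) t)
    (hg : IntervalIntegrable g volume a b) :
    y b = Real.exp (-(x * (b - a))) • y a + ∫ s in a..b, Real.exp (-(x * (b - s))) • g s := by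
  have hc : ContinuousOn (fun s => Real.exp (-(x * (b - s))) • y s) (Icc a b) := by
    have : ContinuousOn (fun s : ℝ => Real.exp (-(x * (b - s)))) (Icc a b) := by fun_prop
    exact this.smul hy
  have hd' : ∀ t ∈ Ioo a b, HasDerivAt (fun s => Real.exp (-(x * (b - s))) • y s)
      (Real.exp (-(x * (b - t))) • g t) t := by
    intro t ht
    have h2 : HasDerivAt (fun u : ℝ => Real.exp (-(x * (b - u))))
        (Real.exp (-(x * (b - t))) * x) t := by
      have h3 : HasDerivAt (fun u : ℝ => -(x * (b - u))) x t := by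
        simpa using (((hasDerivAt_id t).const_sub b).const_mul x).fun_neg
      exact h3.exp
    refine (h2.fun_smul (hd t ht)).congr_deriv ?_
    rw [smul_sub, smul_smul, sub_add_cancel]
  have hi : IntervalIntegrable (fun s => Real.exp (-(x * (b - s))) • g s) volume a b :=
    hg.continuousOn_smul (by fun_prop)
  rw [intervalIntegral.integral_eq_sub_of_hasDerivAt_of_le hab hc hd' hi]
  simp

theorem mul_integral_exp (x a b : ℝ) :
    x * ∫ s in a..b, Real.exp (-(x * (b - s))) = 1 - Real.exp (-(x * (b - a))) := by
  rw [← intervalIntegral.integral_const_mul]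
  have hd : ∀ t ∈ uIcc a b, HasDerivAt (fun u : ℝ => Real.exp (-(x * (b - u))))
        (x * Real.exp (-(x * (b - t)))) t := by
    intro t _
    have h3 : HasDerivAt (fun u : ℝ => -(x * (b - u))) x t := by
      simpa using (((hasDerivAt_id t).const_sub b).const_mul x).fun_neg
    rw [mul_comm]
    exact h3.exp
  rw [intervalIntegral.integral_eq_sub_of_hasDerivAt hd
    (Continuous.intervalIntegrable (by fun_prop) _ _)]
  simp

/-- The integral is at most `b - a`, and `x` times it is at most `1`; adding the first to `b - a`
times the second gives the claim. -/
theorem integral_exp_le {x a b : ℝ} (hx : 0 ≤ x) (hab : a ≤ b) :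
    ∫ s in a..b, Real.exp (-(x * (b - s))) ≤ 2 * (b - a) / (1 + x * (b - a)) := by
  have h1 : ∫ s in a..b, Real.exp (-(x * (b - s))) ≤ b - a := by
    have : ∫ s in a..b, Real.exp (-(x * (b - s))) ≤ ∫ _ in a..b, (1 : ℝ) := by
      refine intervalIntegral.integral_mono_on hab
        (Continuous.intervalIntegrable (by fun_prop) _ _) (by simp) fun s hs => ?_
      rw [Real.exp_le_one_iff]
      have : 0 ≤ x * (b - s) := mul_nonneg hx (by linarith [hs.2])
      linarith
    simpa using this
  have h2 := mul_integral_exp x a b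
  have h3 := Real.exp_pos (-(x * (b - a)))
  have h4 : 0 ≤ b - a := by linarith
  rw [le_div_iff₀ (by positivity)]
  nlinarith

theorem norm_integral_exp_smul_le {x a b B : ℝ} (hx : 0 ≤ x) (hab : a ≤ b) {g : ℝ → E}
    (hg : ∀ s ∈ Ioc a b, ‖g s‖ ≤ B) :
    ‖∫ s in a..b, Real.exp (-(x * (b - s))) • g s‖ ≤ B * (2 * (b - a) / (1 + x * (b - a))) := by
  rcases eq_or_lt_of_le hab with rfl | hlt
  · simp
  have hB : 0 ≤ B := (norm_nonneg _).trans (hg b ⟨hlt, le_rfl⟩)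
  calc _ ≤ ∫ s in a..b, Real.exp (-(x * (b - s))) * B := by
        refine intervalIntegral.norm_integral_le_of_norm_le hab (ae_of_all _ fun s hs => ?_)
          (Continuous.intervalIntegrable (by fun_prop) _ _)
        rw [norm_smul, Real.norm_of_nonneg (Real.exp_pos _).le]
        gcongr
        exact hg s hs
    _ = B * ∫ s in a..b, Real.exp (-(x * (b - s))) := by
        rw [intervalIntegral.integral_mul_const, mul_comm]
    _ ≤ _ := by
        gcongr
        exact integral_exp_le hx hab

end Duhamel

/-! ### Right-hand sides `t ^ β` -/

section Power

/-- Chain of derivatives of the solution of `y' = -x y + t ^ β`, `y 0 = 0`. -/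
noncomputable def powSol (β x : ℝ) : ℕ → ℝ → ℝ
  | 0, t => expConv x (fun s => s ^ β) t
  | k + 1, t => (∏ i ∈ Finset.range k, (β - i)) * t ^ (β - k) - x * powSol β x k t

theorem hasDerivAt_pow_falling (β : ℝ) (k : ℕ) {t : ℝ} (ht : 0 < t) :
    HasDerivAt (fun u : ℝ => (∏ i ∈ Finset.range k, (β - i)) * u ^ (β - k))
      ((∏ i ∈ Finset.range (k + 1), (β - i)) * t ^ (β - (k + 1 : ℕ))) t := by
  have h1 := (Real.hasDerivAt_rpow_const (x := t) (p := β - k) (Or.inl ht.ne')).const_mul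
    (∏ i ∈ Finset.range k, (β - i))
  refine h1.congr_deriv ?_
  rw [Finset.prod_range_succ]
  push_cast
  ring_nf

theorem hasDerivAt_powSol {β x : ℝ} (hβ : -1 < β) (k : ℕ) :
    ∀ t > 0, HasDerivAt (powSol β x k) (powSol β x (k + 1) t) t := by
  induction k with
  | zero =>
    intro t ht
    have := hasDerivAt_expConv (x := x) (g := fun s : ℝ => s ^ β) ht
      (intervalIntegral.intervalIntegrable_rpow' hβ)
      (fun s hs => (Real.continuousAt_rpow_const s β (Or.inl (ne_of_gt hs))).continuousWithinAt)
    refine this.congr_deriv ?_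
    simp [powSol]
  | succ k ih =>
    intro t ht
    exact (hasDerivAt_pow_falling β k ht).sub ((ih t ht).const_mul x)

theorem exists_pow_mul_exp_le (n : ℕ) :
    ∃ C : ℝ, 0 < C ∧ ∀ u : ℝ, 0 ≤ u → (1 + u) ^ n * Real.exp (-(u / 2)) ≤ C := by
  refine ⟨2 ^ n * n.factorial * Real.exp (1 / 2), by positivity, fun u hu => ?_⟩
  have h1 := Real.pow_div_factorial_le_exp ((1 + u) / 2) (by positivity) n
  rw [div_pow, div_div, div_le_iff₀ (by positivity)] at h1
  have h2 : Real.exp ((1 + u) / 2) * Real.exp (-(u / 2)) = Real.exp (1 / 2) := by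
    rw [← Real.exp_add]; ring_nf
  calc _ ≤ Real.exp ((1 + u) / 2) * (2 ^ n * n.factorial) * Real.exp (-(u / 2)) := by gcongr
    _ = 2 ^ n * n.factorial * (Real.exp ((1 + u) / 2) * Real.exp (-(u / 2))) := by ring
    _ = _ := by rw [h2]

/-- Straight from the recursion, each derivative costs a factor `1 + x t`. It serves only as the
initial bound at `t / 2` in the sharp estimate, where an exponential absorbs the growth. -/
theorem exists_powSol_crude {β : ℝ} (hβ : -1 < β) (k : ℕ) :
    ∃ C : ℝ, 0 < C ∧ ∀ x t : ℝ, 0 ≤ x → 0 < t →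
      |powSol β x k t| ≤ C * (t ^ (β + 1 - k) * (1 + x * t) ^ k) := by
  induction k with
  | zero =>
    refine ⟨1 / (β + 1), by have : 0 < β + 1 := by linarith
                            positivity, fun x t hx ht => ?_⟩
    have hβ1 : 0 < β + 1 := by linarith
    have h1 : ‖expConv x (fun s : ℝ => s ^ β) t‖ ≤ ∫ s in (0 : ℝ)..t, s ^ β := by
      refine intervalIntegral.norm_integral_le_of_norm_le ht.le (ae_of_all _ fun s hs => ?_)
        (intervalIntegral.intervalIntegrable_rpow' hβ)
      have hs0 : 0 < s := hs.1
      rw [smul_eq_mul, norm_mul, Real.norm_of_nonneg (Real.exp_pos _).le,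
        Real.norm_of_nonneg (by positivity)]
      refine mul_le_of_le_one_left (by positivity) ?_
      rw [Real.exp_le_one_iff]
      have : 0 ≤ x * (t - s) := mul_nonneg hx (by linarith [hs.2])
      linarith
    rw [integral_rpow (Or.inl hβ), Real.zero_rpow hβ1.ne', sub_zero] at h1
    simp only [powSol, CharP.cast_eq_zero, sub_zero, pow_zero, mul_one]
    rw [← Real.norm_eq_abs]
    refine h1.trans (le_of_eq ?_)
    ring
  | succ k ih =>
    obtain ⟨C, hC, hb⟩ := ih
    refine ⟨|∏ i ∈ Finset.range k, (β - i)| + C, by positivity, fun x t hx ht => ?_⟩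
    have e : t ^ (β + 1 - k) = t * t ^ (β + 1 - (k + 1 : ℕ)) := by
      rw [mul_comm, ← Real.rpow_add_one ht.ne']
      congr 1
      push_cast
      ring
    have e' : β - k = β + 1 - (k + 1 : ℕ) := by push_cast; ring
    have h1 := hb x t hx ht
    have hu : 1 ≤ 1 + x * t := by
      have : 0 ≤ x * t := by positivity
      linarith
    have hp : (1 : ℝ) ≤ (1 + x * t) ^ (k + 1) := one_le_pow₀ hu
    rw [powSol, e']
    refine (abs_sub _ _).trans ?_
    rw [abs_mul, abs_mul, abs_of_nonneg hx, 
      abs_of_nonneg (by positivity : 0 ≤ t ^ (β + 1 - (k + 1 : ℕ))), add_mul]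
    refine add_le_add ?_ ?_
    · exact mul_le_mul_of_nonneg_left (le_mul_of_one_le_right (by positivity) hp) (abs_nonneg _)
    · calc _ ≤ x * (C * (t ^ (β + 1 - k) * (1 + x * t) ^ k)) := by gcongr
        _ = C * (t ^ (β + 1 - (k + 1 : ℕ)) * ((x * t) * (1 + x * t) ^ k)) := by rw [e]; ring
        _ ≤ C * (t ^ (β + 1 - (k + 1 : ℕ)) * (1 + x * t) ^ (k + 1)) := by
            rw [pow_succ (1 + x * t), mul_comm ((1 + x * t) ^ k)]
            gcongr
            linarith

/-- The `k`-th derivative again solves `y' = -x y + d t^{β-k}`. Starting the variation of constants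
at `t / 2` avoids the singularity at the origin: on `[t/2, t]` the source is comparable to
`t^{β-k}`, and `e^{-xt/2}` beats the polynomial growth of the initial value. -/
theorem exists_powSol_bound {β : ℝ} (hβ : -1 < β) (k : ℕ) :
    ∃ C : ℝ, 0 < C ∧ ∀ x t : ℝ, 0 ≤ x → 0 < t →
      |powSol β x k t| ≤ C * (t ^ (β + 1 - k) / (1 + x * t)) := by
  obtain ⟨C₁, hC₁, hb⟩ := exists_powSol_crude hβ k
  obtain ⟨C₂, hC₂, he⟩ := exists_pow_mul_exp_le (k + 1)
  set d : ℝ := ∏ i ∈ Finset.range k, (β - i) with hd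
  set a₁ : ℝ := (1 / 2) ^ (-|β + 1 - k|) with ha₁
  set a₂ : ℝ := (1 / 2) ^ (-|β - k|) with ha₂
  refine ⟨C₂ * (C₁ * a₁) + |d| * a₂ * 2, by positivity, fun x t hx ht => ?_⟩
  have hden : 0 < 1 + x * t := by positivity
  have hdu := duhamel (x := x) (a := t / 2) (b := t) (by linarith) (y := powSol β x k)
    (g := fun s => d * s ^ (β - k))
    (fun s hs => (hasDerivAt_powSol hβ k s (by linarith [hs.1])).continuousAt.continuousWithinAt)
    (fun s hs => hasDerivAt_powSol hβ k s (by linarith [hs.1])) (by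
      apply ContinuousOn.intervalIntegrable
      rw [uIcc_of_le (by linarith)]
      intro s hs
      have : s ≠ 0 := by linarith [hs.1]
      exact ((Real.continuousAt_rpow_const s _ (Or.inl this)).const_mul d).continuousWithinAt)
  rw [hdu, ← Real.norm_eq_abs]
  refine (norm_add_le _ _).trans ?_
  rw [add_mul]
  have hhalf : t - t / 2 = t / 2 := by ring
  refine add_le_add ?_ ?_
  · rw [norm_smul, Real.norm_of_nonneg (Real.exp_pos _).le, Real.norm_eq_abs, hhalf]
    have h1 := hb x (t / 2) hx (by linarith)
    have h2 := rpow_le_of_comparable (a := 1 / 2) (s := t / 2) (t := t) (by norm_num) (by norm_num)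
      ht (by linarith) (by linarith) (β + 1 - k)
    have h3 := he (x * t) (by positivity)
    have h4 : Real.exp (-(x * (t / 2))) ≤ C₂ / (1 + x * t) ^ (k + 1) := by
      rw [le_div_iff₀ (by positivity), mul_comm, ← mul_div_assoc]
      exact h3
    calc _ ≤ C₂ / (1 + x * t) ^ (k + 1) * (C₁ * (a₁ * t ^ (β + 1 - k) * (1 + x * t) ^ k)) := by
          gcongr
          refine h1.trans ?_
          gcongr
          linarith
      _ = _ := by
          rw [pow_succ]
          field_simp
  · have h5 := norm_integral_exp_smul_le (x := x) (a := t / 2) (b := t)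
      (B := |d| * (a₂ * t ^ (β - k))) hx (by linarith) (g := fun s => d * s ^ (β - k)) (by
        intro s hs
        have hs0 : 0 < s := by linarith [hs.1]
        rw [Real.norm_eq_abs, abs_mul, abs_of_nonneg (by positivity : 0 ≤ s ^ (β - k))]
        gcongr
        exact rpow_le_of_comparable (by norm_num) (by norm_num) ht (by linarith [hs.1]) hs.2 _)
    refine h5.trans ?_
    rw [hhalf]
    have h6 : 2 * (t / 2) / (1 + x * (t / 2)) ≤ 2 * (t / (1 + x * t)) := by
      have e : 2 * (t / (1 + x * t)) = 2 * t / (1 + x * t) := by ring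
      rw [e, div_le_div_iff₀ (by positivity) hden]
      have : 0 ≤ x * t * t := by positivity
      nlinarith
    have h7 : t ^ (β + 1 - k) = t ^ (β - k) * t := by
      rw [← Real.rpow_add_one ht.ne']; ring_nf
    calc _ ≤ |d| * (a₂ * t ^ (β - k)) * (2 * (t / (1 + x * t))) := by gcongr
      _ = _ := by rw [h7]; ring

variable {E : Type u} [NormedAddCommGroup E] [NormedSpace ℂ E]

theorem RungeKutta.Admissible.exists_powSol_solutionBounds {r : ℕ} {rk : RungeKutta (r + 1)}
    {p q : ℕ} (h : rk.Admissible p q) {β : ℝ} (hβ : -1 < β) :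
    ∃ C : ℝ, 0 < C ∧ ∀ (E : Type u) [NormedAddCommGroup E] [NormedSpace ℂ E] (a : E) (x S : ℝ),
      0 ≤ x → HasSolutionBounds rk p q β S x (C * ‖a‖) (fun k t => powSol β x k t • a)
        (fun t => (t ^ β : ℝ) • a) := by
  choose C hC hb using exists_powSol_bound hβ
  have hsum : ∀ k ∈ Finset.range (p + 2), C k ≤ ∑ k ∈ Finset.range (p + 2), C k := fun k hk =>
    Finset.single_le_sum (fun k _ => (hC k).le) hk
  set K : ℝ := ∑ k ∈ Finset.range (p + 2), C k with hK
  have hK0 : 0 ≤ K := Finset.sum_nonneg fun k _ => (hC k).le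
  -- Bounds the data at the nodes `c_i t`. Should some `c_i` vanish with `β < 0`, the default value
  -- `0 ^ β = 0` keeps this finite.
  set L : ℝ := ∑ i, |rk.c i ^ β| with hL
  have hL0 : 0 ≤ L := by positivity
  refine ⟨K + L + 1, by positivity, fun E _ _ a x S hx => ?_⟩
  have hbound : ∀ k ≤ p + 1, ∀ t > 0,
      ‖powSol β x k t • a‖ ≤ (K + L + 1) * ‖a‖ * (t ^ (β + 1 - k) / (1 + x * t)) := by
    intro k hk t ht
    rw [norm_smul, Real.norm_eq_abs]
    calc _ ≤ (C k * (t ^ (β + 1 - k) / (1 + x * t))) * ‖a‖ := by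
          gcongr
          exact hb k x t hx ht
      _ = C k * ‖a‖ * (t ^ (β + 1 - k) / (1 + x * t)) := by ring
      _ ≤ _ := by
          have := hsum k (Finset.mem_range.2 (by omega))
          gcongr
          linarith
  refine ⟨fun k _ t ht => (hasDerivAt_powSol hβ k t ht).smul_const a, fun t ht => ?_, ?_,
    fun t ht => ?_, fun k hk t ht => ?_, fun s hs t ht => ?_, fun i t ht => ?_⟩
  · simp [powSol, sub_smul, smul_smul]
  · simp [powSol, expConv_zero_right]
  · simpa using hbound 0 (by omega) t ht.1
  · exact hbound k (by rw [Finset.mem_Ioc] at hk; omega) t ht.1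
  · have hs0 : 0 < s := hs.1
    have ht0 : 0 < t := hs0.trans_le ht.1
    have hd : ∀ u ∈ Icc s t, HasDerivWithinAt (fun u => powSol β x p u • a)
        (powSol β x (p + 1) u • a) (Icc s t) u := fun u hu =>
      ((hasDerivAt_powSol hβ p u (hs0.trans_le hu.1)).smul_const a).hasDerivWithinAt
    have hn : ∀ u ∈ Icc s t, ‖powSol β x (p + 1) u • a‖ ≤
        (K + L + 1) * ‖a‖ * (s ^ (β - p) + t ^ (β - p)) := by
      intro u hu
      have hu0 : 0 < u := hs0.trans_le hu.1
      refine (hbound (p + 1) le_rfl u hu0).trans ?_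
      gcongr
      have e : β + 1 - (p + 1 : ℕ) = β - p := by push_cast; ring
      rw [e]
      have h1 : u ^ (β - p) / (1 + x * u) ≤ u ^ (β - p) := by
        apply div_le_self (by positivity)
        have : 0 ≤ x * u := by positivity
        linarith
      refine h1.trans ?_
      have h2 : 0 < s ^ (β - p) := by positivity
      have h3 : 0 < t ^ (β - p) := by positivity
      rcases le_total 0 (β - p) with h0 | h0
      · have := Real.rpow_le_rpow hu0.le hu.2 h0
        linarith
      · have := Real.rpow_le_rpow_of_nonpos hs0 hu.1 h0
        linarith
    have := (convex_Icc s t).norm_image_sub_le_of_norm_hasDerivWithin_le hd hn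
      (left_mem_Icc.2 ht.1) (right_mem_Icc.2 ht.1)
    rw [Real.norm_of_nonneg (by linarith [ht.1])] at this
    refine this.trans (le_of_eq ?_)
    ring
  · have ht0 : 0 < t := ht.1
    rw [Real.mul_rpow (h.c_mem i).1 ht0.le, norm_smul, norm_mul, Real.norm_eq_abs,
      Real.norm_of_nonneg (by positivity : 0 ≤ t ^ β)]
    have h1 : |rk.c i ^ β| ≤ L :=
      Finset.single_le_sum (f := fun i => |rk.c i ^ β|) (fun _ _ => abs_nonneg _) (Finset.mem_univ i)
    calc _ = |rk.c i ^ β| * ‖a‖ * t ^ β := by ring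
      _ ≤ _ := by
          gcongr
          linarith

end Power

end GCQ

namespace GCQ

/-! ### Fractional integrals of bounded continuous functions -/

section FracInt

variable {E : Type*} [NormedAddCommGroup E] [NormedSpace ℝ E]

/-- The unnormalised fractional integral `∫₀ᵗ (t - s) ^ a g(s) ds`. -/
noncomputable def fracInt (a : ℝ) (g : ℝ → E) (t : ℝ) : E := ∫ s in (0 : ℝ)..t, (t - s) ^ a • g s

theorem rpow_sub_rpow_le {a u v S : ℝ} (ha : 1 ≤ a) (hu : 0 ≤ u) (huv : u ≤ v) (hv : v ≤ S) :
    |v ^ a - u ^ a| ≤ a * S ^ (a - 1) * (v - u) := by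
  have hd : ∀ w ∈ Icc u v, HasDerivWithinAt (fun y : ℝ => y ^ a) (a * w ^ (a - 1)) (Icc u v) w :=
    fun w _ => (Real.hasDerivAt_rpow_const (Or.inr ha)).hasDerivWithinAt
  have hn : ∀ w ∈ Icc u v, ‖a * w ^ (a - 1)‖ ≤ a * S ^ (a - 1) := by
    intro w hw
    have hw0 : 0 ≤ w := hu.trans hw.1
    rw [Real.norm_of_nonneg (by positivity)]
    gcongr
    exact hw.2.trans hv
  have := (convex_Icc u v).norm_image_sub_le_of_norm_hasDerivWithin_le hd hn
    (left_mem_Icc.2 huv) (right_mem_Icc.2 huv)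
  rwa [Real.norm_eq_abs, Real.norm_of_nonneg (by linarith : 0 ≤ v - u)] at this

theorem continuous_sub_rpow_smul {a : ℝ} (ha : 0 ≤ a) {g : ℝ → E} (hg : Continuous g) (t : ℝ) :
    Continuous fun s => (t - s) ^ a • g s :=
  ((continuous_const.sub continuous_id).rpow_const fun _ => Or.inr ha).smul hg

theorem fracInt_zero_right (a : ℝ) (g : ℝ → E) : fracInt a g 0 = 0 := by simp [fracInt]

theorem norm_fracInt_le {a G t : ℝ} (ha : 0 ≤ a) {g : ℝ → E} (hG : ∀ s, ‖g s‖ ≤ G) (ht : 0 ≤ t) :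
    ‖fracInt a g t‖ ≤ G * t ^ (a + 1) := by
  have : ∀ s ∈ uIoc 0 t, ‖(t - s) ^ a • g s‖ ≤ t ^ a * G := by
    intro s hs
    rw [uIoc_of_le ht] at hs
    rw [norm_smul, Real.norm_of_nonneg (Real.rpow_nonneg (by linarith [hs.2]) _)]
    gcongr
    · linarith [hs.2]
    · linarith [hs.1]
    · exact hG s
  refine (intervalIntegral.norm_integral_le_of_norm_le_const this).trans (le_of_eq ?_)
  rcases eq_or_lt_of_le ht with rfl | ht
  · rw [Real.zero_rpow (by linarith : a + 1 ≠ 0)]; simp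
  · rw [sub_zero, abs_of_pos ht, Real.rpow_add_one ht.ne']; ring

theorem integral_sub_rpow {a t : ℝ} (ha : 0 ≤ a) (c : ℝ) :
    ∫ s in c..t, (t - s) ^ a = (t - c) ^ (a + 1) / (a + 1) := by
  have := intervalIntegral.integral_comp_sub_left (a := c) (b := t) (fun s : ℝ => s ^ a) t
  rw [this, sub_self, integral_rpow (Or.inl (by linarith)), Real.zero_rpow (by linarith), sub_zero]

/-- For `a ≥ 0` the increment of the kernel on `[0, s]` and the kernel on `[s, t]` are both
nonnegative, so their integrals add up to `(t^{a+1} - s^{a+1}) / (a + 1)`, which is Lipschitz. The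
case `a = 0` is included, as needed for the last controlled derivative. -/
theorem norm_fracInt_sub_le {a G s t S : ℝ} (ha : 0 ≤ a) {g : ℝ → E} (hg : Continuous g)
    (hG : ∀ s, ‖g s‖ ≤ G) (hs : 0 ≤ s) (hst : s ≤ t) (htS : t ≤ S) :
    ‖fracInt a g t - fracInt a g s‖ ≤ G * S ^ a * (t - s) := by
  have hG0 : 0 ≤ G := (norm_nonneg _).trans (hG 0)
  have hc := continuous_sub_rpow_smul ha hg
  have hr : ∀ u : ℝ, Continuous fun s : ℝ => (u - s) ^ a := fun u =>
    (continuous_const.sub continuous_id).rpow_const fun _ => Or.inr ha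
  have e : fracInt a g t - fracInt a g s =
      (∫ r in (0 : ℝ)..s, ((t - r) ^ a - (s - r) ^ a) • g r) + ∫ r in s..t, (t - r) ^ a • g r := by
    rw [fracInt, fracInt, ← intervalIntegral.integral_add_adjacent_intervals
      ((hc t).intervalIntegrable 0 s) ((hc t).intervalIntegrable s t)]
    simp only [sub_smul]
    rw [intervalIntegral.integral_sub ((hc t).intervalIntegrable 0 s)
      ((hc s).intervalIntegrable 0 s)]
    abel
  have b1 : ‖∫ r in (0 : ℝ)..s, ((t - r) ^ a - (s - r) ^ a) • g r‖ ≤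
      ∫ r in (0 : ℝ)..s, G * ((t - r) ^ a - (s - r) ^ a) := by
    refine intervalIntegral.norm_integral_le_of_norm_le hs (ae_of_all _ fun r hr => ?_)
      ((((hr t).sub (hr s)).const_mul G).intervalIntegrable _ _)
    have h1 : (s - r) ^ a ≤ (t - r) ^ a :=
      Real.rpow_le_rpow (by linarith [hr.2]) (by linarith) ha
    rw [norm_smul, Real.norm_of_nonneg (by linarith), mul_comm]
    exact mul_le_mul_of_nonneg_right (hG r) (by linarith)
  have b2 : ‖∫ r in s..t, (t - r) ^ a • g r‖ ≤ ∫ r in s..t, G * (t - r) ^ a := by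
    refine intervalIntegral.norm_integral_le_of_norm_le hst (ae_of_all _ fun r hr => ?_)
      (((hr t).const_mul G).intervalIntegrable _ _)
    have h1 : 0 ≤ (t - r) ^ a := Real.rpow_nonneg (by linarith [hr.2]) _
    rw [norm_smul, Real.norm_of_nonneg h1, mul_comm]
    exact mul_le_mul_of_nonneg_right (hG r) h1
  rw [intervalIntegral.integral_const_mul, intervalIntegral.integral_sub
    ((hr t).intervalIntegrable _ _) ((hr s).intervalIntegrable _ _), integral_sub_rpow ha 0] at b1
  rw [intervalIntegral.integral_const_mul] at b2
  have b3 := intervalIntegral.integral_add_adjacent_intervals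
      ((hr t).intervalIntegrable (μ := volume) 0 s) ((hr t).intervalIntegrable s t)
  rw [integral_sub_rpow ha 0] at b3
  rw [e]
  refine (norm_add_le _ _).trans ((add_le_add b1 b2).trans ?_)
  have b4 := rpow_sub_rpow_le (a := a + 1) (by linarith) hs hst htS
  rw [add_sub_cancel_right] at b4
  have b5 := (le_abs_self _).trans b4
  rw [← mul_add, mul_assoc]
  refine mul_le_mul_of_nonneg_left ?_ hG0
  have b6 : (∫ r in (0 : ℝ)..s, (t - r) ^ a) - (s - 0) ^ (a + 1) / (a + 1) +
      ∫ r in s..t, (t - r) ^ a = (t ^ (a + 1) - s ^ (a + 1)) / (a + 1) := by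
    rw [sub_zero] at b3 ⊢
    rw [sub_div, ← b3]
    ring
  rw [b6, div_le_iff₀ (by linarith)]
  linarith

/-- The truncated kernel `max (t - s) 0 ^ a` moves the variable upper limit into the integrand, over
a fixed interval. For `a = 1` it has a kink at `s = t`, so one differentiates under the integral
from a Lipschitz bound and differentiability for almost every `s`. -/
theorem hasDerivAt_fracInt [CompleteSpace E] {a G t : ℝ} (ha : 1 ≤ a) {g : ℝ → E}
    (hg : Continuous g) (hG : ∀ s, ‖g s‖ ≤ G) (ht : 0 < t) :
    HasDerivAt (fracInt a g) (a • fracInt (a - 1) g t) t := by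
  have ha0 : 0 ≤ a := by linarith
  set F : ℝ → ℝ → E := fun t' s => (max (t' - s) 0) ^ a • g s with hF
  set F' : ℝ → E := {s | s ≤ t}.indicator fun s => a • ((t - s) ^ (a - 1) • g s) with hF'
  have hFc : ∀ t', Continuous (F t') := fun t' =>
    (((continuous_const.sub continuous_id).max continuous_const).rpow_const
      fun _ => Or.inr ha0).smul hg
  have hFind : ∀ t', F t' = {s | s ≤ t'}.indicator fun s => (t' - s) ^ a • g s := by
    intro t'
    funext s
    by_cases hs : s ≤ t'
    · rw [indicator_of_mem (by exact hs)]
      simp only [hF]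
      rw [max_eq_left (by linarith)]
    · rw [indicator_of_notMem (by exact hs)]
      simp only [hF]
      rw [max_eq_right (by linarith), Real.zero_rpow (by linarith), zero_smul]
  have key := intervalIntegral.hasDerivAt_integral_of_dominated_loc_of_lip (μ := volume)
    (a := 0) (b := t + 1) (F := F) (F' := F') (x₀ := t)
    (bound := fun _ => a * (t + 1) ^ (a - 1) * G) (s := Ioo 0 (t + 1))
    (Ioo_mem_nhds ht (by linarith))
    (Eventually.of_forall fun t' => (hFc t').aestronglyMeasurable)
    ((hFc t).intervalIntegrable _ _)
    (((continuous_sub_rpow_smul (by linarith) hg t).const_smul a).aestronglyMeasurable.indicator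
      measurableSet_Iic)
    (by
      refine ae_of_all _ fun s hs => ?_
      rw [uIoc_of_le (by linarith)] at hs
      refine LipschitzOnWith.of_dist_le_mul fun u hu v hv => ?_
      have hG0 : 0 ≤ G := (norm_nonneg _).trans (hG 0)
      have hK : 0 ≤ a * (t + 1) ^ (a - 1) * G := by positivity
      rw [Real.coe_nnabs, abs_of_nonneg hK, dist_eq_norm, Real.dist_eq]
      simp only [hF]
      rw [← sub_smul, norm_smul, Real.norm_eq_abs]
      have hm : ∀ {w}, w ∈ Ioo 0 (t + 1) → max (w - s) 0 ≤ t + 1 := fun hw =>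
        max_le (by linarith [hw.2, hs.1]) (by linarith)
      have hl : |max (u - s) 0 - max (v - s) 0| ≤ |u - v| := by
        have := abs_max_sub_max_le_abs (u - s) (v - s) 0
        rwa [sub_sub_sub_cancel_right] at this
      have h1 : |max (u - s) 0 ^ a - max (v - s) 0 ^ a| ≤ a * (t + 1) ^ (a - 1) * |u - v| := by
        refine le_trans ?_ (mul_le_mul_of_nonneg_left hl (by positivity))
        rcases le_total (max (v - s) 0) (max (u - s) 0) with h | h
        · rw [abs_of_nonneg (sub_nonneg.2 h)]
          exact (le_abs_self _).trans (rpow_sub_rpow_le ha (le_max_right _ _) h (hm hu)) |>.trans_eq'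
            (by rw [abs_of_nonneg]; exact sub_nonneg.2 (Real.rpow_le_rpow (le_max_right _ _) h ha0))
        · rw [abs_sub_comm, abs_sub_comm (max (u - s) 0), abs_of_nonneg (sub_nonneg.2 h)]
          exact rpow_sub_rpow_le ha (le_max_right _ _) h (hm hv)
      calc _ ≤ (a * (t + 1) ^ (a - 1) * |u - v|) * G := by gcongr; exact hG s
        _ = _ := by ring)
    (by simp)
    (by
      have hne : ∀ᵐ s ∂(volume : Measure ℝ), s ≠ t := by
        rw [ae_iff]; simp
      filter_upwards [hne] with s hs _
      rcases lt_or_gt_of_ne hs with h | h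
      · rw [hF', indicator_of_mem (by exact h.le)]
        have h1 : HasDerivAt (fun u : ℝ => (u - s) ^ a) (a * (t - s) ^ (a - 1)) t := by
          have := ((hasDerivAt_id t).sub_const s).rpow_const (p := a) (Or.inr ha)
          simpa using this
        have h2 := h1.smul_const (g s)
        rw [mul_smul] at h2
        refine h2.congr_of_eventuallyEq ?_
        filter_upwards [Ioi_mem_nhds h] with u hu
        simp only [hF]
        rw [max_eq_left (by linarith [mem_Ioi.1 hu])]
      · rw [hF', indicator_of_notMem (by simpa using h)]
        refine (hasDerivAt_const t (0 : E)).congr_of_eventuallyEq ?_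
        filter_upwards [Iio_mem_nhds h] with u hu
        simp only [hF]
        rw [max_eq_right (by linarith [mem_Iio.1 hu]), Real.zero_rpow (by linarith), zero_smul])
  have h2 := key.2
  have e1 : ∫ s in (0 : ℝ)..(t + 1), F' s = a • fracInt (a - 1) g t := by
    rw [hF', intervalIntegral.integral_indicator ⟨ht.le, by linarith⟩,
      intervalIntegral.integral_smul]
    rfl
  rw [e1] at h2
  refine h2.congr_of_eventuallyEq ?_
  filter_upwards [Ioo_mem_nhds ht (by linarith : t < t + 1)] with u hu
  rw [hFind, intervalIntegral.integral_indicator ⟨hu.1.le, hu.2.le⟩]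
  rfl

end FracInt

/-! ### Right-hand sides given by fractional integrals -/

section Remainder

variable {E : Type*} [NormedAddCommGroup E] [NormedSpace ℝ E]

/-- The `k`-th derivative of the Riemann--Liouville integral of order `μ` of `g`. -/
noncomputable def rlChain (μ : ℝ) (g : ℝ → E) (k : ℕ) (t : ℝ) : E :=
  (Real.Gamma (μ - k))⁻¹ • fracInt (μ - k - 1) g t

/-- Chain of derivatives of the solution of `y' = -x y + I^μ g`, `y 0 = 0`. -/
noncomputable def rlSol (μ x : ℝ) (g : ℝ → E) : ℕ → ℝ → E
  | 0, t => expConv x (rlChain μ g 0) t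
  | k + 1, t => rlChain μ g k t - x • rlSol μ x g k t

variable {μ G : ℝ} {g : ℝ → E} {p : ℕ}

theorem rlChain_zero_right (μ : ℝ) (g : ℝ → E) (k : ℕ) : rlChain μ g k 0 = 0 := by
  rw [rlChain, fracInt_zero_right, smul_zero]

theorem norm_rlChain_le (hG : ∀ s, ‖g s‖ ≤ G) {k : ℕ} (hk : (k : ℝ) + 1 ≤ μ) {t : ℝ}
    (ht : 0 ≤ t) : ‖rlChain μ g k t‖ ≤ (Real.Gamma (μ - k))⁻¹ * (G * t ^ (μ - k)) := by
  have hΓ : 0 < Real.Gamma (μ - k) := Real.Gamma_pos_of_pos (by linarith)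
  rw [rlChain, norm_smul, norm_inv, Real.norm_of_nonneg hΓ.le]
  have := norm_fracInt_le (a := μ - k - 1) (by linarith) hG ht
  rw [sub_add_cancel] at this
  gcongr

theorem norm_rlChain_sub_le (hg : Continuous g) (hG : ∀ s, ‖g s‖ ≤ G) {k : ℕ}
    (hk : (k : ℝ) + 1 ≤ μ) {s t S : ℝ} (hs : 0 ≤ s) (hst : s ≤ t) (htS : t ≤ S) :
    ‖rlChain μ g k t - rlChain μ g k s‖ ≤
      (Real.Gamma (μ - k))⁻¹ * (G * S ^ (μ - k - 1) * (t - s)) := by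
  have hΓ : 0 < Real.Gamma (μ - k) := Real.Gamma_pos_of_pos (by linarith)
  rw [rlChain, rlChain, ← smul_sub, norm_smul, norm_inv, Real.norm_of_nonneg hΓ.le]
  have := norm_fracInt_sub_le (a := μ - k - 1) (by linarith) hg hG hs hst htS
  gcongr

theorem continuousOn_rlChain (hg : Continuous g) (hG : ∀ s, ‖g s‖ ≤ G) {k : ℕ}
    (hk : (k : ℝ) + 1 ≤ μ) (S : ℝ) : ContinuousOn (rlChain μ g k) (Icc 0 S) := by
  have hΓ : 0 < Real.Gamma (μ - k) := Real.Gamma_pos_of_pos (by linarith)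
  have hG0 : 0 ≤ G := (norm_nonneg _).trans (hG 0)
  rcases lt_or_ge S 0 with hS | hS
  · rw [Icc_eq_empty (by linarith)]; exact continuousOn_empty _
  have hK : 0 ≤ (Real.Gamma (μ - k))⁻¹ * (G * S ^ (μ - k - 1)) := by positivity
  refine LipschitzOnWith.continuousOn
    (K := ⟨(Real.Gamma (μ - k))⁻¹ * (G * S ^ (μ - k - 1)), hK⟩) ?_
  refine LipschitzOnWith.of_dist_le_mul fun u hu v hv => ?_
  rw [dist_eq_norm, Real.dist_eq]
  change _ ≤ (Real.Gamma (μ - k))⁻¹ * (G * S ^ (μ - k - 1)) * _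
  rcases le_total u v with h | h
  · rw [norm_sub_rev, abs_sub_comm, abs_of_nonneg (by linarith)]
    refine (norm_rlChain_sub_le hg hG hk hu.1 h hv.2).trans (le_of_eq ?_)
    ring
  · rw [abs_of_nonneg (by linarith)]
    refine (norm_rlChain_sub_le hg hG hk hv.1 h hu.2).trans (le_of_eq ?_)
    ring

theorem hasDerivAt_rlChain [CompleteSpace E] (hg : Continuous g) (hG : ∀ s, ‖g s‖ ≤ G) {k : ℕ}
    (hk : (k : ℝ) + 2 ≤ μ) {t : ℝ} (ht : 0 < t) :
    HasDerivAt (rlChain μ g k) (rlChain μ g (k + 1) t) t := by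
  have h1 := (hasDerivAt_fracInt (a := μ - k - 1) (by linarith) hg hG ht).const_smul
    (Real.Gamma (μ - k))⁻¹
  have h2 : HasDerivAt (rlChain μ g k)
      ((Real.Gamma (μ - k))⁻¹ • (μ - k - 1) • fracInt (μ - k - 1 - 1) g t) t := h1
  refine h2.congr_deriv ?_
  have e : μ - k = (μ - (k + 1 : ℕ)) + 1 := by push_cast; ring
  have e0 : μ - (k + 1 : ℕ) ≠ 0 := by push_cast; linarith
  have e1 : μ - k - 1 = μ - (k + 1 : ℕ) := by push_cast; ring
  rw [rlChain, smul_smul, e1, e, Real.Gamma_add_one e0, mul_inv, mul_comm _⁻¹, mul_assoc,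
    inv_mul_cancel₀ e0, mul_one]

theorem continuousOn_Ioi_rlChain (hg : Continuous g) (hG : ∀ s, ‖g s‖ ≤ G) {k : ℕ}
    (hk : (k : ℝ) + 1 ≤ μ) : ContinuousOn (rlChain μ g k) (Ioi 0) := by
  intro t ht
  have ht' : (0 : ℝ) < t := ht
  exact ((continuousOn_rlChain hg hG hk (t + 1)).continuousAt
    (Icc_mem_nhds ht' (by linarith))).continuousWithinAt

theorem intervalIntegrable_rlChain (hg : Continuous g) (hG : ∀ s, ‖g s‖ ≤ G) {k : ℕ}
    (hk : (k : ℝ) + 1 ≤ μ) {t : ℝ} (ht : 0 ≤ t) :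
    IntervalIntegrable (rlChain μ g k) volume 0 t := by
  apply ContinuousOn.intervalIntegrable
  rw [uIcc_of_le ht]
  exact continuousOn_rlChain hg hG hk t

theorem hasDerivAt_rlSol [CompleteSpace E] (hg : Continuous g) (hG : ∀ s, ‖g s‖ ≤ G) (x : ℝ)
    (k : ℕ) : (k : ℝ) + 1 ≤ μ → ∀ t > 0, HasDerivAt (rlSol μ x g k) (rlSol μ x g (k + 1) t) t := by
  induction k with
  | zero =>
    intro hk t ht
    exact hasDerivAt_expConv ht (intervalIntegrable_rlChain hg hG hk ht.le)
      (continuousOn_Ioi_rlChain hg hG hk)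
  | succ k ih =>
    intro hk t ht
    push_cast at hk
    exact (hasDerivAt_rlChain hg hG (by linarith) ht).sub
      ((ih (by linarith) t ht).const_smul x)

theorem continuousOn_rlSol (hg : Continuous g) (hG : ∀ s, ‖g s‖ ≤ G) (x : ℝ) {S : ℝ}
    (hS : 0 ≤ S) (k : ℕ) : (k : ℝ) + 1 ≤ μ → ContinuousOn (rlSol μ x g k) (Icc 0 S) := by
  induction k with
  | zero =>
    intro hk
    exact continuousOn_expConv hS (intervalIntegrable_rlChain hg hG hk hS)
  | succ k ih =>
    intro hk
    push_cast at hk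
    exact (continuousOn_rlChain hg hG (by linarith) S).sub
      ((ih (by linarith)).const_smul x)

theorem rlSol_zero_right (μ x : ℝ) (g : ℝ → E) (k : ℕ) : rlSol μ x g k 0 = 0 := by
  induction k with
  | zero => exact expConv_zero_right _ _
  | succ k ih => rw [rlSol, ih, rlChain_zero_right, smul_zero, sub_zero]

/-- The solution chain vanishes at the origin, so the `k`-th derivative of the solution solves the
same initial value problem with the `k`-th derivative of the data. -/
theorem rlSol_eq_expConv [CompleteSpace E] (hg : Continuous g) (hG : ∀ s, ‖g s‖ ≤ G) (x : ℝ)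
    {k : ℕ} (hk : (k : ℝ) + 1 ≤ μ) {t : ℝ} (ht : 0 ≤ t) :
    rlSol μ x g k t = expConv x (rlChain μ g k) t := by
  rw [duhamel (x := x) ht (continuousOn_rlSol hg hG x ht k hk)
    (fun s hs => hasDerivAt_rlSol hg hG x k hk s hs.1) (intervalIntegrable_rlChain hg hG hk ht),
    rlSol_zero_right, smul_zero, zero_add]
  rfl

theorem norm_rlSol_le [CompleteSpace E] (hg : Continuous g) (hG : ∀ s, ‖g s‖ ≤ G) {x : ℝ}
    (hx : 0 ≤ x) {k : ℕ} (hk : (k : ℝ) + 1 ≤ μ) {t : ℝ} (ht : 0 ≤ t) :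
    ‖rlSol μ x g k t‖ ≤
      (Real.Gamma (μ - k))⁻¹ * (G * t ^ (μ - k)) * (2 * t / (1 + x * t)) := by
  have hΓ : 0 < Real.Gamma (μ - k) := Real.Gamma_pos_of_pos (by linarith)
  have hG0 : 0 ≤ G := (norm_nonneg _).trans (hG 0)
  rw [rlSol_eq_expConv hg hG x hk ht]
  have := norm_integral_exp_smul_le (a := 0) (b := t) (g := rlChain μ g k)
    (B := (Real.Gamma (μ - k))⁻¹ * (G * t ^ (μ - k))) hx ht (fun s hs => by
      refine (norm_rlChain_le hG hk hs.1.le).trans ?_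
      have := hs.1.le
      gcongr
      · linarith
      · exact hs.2)
  rwa [sub_zero] at this

/-- The derivative of `expConv x w` for Lipschitz `w` vanishing at the origin. -/
theorem norm_sub_smul_expConv_le [CompleteSpace E] {x t L : ℝ} (hx : 0 ≤ x) (ht : 0 ≤ t) {w : ℝ → E}
    (hw : ContinuousOn w (Icc 0 t)) (h0 : w 0 = 0)
    (hL : ∀ s ∈ Icc 0 t, ‖w t - w s‖ ≤ L * (t - s)) :
    ‖w t - x • expConv x w t‖ ≤ L * (5 * (t / (1 + x * t))) := by
  rcases eq_or_lt_of_le ht with rfl | ht0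
  · simp [h0, expConv_zero_right]
  have hL0 : 0 ≤ L := by
    have := (norm_nonneg _).trans (hL 0 ⟨le_rfl, ht⟩)
    rw [sub_zero] at this
    exact nonneg_of_mul_nonneg_left this ht0
  have hden : 0 < 1 + x * t := by positivity
  have hwi : IntervalIntegrable w volume 0 t := by
    apply ContinuousOn.intervalIntegrable
    rwa [uIcc_of_le ht]
  have hexp : Continuous fun s : ℝ => Real.exp (-(x * (t - s))) := by fun_prop
  -- Write `w(t)` as `e^{-xt} w(t) + x ∫ e^{-x(t-s)} w(t) ds`; the large factor `x` then multiplies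
  -- only increments of `w`.
  have e : w t - x • expConv x w t = Real.exp (-(x * t)) • w t +
      ∫ s in (0 : ℝ)..t, (x * Real.exp (-(x * (t - s)))) • (w t - w s) := by
    have h1 := mul_integral_exp x 0 t
    rw [sub_zero] at h1
    have h2 : ∫ s in (0 : ℝ)..t, (x * Real.exp (-(x * (t - s)))) • (w t - w s) =
        x • ((∫ s in (0 : ℝ)..t, Real.exp (-(x * (t - s)))) • w t - expConv x w t) := by
      rw [expConv, ← intervalIntegral.integral_smul_const, ← intervalIntegral.integral_sub
        (Continuous.intervalIntegrable (by fun_prop) _ _)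
        (hwi.continuousOn_smul hexp.continuousOn), ← intervalIntegral.integral_smul]
      refine intervalIntegral.integral_congr fun s _ => ?_
      simp only [smul_sub, mul_smul]
    rw [h2, smul_sub, smul_smul, h1, sub_smul, one_smul]
    abel
  rw [e]
  have hwt : ‖w t‖ ≤ L * t := by
    have := hL 0 ⟨le_rfl, ht⟩
    rwa [h0, sub_zero, sub_zero] at this
  have b1 : ‖Real.exp (-(x * t)) • w t‖ ≤ L * (t / (1 + x * t)) := by
    rw [norm_smul, Real.norm_of_nonneg (Real.exp_pos _).le]
    have h1 : Real.exp (-(x * t)) ≤ 1 / (1 + x * t) := by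
      rw [Real.exp_neg, ← one_div]
      apply one_div_le_one_div_of_le hden
      linarith [Real.add_one_le_exp (x * t)]
    calc _ ≤ 1 / (1 + x * t) * (L * t) := by gcongr
      _ = _ := by ring
  have b2 : ‖∫ s in (0 : ℝ)..t, (x * Real.exp (-(x * (t - s)))) • (w t - w s)‖ ≤
      L * (4 * (t / (1 + x * t))) := by
    calc _ ≤ ∫ s in (0 : ℝ)..t, L * Real.exp (-(x / 2 * (t - s))) := by
          refine intervalIntegral.norm_integral_le_of_norm_le ht (ae_of_all _ fun s hs => ?_)
            (Continuous.intervalIntegrable (by fun_prop) _ _)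
          have hts : 0 ≤ t - s := by linarith [hs.2]
          rw [norm_smul, Real.norm_of_nonneg (by positivity)]
          -- Half of the exponential absorbs `x (t - s)`, which the Lipschitz bound has made
          -- available; the other half still supplies `1 / (1 + x t)`.
          have h1 : x * (t - s) * Real.exp (-(x * (t - s))) ≤ Real.exp (-(x / 2 * (t - s))) := by
            have h3 : x * (t - s) ≤ Real.exp (x / 2 * (t - s)) := by
              have := Real.quadratic_le_exp_of_nonneg (x := x / 2 * (t - s)) (by positivity)
              nlinarith [sq_nonneg (x / 2 * (t - s) - 1)]
            calc _ ≤ Real.exp (x / 2 * (t - s)) * Real.exp (-(x * (t - s))) := by gcongr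
              _ = _ := by rw [← Real.exp_add]; ring_nf
          calc _ ≤ x * Real.exp (-(x * (t - s))) * (L * (t - s)) := by
                gcongr
                exact hL s ⟨hs.1.le, hs.2⟩
            _ = L * (x * (t - s) * Real.exp (-(x * (t - s)))) := by ring
            _ ≤ _ := by gcongr
      _ = L * ∫ s in (0 : ℝ)..t, Real.exp (-(x / 2 * (t - s))) :=
          intervalIntegral.integral_const_mul _ _
      _ ≤ L * (2 * (t - 0) / (1 + x / 2 * (t - 0))) := by
          gcongr
          exact integral_exp_le (by positivity) ht
      _ ≤ _ := by
          gcongr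
          rw [sub_zero]
          have e : 4 * (t / (1 + x * t)) = 4 * t / (1 + x * t) := by ring
          rw [e, div_le_div_iff₀ (by positivity) hden]
          have : 0 ≤ x * t * t := by positivity
          nlinarith
  refine (norm_add_le _ _).trans ((add_le_add b1 b2).trans (le_of_eq ?_))
  ring

end Remainder

/-- An integral of order `μ ≥ p` of a bounded function has a Lipschitz derivative of order `p - 1`,
and its derivatives below order `p` vanish at `0`. It is therefore no worse than `t^p`, which fixes
the exponent `p` in place of `β`; the surplus `μ - p` goes into the constant as `T^{μ-p}`. -/
theorem RungeKutta.Admissible.exists_rlSol_solutionBounds {r : ℕ} {rk : RungeKutta (r + 1)}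
    {p q : ℕ} (h : rk.Admissible p q) {μ T : ℝ} (hμ : (p : ℝ) ≤ μ) (hT : 0 < T) :
    ∃ C : ℝ, 0 < C ∧ ∀ (E : Type u) [NormedAddCommGroup E] [NormedSpace ℂ E] [CompleteSpace E]
      (g : ℝ → E) (G x S : ℝ), Continuous g → (∀ s, ‖g s‖ ≤ G) → 0 ≤ x → S ≤ T →
      HasSolutionBounds rk p q p S x (C * G) (rlSol μ x g) (rlChain μ g 0) := by
  have hp1 := h.one_le_p
  have hp1R : (1 : ℝ) ≤ p := by exact_mod_cast hp1
  have hΓ : ∀ k < p, 0 < (Real.Gamma (μ - k))⁻¹ := fun k hk => by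
    have : (k : ℝ) + 1 ≤ p := by exact_mod_cast hk
    exact inv_pos.2 (Real.Gamma_pos_of_pos (by linarith))
  set K : ℝ := ∑ k ∈ Finset.range p, (Real.Gamma (μ - k))⁻¹ with hK
  have hKk : ∀ k < p, (Real.Gamma (μ - k))⁻¹ ≤ K := fun k hk =>
    Finset.single_le_sum (f := fun k : ℕ => (Real.Gamma (μ - k))⁻¹)
      (fun k hk => (hΓ k (Finset.mem_range.1 hk)).le) (Finset.mem_range.2 hk)
  have hK0 : 0 < K := (hΓ 0 hp1).trans_le (hKk 0 hp1)
  refine ⟨6 * (K * T ^ (μ - p)), by positivity, ?_⟩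
  intro E _ _ _ g G x S hg hG hx hST
  have hG0 : 0 ≤ G := (norm_nonneg _).trans (hG 0)
  have hlt : ∀ k < p, (k : ℝ) + 1 ≤ μ := fun k hk => by
    have : (k : ℝ) + 1 ≤ p := by exact_mod_cast hk
    linarith
  set w : ℝ := T ^ (μ - p) with hw
  have hw0 : 0 < w := by positivity
  have hrpow : ∀ (e : ℝ) {t : ℝ}, t ∈ Ioc 0 S → t ^ (e + (μ - p)) ≤ w * t ^ e := by
    intro e t ht
    have ht0 := ht.1
    rw [Real.rpow_add ht0, mul_comm]
    exact mul_le_mul_of_nonneg_right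
      (Real.rpow_le_rpow ht0.le (ht.2.trans hST) (by linarith)) (by positivity)
  -- derivatives of order below `p`
  have hlow : ∀ k < p, ∀ t ∈ Ioc 0 S, ‖rlSol μ x g k t‖ ≤
      6 * (K * w) * G * (t ^ ((p : ℝ) + 1 - k) / (1 + x * t)) := by
    intro k hk t ht
    have ht0 : 0 < t := ht.1
    refine (norm_rlSol_le hg hG hx (hlt k hk) ht0.le).trans ?_
    have e : t ^ (μ - k) * t = t ^ (((p : ℝ) + 1 - k) + (μ - p)) := by
      rw [← Real.rpow_add_one ht0.ne']; ring_nf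
    have h1 := hrpow ((p : ℝ) + 1 - k) ht
    have h2 := (hΓ k hk).le
    calc _ = (Real.Gamma (μ - k))⁻¹ * (2 * G) * (t ^ (μ - k) * t) / (1 + x * t) := by ring
      _ ≤ K * (2 * G) * (w * t ^ ((p : ℝ) + 1 - k)) / (1 + x * t) := by
          rw [e]
          gcongr
          exact hKk k hk
      _ = 2 * (K * w * G * (t ^ ((p : ℝ) + 1 - k) / (1 + x * t))) := by ring
      _ ≤ 6 * (K * w * G * (t ^ ((p : ℝ) + 1 - k) / (1 + x * t))) := by
          gcongr
          norm_num
      _ = _ := by ring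
  -- The data are differentiated only `p - 1` times, since `μ` may equal `p`. The `p`-th derivative
  -- of the solution is read off from the equation and estimated through the Lipschitz constant `L`.
  obtain ⟨p', hp'⟩ : ∃ l, p = l + 1 := ⟨p - 1, by omega⟩
  have hp'lt : p' < p := by omega
  have hp'R : (p : ℝ) = p' + 1 := by rw [hp']; push_cast; ring
  set L : ℝ := K * (G * w) with hL
  have hL0 : 0 ≤ L := by positivity
  have hlip : ∀ s t, 0 ≤ s → s ≤ t → t ≤ S →
      ‖rlChain μ g p' t - rlChain μ g p' s‖ ≤ L * (t - s) := by
    intro s t hs hst htS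
    refine (norm_rlChain_sub_le hg hG (hlt p' hp'lt) hs hst (htS.trans hST)).trans ?_
    have e : μ - p' - 1 = μ - p := by rw [hp'R]; ring
    rw [e, ← hw]
    have h2 := (hΓ p' hp'lt).le
    have h3 : 0 ≤ t - s := by linarith
    calc _ ≤ K * (G * w * (t - s)) := by gcongr; exact hKk p' hp'lt
      _ = _ := by rw [hL]; ring
  -- derivative of order `p`
  have htop : ∀ t ∈ Ioc 0 S, ‖rlSol μ x g p t‖ ≤ L * (5 * (t / (1 + x * t))) := by
    intro t ht
    rw [hp', rlSol, rlSol_eq_expConv hg hG x (hlt p' hp'lt) ht.1.le]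
    exact norm_sub_smul_expConv_le hx ht.1.le (continuousOn_rlChain hg hG (hlt p' hp'lt) t)
      (rlChain_zero_right _ _ _) fun s hs => hlip s t hs.1 hs.2 ht.2
  refine ⟨fun k hk t ht => hasDerivAt_rlSol hg hG x k (hlt k hk) t ht, fun t ht => rfl,
    rlSol_zero_right _ _ _ _, fun t ht => ?_, fun k hk t ht => ?_, fun s hs t ht => ?_,
    fun i t ht => ?_⟩
  · simpa using hlow 0 hp1 t ht
  · rw [Finset.mem_Ioc] at hk
    rcases eq_or_lt_of_le hk.2 with rfl | hkp
    · have ht0 := ht.1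
      refine (htop t ht).trans ?_
      rw [add_sub_cancel_left, Real.rpow_one]
      calc _ = 5 * (L * (t / (1 + x * t))) := by ring
        _ ≤ 6 * (L * (t / (1 + x * t))) := by gcongr; norm_num
        _ = _ := by rw [hL]; ring
    · exact hlow k hkp t ht
  · have hs0 : 0 < s := hs.1
    have hts : 0 ≤ t - s := by linarith [ht.1]
    rw [sub_self, Real.rpow_zero, Real.rpow_zero, hp', rlSol, rlSol]
    -- The bound `‖v p‖ ≤ 5 L / x` makes the increment of `v (p - 1)` small enough to cancel the
    -- factor `x`, so the Lipschitz constant of `v p` is uniform in `x`.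
    have h1 : ‖rlSol μ x g p' t - rlSol μ x g p' s‖ * x ≤ 5 * L * (t - s) := by
      rcases eq_or_lt_of_le hx with rfl | hx0
      · simp; positivity
      have hd : ∀ u ∈ Icc s t, HasDerivWithinAt (rlSol μ x g p') (rlSol μ x g p u) (Icc s t) u := by
        intro u hu
        rw [hp']
        exact (hasDerivAt_rlSol hg hG x p' (hlt p' hp'lt) u (hs0.trans_le hu.1)).hasDerivWithinAt
      have hn : ∀ u ∈ Icc s t, ‖rlSol μ x g p u‖ ≤ 5 * L / x := by
        intro u hu
        have hu0 : 0 < u := hs0.trans_le hu.1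
        refine (htop u ⟨hu0, hu.2.trans ht.2⟩).trans ?_
        have : u / (1 + x * u) ≤ 1 / x := by
          rw [div_le_div_iff₀ (by positivity) hx0]
          nlinarith
        calc _ ≤ L * (5 * (1 / x)) := by gcongr
          _ = _ := by ring
      have := (convex_Icc s t).norm_image_sub_le_of_norm_hasDerivWithin_le hd hn
        (left_mem_Icc.2 ht.1) (right_mem_Icc.2 ht.1)
      rw [Real.norm_of_nonneg hts] at this
      calc _ ≤ 5 * L / x * (t - s) * x := by gcongr
        _ = _ := by field_simp
    have e : rlChain μ g p' t - x • rlSol μ x g p' t - (rlChain μ g p' s - x • rlSol μ x g p' s) =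
        (rlChain μ g p' t - rlChain μ g p' s) - x • (rlSol μ x g p' t - rlSol μ x g p' s) := by
      rw [smul_sub]; abel
    rw [e]
    refine (norm_sub_le _ _).trans ?_
    rw [norm_smul, Real.norm_of_nonneg hx, mul_comm x]
    have h2 := hlip s t hs0.le ht.1 ht.2
    have h3 : 0 ≤ L * (t - s) := by positivity
    calc _ ≤ L * (t - s) + 5 * L * (t - s) := add_le_add h2 h1
      _ = 6 * (L * (t - s)) := by ring
      _ ≤ 12 * (L * (t - s)) := by linarith
      _ = _ := by rw [hL]; ring
  · have ht0 : 0 < t := ht.1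
    have hc := h.c_mem i
    have h0 := norm_rlChain_le hG (hlt 0 hp1) (mul_nonneg hc.1 ht0.le)
    refine h0.trans ?_
    have h1 : (rk.c i * t) ^ (μ - (0 : ℕ)) ≤ t ^ (μ - (0 : ℕ)) := by
      refine Real.rpow_le_rpow (mul_nonneg hc.1 ht0.le) ?_ ?_
      · exact mul_le_of_le_one_left ht0.le hc.2
      · push_cast; linarith
    have h2 : t ^ (μ - (0 : ℕ)) ≤ w * t ^ (p : ℝ) := by
      have := hrpow p ht
      convert this using 2
      push_cast
      ring
    have h3 := hKk 0 hp1
    have h4 := (hΓ 0 hp1).le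
    have h5 : (0 : ℝ) ≤ (rk.c i * t) ^ (μ - (0 : ℕ)) := Real.rpow_nonneg (mul_nonneg hc.1 ht0.le) _
    calc _ ≤ K * (G * (w * t ^ (p : ℝ))) := by
          gcongr
          exact h1.trans h2
      _ = 1 * (K * w * G * t ^ (p : ℝ)) := by ring
      _ ≤ 6 * (K * w * G * t ^ (p : ℝ)) := by gcongr; norm_num
      _ = _ := by ring

end GCQ

namespace GCQ

/-! ### Boundary values of sectorial transfer operators -/

section Edges

variable {X : Type u} {Y : Type v} [NormedAddCommGroup X] [NormedSpace ℂ X]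
  [NormedAddCommGroup Y] [NormedSpace ℂ Y]
  {K Kp Km : ℂ → X →L[ℂ] Y} {M α : ℝ}

theorem mem_closure_im_pos {z : ℂ} (hz : 0 ≤ z.im) : z ∈ closure {w : ℂ | 0 < w.im} := by
  rw [Complex.closure_setOfPred_lt_im]; exact hz

theorem mem_closure_im_neg {z : ℂ} (hz : z.im ≤ 0) : z ∈ closure {w : ℂ | w.im < 0} := by
  rw [Complex.closure_setOfPred_im_lt]; exact hz

theorem tendsto_upper (hc : ContinuousOn Kp {z | 0 ≤ z.im ∧ z ≠ 0})
    (he : EqOn Kp K {z | 0 < z.im}) {z : ℂ} (hz : 0 ≤ z.im) (hz0 : z ≠ 0) :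
    Tendsto K (𝓝[{w : ℂ | 0 < w.im}] z) (𝓝 (Kp z)) := by
  have h := (hc z ⟨hz, hz0⟩).mono_left (nhdsWithin_mono z (s := {w : ℂ | 0 < w.im})
    fun w (hw : 0 < w.im) => ⟨hw.le, fun h => by simp [h] at hw⟩)
  exact h.congr' (eventually_nhdsWithin_of_forall he)

theorem tendsto_lower (hc : ContinuousOn Km {z | z.im ≤ 0 ∧ z ≠ 0})
    (he : EqOn Km K {z | z.im < 0}) {z : ℂ} (hz : z.im ≤ 0) (hz0 : z ≠ 0) :
    Tendsto K (𝓝[{w : ℂ | w.im < 0}] z) (𝓝 (Km z)) := by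
  have h := (hc z ⟨hz, hz0⟩).mono_left (nhdsWithin_mono z (s := {w : ℂ | w.im < 0})
    fun w (hw : w.im < 0) => ⟨hw.le, fun h => by simp [h] at hw⟩)
  exact h.congr' (eventually_nhdsWithin_of_forall he)

theorem upperEdge_eq (hc : ContinuousOn Kp {z | 0 ≤ z.im ∧ z ≠ 0})
    (he : EqOn Kp K {z | 0 < z.im}) {x : ℝ} (hx : 0 < x) : upperEdge K x = Kp (-(x : ℂ)) := by
  have : NeBot (𝓝[{w : ℂ | 0 < w.im}] (-(x : ℂ))) :=
    mem_closure_iff_nhdsWithin_neBot.mp (mem_closure_im_pos (by simp))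
  exact (tendsto_upper hc he (by simp) (by simpa using hx.ne')).limUnder_eq

theorem lowerEdge_eq (hc : ContinuousOn Km {z | z.im ≤ 0 ∧ z ≠ 0})
    (he : EqOn Km K {z | z.im < 0}) {x : ℝ} (hx : 0 < x) : lowerEdge K x = Km (-(x : ℂ)) := by
  have : NeBot (𝓝[{w : ℂ | w.im < 0}] (-(x : ℂ))) :=
    mem_closure_iff_nhdsWithin_neBot.mp (mem_closure_im_neg (by simp))
  exact (tendsto_lower hc he (by simp) (by simpa using hx.ne')).limUnder_eq

theorem IsSectorial.norm_upper_le (h : IsSectorial K M α)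
    (hc : ContinuousOn Kp {z | 0 ≤ z.im ∧ z ≠ 0})
    (he : EqOn Kp K {z | 0 < z.im}) {z : ℂ} (hz : 0 ≤ z.im) (hz0 : z ≠ 0) :
    ‖Kp z‖ ≤ M * ‖z‖ ^ (-α) := by
  have : NeBot (𝓝[{w : ℂ | 0 < w.im}] z) :=
    mem_closure_iff_nhdsWithin_neBot.mp (mem_closure_im_pos hz)
  have h2 : Tendsto (fun w : ℂ => M * ‖w‖ ^ (-α)) (𝓝[{w : ℂ | 0 < w.im}] z)
      (𝓝 (M * ‖z‖ ^ (-α))) :=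
    ((continuous_norm.continuousAt.rpow_const (Or.inl (norm_ne_zero_iff.mpr hz0))).tendsto.const_mul
      M).mono_left nhdsWithin_le_nhds
  exact le_of_tendsto_of_tendsto (tendsto_upper hc he hz hz0).norm h2
    (eventually_nhdsWithin_of_forall fun w (hw : 0 < w.im) =>
      h.bound w (Or.inr hw.ne'))

theorem IsSectorial.norm_lower_le (h : IsSectorial K M α)
    (hc : ContinuousOn Km {z | z.im ≤ 0 ∧ z ≠ 0})
    (he : EqOn Km K {z | z.im < 0}) {z : ℂ} (hz : z.im ≤ 0) (hz0 : z ≠ 0) :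
    ‖Km z‖ ≤ M * ‖z‖ ^ (-α) := by
  have : NeBot (𝓝[{w : ℂ | w.im < 0}] z) :=
    mem_closure_iff_nhdsWithin_neBot.mp (mem_closure_im_neg hz)
  have h2 : Tendsto (fun w : ℂ => M * ‖w‖ ^ (-α)) (𝓝[{w : ℂ | w.im < 0}] z)
      (𝓝 (M * ‖z‖ ^ (-α))) :=
    ((continuous_norm.continuousAt.rpow_const (Or.inl (norm_ne_zero_iff.mpr hz0))).tendsto.const_mul
      M).mono_left nhdsWithin_le_nhds
  exact le_of_tendsto_of_tendsto (tendsto_lower hc he hz hz0).norm h2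
    (eventually_nhdsWithin_of_forall fun w (hw : w.im < 0) =>
      h.bound w (Or.inr hw.ne))

/-- Adds the positive real axis to the set where the upper extension is known to be `K`, which
allows the two extensions to be glued along it. -/
theorem IsSectorial.upper_eq (h : IsSectorial K M α)
    (hc : ContinuousOn Kp {z | 0 ≤ z.im ∧ z ≠ 0})
    (he : EqOn Kp K {z | 0 < z.im}) {z : ℂ} (hz : 0 ≤ z.im) (hs : z ∈ Complex.slitPlane) :
    Kp z = K z := by
  have : NeBot (𝓝[{w : ℂ | 0 < w.im}] z) :=
    mem_closure_iff_nhdsWithin_neBot.mp (mem_closure_im_pos hz)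
  refine tendsto_nhds_unique (tendsto_upper hc he hz (Complex.slitPlane_ne_zero hs)) ?_
  exact (((h.holomorphic z hs).differentiableAt
    (Complex.isOpen_slitPlane.mem_nhds hs)).continuousAt.tendsto).mono_left nhdsWithin_le_nhds

theorem IsSectorial.lower_eq (h : IsSectorial K M α)
    (hc : ContinuousOn Km {z | z.im ≤ 0 ∧ z ≠ 0})
    (he : EqOn Km K {z | z.im < 0}) {z : ℂ} (hz : z.im ≤ 0) (hs : z ∈ Complex.slitPlane) :
    Km z = K z := by
  have : NeBot (𝓝[{w : ℂ | w.im < 0}] z) :=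
    mem_closure_iff_nhdsWithin_neBot.mp (mem_closure_im_neg hz)
  refine tendsto_nhds_unique (tendsto_lower hc he hz (Complex.slitPlane_ne_zero hs)) ?_
  exact (((h.holomorphic z hs).differentiableAt
    (Complex.isOpen_slitPlane.mem_nhds hs)).continuousAt.tendsto).mono_left nhdsWithin_le_nhds

theorem IsSectorial.continuousOn_density (h : IsSectorial K M α) :
    ContinuousOn (density K) (Ioi 0) := by
  obtain ⟨Kp, hpc, hpe⟩ := h.upper
  obtain ⟨Km, hmc, hme⟩ := h.lower
  have h1 : ContinuousOn (fun x : ℝ => Kp (-(x : ℂ))) (Ioi 0) :=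
    hpc.comp (by fun_prop) fun x (hx : 0 < x) => ⟨by simp, by simpa using hx.ne'⟩
  have h2 : ContinuousOn (fun x : ℝ => Km (-(x : ℂ))) (Ioi 0) :=
    hmc.comp (by fun_prop) fun x (hx : 0 < x) => ⟨by simp, by simpa using hx.ne'⟩
  exact ((h2.sub h1).const_smul (2 * (Real.pi : ℂ) * Complex.I)⁻¹).congr fun x hx => by
    simp only [density, upperEdge_eq hpc hpe hx, lowerEdge_eq hmc hme hx]; rfl

theorem IsSectorial.norm_density_le (h : IsSectorial K M α) {x : ℝ} (hx : 0 < x) :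
    ‖density K x‖ ≤ M * x ^ (-α) := by
  obtain ⟨Kp, hpc, hpe⟩ := h.upper
  obtain ⟨Km, hmc, hme⟩ := h.lower
  have h1 := h.norm_upper_le hpc hpe (z := -(x : ℂ)) (by simp) (by simpa using hx.ne')
  have h2 := h.norm_lower_le hmc hme (z := -(x : ℂ)) (by simp) (by simpa using hx.ne')
  have hn : ‖-(x : ℂ)‖ = x := by simp [abs_of_pos hx]
  rw [hn] at h1 h2
  have hC : ‖(2 * (Real.pi : ℂ) * Complex.I)⁻¹‖ = (2 * Real.pi)⁻¹ := by
    simp [abs_of_pos Real.pi_pos, mul_comm]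
  rw [density, norm_smul, upperEdge_eq hpc hpe hx, lowerEdge_eq hmc hme hx, hC]
  have h3 := (norm_sub_le (Km (-(x : ℂ))) (Kp (-(x : ℂ)))).trans (add_le_add h2 h1)
  have h0 : 0 ≤ M * x ^ (-α) := (norm_nonneg _).trans h1
  have hpi : (2 * Real.pi)⁻¹ ≤ 1 / 2 := by
    rw [inv_le_comm₀ (by positivity) (by norm_num)]; norm_num; linarith [Real.pi_gt_three]
  calc (2 * Real.pi)⁻¹ * ‖Km (-(x : ℂ)) - Kp (-(x : ℂ))‖
      ≤ 1 / 2 * (M * x ^ (-α) + M * x ^ (-α)) := by gcongr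
    _ = M * x ^ (-α) := by ring

end Edges

/-! ### Cauchy's integral formula on the strip `|Im w| ≤ π` -/

section Strip

variable {E : Type*} [NormedAddCommGroup E] [NormedSpace ℂ E]

/-- Two preimages of a point differ by a multiple of `2πi`, while a point of the closed strip and
one of the open strip have imaginary parts less than `2π` apart. -/
theorem exp_ne_exp_of_strip {w w₀ : ℂ} (hw : |w.im| ≤ Real.pi) (hw₀ : |w₀.im| < Real.pi)
    (hne : w ≠ w₀) : Complex.exp w ≠ Complex.exp w₀ := by
  intro h
  obtain ⟨n, hn⟩ := Complex.exp_eq_exp_iff_exists_int.mp h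
  have him : w.im = w₀.im + n * (2 * Real.pi) := by rw [hn]; simp
  have h1 := abs_le.mp hw
  have h2 := abs_lt.mp hw₀
  have hpi := Real.pi_pos
  have hlt : (n : ℝ) < 1 := by by_contra! hc; nlinarith
  have hgt : (-1 : ℝ) < n := by by_contra! hc; nlinarith
  have hn0 : n = 0 := by
    have a1 : n < 1 := by exact_mod_cast hlt
    have a2 : -1 < n := by exact_mod_cast hgt
    omega
  exact hne (by rw [hn, hn0]; simp)

theorem dslope_exp_ne_zero {w w₀ : ℂ} (hw : |w.im| ≤ Real.pi) (hw₀ : |w₀.im| < Real.pi) :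
    dslope Complex.exp w₀ w ≠ 0 := by
  by_cases hne : w = w₀
  · rw [hne, dslope_same]; simp
  · rw [dslope_of_ne _ hne, slope_def_field]
    exact div_ne_zero (sub_ne_zero.mpr (exp_ne_exp_of_strip hw hw₀ hne)) (sub_ne_zero.mpr hne)

/-- The integrand of Cauchy's formula in exponential coordinates, with its singularity removed. -/
noncomputable def stripKernel (F : ℂ → E) (w₀ w : ℂ) : E :=
  (Complex.exp w / dslope Complex.exp w₀ w) • dslope F w₀ w

theorem stripKernel_of_ne (F : ℂ → E) {w₀ w : ℂ} (hne : w ≠ w₀) :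
    stripKernel F w₀ w =
      (Complex.exp w / (Complex.exp w - Complex.exp w₀)) • (F w - F w₀) := by
  have h : w - w₀ ≠ 0 := sub_ne_zero.mpr hne
  rw [stripKernel, dslope_of_ne _ hne, dslope_of_ne _ hne, slope_def_field, slope_def_module,
    smul_smul]
  congr 1
  by_cases h2 : Complex.exp w - Complex.exp w₀ = 0
  · simp [h2]
  · field_simp

theorem strip_mem_nhds {w₀ : ℂ} (hw₀ : |w₀.im| < Real.pi) : {w : ℂ | |w.im| < Real.pi} ∈ 𝓝 w₀ :=
  (isOpen_lt (by fun_prop) continuous_const).mem_nhds hw₀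

variable {F : ℂ → E} {M α : ℝ} {w₀ : ℂ}

theorem continuousOn_stripKernel (hc : ContinuousOn F {w | |w.im| ≤ Real.pi})
    (hd : DifferentiableOn ℂ F {w | |w.im| < Real.pi}) (hw₀ : |w₀.im| < Real.pi) :
    ContinuousOn (stripKernel F w₀) {w | |w.im| ≤ Real.pi} := by
  have hn : {w : ℂ | |w.im| ≤ Real.pi} ∈ 𝓝 w₀ :=
    mem_of_superset (strip_mem_nhds hw₀) fun w (hw : |w.im| < Real.pi) => hw.le
  have h1 : ContinuousOn (dslope F w₀) {w | |w.im| ≤ Real.pi} :=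
    (continuousOn_dslope hn).mpr ⟨hc, hd.differentiableAt (strip_mem_nhds hw₀)⟩
  have h2 : ContinuousOn (dslope Complex.exp w₀) {w | |w.im| ≤ Real.pi} :=
    (continuousOn_dslope hn).mpr ⟨by fun_prop, by fun_prop⟩
  exact (Complex.continuous_exp.continuousOn.div h2
    fun w hw => dslope_exp_ne_zero hw hw₀).smul h1

theorem differentiableOn_stripKernel [CompleteSpace E]
    (hd : DifferentiableOn ℂ F {w | |w.im| < Real.pi}) (hw₀ : |w₀.im| < Real.pi) :
    DifferentiableOn ℂ (stripKernel F w₀) {w | |w.im| < Real.pi} := by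
  have h1 : DifferentiableOn ℂ (dslope F w₀) {w | |w.im| < Real.pi} :=
    (Complex.differentiableOn_dslope (strip_mem_nhds hw₀)).mpr hd
  have h2 : DifferentiableOn ℂ (dslope Complex.exp w₀) {w | |w.im| < Real.pi} :=
    (Complex.differentiableOn_dslope (strip_mem_nhds hw₀)).mpr
      Complex.differentiable_exp.differentiableOn
  exact (Complex.differentiable_exp.differentiableOn.div h2
    fun w (hw : |w.im| < Real.pi) => dslope_exp_ne_zero hw.le hw₀).smul h1

/-- Far to the right `e^w / (e^w - e^{w₀})` tends to `1` and `F` decays because `α > 0`, so the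
kernel tends to `-F w₀`. Having removed the singularity, one recovers the residue from this side of
the rectangle. -/
theorem norm_stripKernel_add_le (hb : ∀ w : ℂ, |w.im| ≤ Real.pi → ‖F w‖ ≤ M * Real.exp (-α * w.re))
    {w : ℂ} (hw : |w.im| ≤ Real.pi) (hL : 2 * ‖Complex.exp w₀‖ ≤ Real.exp w.re) :
    ‖stripKernel F w₀ w + F w₀‖ ≤
      2 * (M * Real.exp (-α * w.re)) + 2 * ‖Complex.exp w₀‖ * Real.exp (-w.re) * ‖F w₀‖ := by
  have h0 : 0 < ‖Complex.exp w₀‖ := norm_pos_iff.mpr (Complex.exp_ne_zero _)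
  have hne : w ≠ w₀ := by
    rintro rfl; rw [Complex.norm_exp] at hL h0; linarith
  set d := Complex.exp w - Complex.exp w₀ with hd
  have hdn : Real.exp w.re / 2 ≤ ‖d‖ := by
    have := norm_sub_norm_le (Complex.exp w) (Complex.exp w₀)
    rw [Complex.norm_exp w] at this; linarith
  have hE := Real.exp_pos w.re
  have hd0 : d ≠ 0 := norm_pos_iff.mp (by linarith)
  have heq : stripKernel F w₀ w + F w₀ =
      (Complex.exp w / d) • F w - (Complex.exp w₀ / d) • F w₀ := by
    have : Complex.exp w₀ / d = Complex.exp w / d - 1 := by field_simp; rw [hd]; ring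
    rw [stripKernel_of_ne F hne, this, smul_sub, sub_smul, one_smul]; abel
  have h1 : ‖Complex.exp w / d‖ ≤ 2 := by
    rw [norm_div, Complex.norm_exp w, div_le_iff₀ (by linarith)]; linarith
  have h2 : ‖Complex.exp w₀ / d‖ ≤ 2 * ‖Complex.exp w₀‖ * Real.exp (-w.re) := by
    rw [norm_div, div_le_iff₀ (by linarith), Real.exp_neg]
    have : ‖Complex.exp w₀‖ = 2 * ‖Complex.exp w₀‖ * (Real.exp w.re)⁻¹ * (Real.exp w.re / 2) := by
      field_simp
    calc _ = _ := this
      _ ≤ _ := by gcongr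
  rw [heq]
  refine (norm_sub_le _ _).trans ?_
  rw [norm_smul, norm_smul]
  gcongr
  exact hb w hw

/-- Far to the left the factor `e^w` dominates the growth `e^{-α Re w}` of `F` because `α < 1`. -/
theorem norm_stripKernel_le (hb : ∀ w : ℂ, |w.im| ≤ Real.pi → ‖F w‖ ≤ M * Real.exp (-α * w.re))
    {w : ℂ} (hw : |w.im| ≤ Real.pi) (hL : 2 * Real.exp w.re ≤ ‖Complex.exp w₀‖) :
    ‖stripKernel F w₀ w‖ ≤
      2 / ‖Complex.exp w₀‖ * (M * Real.exp ((1 - α) * w.re) + Real.exp w.re * ‖F w₀‖) := by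
  have h0 : 0 < ‖Complex.exp w₀‖ := norm_pos_iff.mpr (Complex.exp_ne_zero _)
  have hne : w ≠ w₀ := by
    rintro rfl; rw [Complex.norm_exp] at hL h0; linarith
  have hdn : ‖Complex.exp w₀‖ / 2 ≤ ‖Complex.exp w - Complex.exp w₀‖ := by
    have := norm_sub_norm_le (Complex.exp w₀) (Complex.exp w)
    rw [norm_sub_rev, Complex.norm_exp w] at this; linarith
  rw [stripKernel_of_ne F hne, norm_smul, norm_div, Complex.norm_exp w]
  have h1 : Real.exp w.re / ‖Complex.exp w - Complex.exp w₀‖ ≤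
      Real.exp w.re / (‖Complex.exp w₀‖ / 2) := by gcongr
  have h2 := (norm_sub_le (F w) (F w₀)).trans (add_le_add_left (hb w hw) _)
  calc _ ≤ Real.exp w.re / (‖Complex.exp w₀‖ / 2) * (M * Real.exp (-α * w.re) + ‖F w₀‖) := by
        gcongr
    _ = _ := by
        have : Real.exp ((1 - α) * w.re) = Real.exp w.re * Real.exp (-α * w.re) := by
          rw [← Real.exp_add]; ring_nf
        rw [this]; field_simp

/-- In the coordinate `z = e^w` a keyhole contour around the cut becomes the boundary of `[-L, L] ×
[-π, π]`. The desingularised kernel integrates to zero over it; the horizontal sides give the jump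
of `F`, where `e^{x ± iπ} = -e^x`. As `L → ∞` the left side vanishes and the right side contributes
`2πi F(w₀)`. -/
theorem tendsto_strip_integral [CompleteSpace E] (hα0 : 0 < α) (hα1 : α < 1)
    (hc : ContinuousOn F {w | |w.im| ≤ Real.pi})
    (hd : DifferentiableOn ℂ F {w | |w.im| < Real.pi})
    (hb : ∀ w : ℂ, |w.im| ≤ Real.pi → ‖F w‖ ≤ M * Real.exp (-α * w.re))
    (hw₀ : |w₀.im| < Real.pi) :
    Tendsto (fun L : ℝ => ∫ x in -L..L, (Complex.exp x / (Complex.exp x + Complex.exp w₀)) •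
        (F (x + (-Real.pi : ℝ) * Complex.I) - F (x + Real.pi * Complex.I)))
      atTop (𝓝 ((2 * Real.pi * Complex.I) • F w₀)) := by
  have hpi := Real.pi_pos
  have hK := continuousOn_stripKernel hc hd hw₀
  have hKd := differentiableOn_stripKernel hd hw₀
  have hside : ∀ (x y : ℝ), |y| ≤ Real.pi → |((x : ℂ) + y * Complex.I).im| ≤ Real.pi := by
    intro x y hy; simpa using hy
  have hline : ∀ y : ℝ, |y| ≤ Real.pi →
      Continuous fun x : ℝ => stripKernel F w₀ (x + y * Complex.I) := fun y hy =>
    hK.comp_continuous (by fun_prop) fun x => hside x y hy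
  have hcol : ∀ x a b : ℝ, |a| ≤ Real.pi → |b| ≤ Real.pi →
      ContinuousOn (fun y : ℝ => stripKernel F w₀ (x + y * Complex.I)) (uIcc a b) := by
    intro x a b ha hb
    refine hK.comp (by fun_prop) fun y hy => hside x y ?_
    exact abs_le.mpr ((uIcc_subset_Icc (abs_le.mp ha) (abs_le.mp hb)) hy)
  have hpp : |Real.pi| ≤ Real.pi := (abs_of_pos hpi).le
  have hpm : |(-Real.pi)| ≤ Real.pi := by rw [abs_neg]; exact hpp
  have hexp : ∀ x : ℝ, Complex.exp (x + Real.pi * Complex.I) = -Complex.exp x := by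
    intro x; rw [Complex.exp_add, Complex.exp_pi_mul_I]; ring
  have hexm : ∀ x : ℝ, Complex.exp (x + (-Real.pi : ℝ) * Complex.I) = -Complex.exp x := by
    intro x
    rw [Complex.exp_add]; push_cast
    rw [neg_mul, Complex.exp_neg, Complex.exp_pi_mul_I]; norm_num
  have hne : ∀ x y : ℝ, |y| = Real.pi → (x : ℂ) + y * Complex.I ≠ w₀ := by
    rintro x y hy rfl
    simp [hy] at hw₀
  have hrect : ∀ L : ℝ, (∫ x in -L..L, (Complex.exp x / (Complex.exp x + Complex.exp w₀)) •
        (F (x + (-Real.pi : ℝ) * Complex.I) - F (x + Real.pi * Complex.I)))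
      = (2 * Real.pi * Complex.I) • F w₀
        - Complex.I • (∫ y in -Real.pi..Real.pi, (stripKernel F w₀ (L + y * Complex.I) + F w₀))
        + Complex.I • ∫ y in -Real.pi..Real.pi, stripKernel F w₀ ((-L : ℝ) + y * Complex.I) := by
    intro L
    have hcau := Complex.integral_boundary_rect_eq_zero_of_continuousOn_of_differentiableOn
      (stripKernel F w₀) ((-L : ℝ) + (-Real.pi : ℝ) * Complex.I) (L + Real.pi * Complex.I)
      (hK.mono ?_) (hKd.mono ?_)
    rotate_left
    · intro w hw
      have h2 : w.im ∈ uIcc (-Real.pi) Real.pi := by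
        have := hw.2; simpa using this
      rw [uIcc_of_le (by linarith)] at h2
      exact abs_le.mpr h2
    · intro w hw
      have h2 : w.im ∈ Ioo (min (-Real.pi) Real.pi) (max (-Real.pi) Real.pi) := by
        have := hw.2; simpa using this
      rw [min_eq_left (by linarith), max_eq_right (by linarith)] at h2
      exact abs_lt.mpr h2
    have e1 : ((-L : ℝ) + (-Real.pi : ℝ) * Complex.I : ℂ).re = -L := by simp
    have e2 : ((-L : ℝ) + (-Real.pi : ℝ) * Complex.I : ℂ).im = -Real.pi := by simp
    have e3 : ((L : ℝ) + Real.pi * Complex.I : ℂ).re = L := by simp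
    have e4 : ((L : ℝ) + Real.pi * Complex.I : ℂ).im = Real.pi := by simp
    rw [e1, e2, e3, e4, ← intervalIntegral.integral_sub
      ((hline _ hpm).intervalIntegrable _ _) ((hline _ hpp).intervalIntegrable _ _)] at hcau
    have hint : (∫ x in -L..L, (stripKernel F w₀ (x + (-Real.pi : ℝ) * Complex.I)
          - stripKernel F w₀ (x + Real.pi * Complex.I)))
        = ∫ x in -L..L, (Complex.exp x / (Complex.exp x + Complex.exp w₀)) •
          (F (x + (-Real.pi : ℝ) * Complex.I) - F (x + Real.pi * Complex.I)) := by
      refine intervalIntegral.integral_congr fun x _ => ?_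
      rw [stripKernel_of_ne F (hne x _ (by rw [abs_neg, abs_of_pos hpi])),
        stripKernel_of_ne F (hne x _ (abs_of_pos hpi)), hexp, hexm, ← smul_sub]
      congr 1
      · rw [← neg_div_neg_eq]; congr 1 <;> ring
      · abel
    rw [hint] at hcau
    rw [intervalIntegral.integral_add ((hcol L _ _ hpm hpp).intervalIntegrable)
      intervalIntegrable_const, intervalIntegral.integral_const, smul_add]
    have hconst : Complex.I • ((Real.pi - -Real.pi) • F w₀) = (2 * Real.pi * Complex.I) • F w₀ := by
      rw [← Complex.coe_smul, smul_smul]; congr 1; push_cast; ring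
    rw [hconst, ← sub_eq_zero]
    rw [← hcau]; abel
  have hbound : ∀ᶠ L : ℝ in atTop,
      ‖(∫ x in -L..L, (Complex.exp x / (Complex.exp x + Complex.exp w₀)) •
        (F (x + (-Real.pi : ℝ) * Complex.I) - F (x + Real.pi * Complex.I)))
        - (2 * Real.pi * Complex.I) • F w₀‖ ≤
      (2 * (M * Real.exp (-α * L)) + 2 * ‖Complex.exp w₀‖ * Real.exp (-L) * ‖F w₀‖) * (2 * Real.pi)
      + (2 / ‖Complex.exp w₀‖ * (M * Real.exp ((1 - α) * -L) + Real.exp (-L) * ‖F w₀‖)) *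
          (2 * Real.pi) := by
    have h0 : 0 < ‖Complex.exp w₀‖ := norm_pos_iff.mpr (Complex.exp_ne_zero _)
    have ev1 : ∀ᶠ L : ℝ in atTop, 2 * ‖Complex.exp w₀‖ ≤ Real.exp L :=
      Real.tendsto_exp_atTop.eventually_ge_atTop _
    have ev2 : ∀ᶠ L : ℝ in atTop, Real.exp (-L) ≤ ‖Complex.exp w₀‖ / 2 :=
      (Real.tendsto_exp_neg_atTop_nhds_zero.eventually_lt_const (by positivity)).mono
        fun _ h => h.le
    filter_upwards [ev1, ev2] with L h1 h2
    rw [hrect L]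
    have hlen : |Real.pi - -Real.pi| = 2 * Real.pi := by
      rw [abs_of_pos (by linarith)]; ring
    have hmem : ∀ y ∈ uIoc (-Real.pi) Real.pi, |y| ≤ Real.pi := by
      intro y hy
      rw [uIoc_of_le (by linarith)] at hy
      exact abs_le.mpr ⟨hy.1.le, hy.2⟩
    have i1 := intervalIntegral.norm_integral_le_of_norm_le_const (a := -Real.pi) (b := Real.pi)
      (f := fun y : ℝ => stripKernel F w₀ (L + y * Complex.I) + F w₀)
      (C := 2 * (M * Real.exp (-α * L)) + 2 * ‖Complex.exp w₀‖ * Real.exp (-L) * ‖F w₀‖) (by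
        intro y hy
        have := norm_stripKernel_add_le hb (hside L y (hmem y hy)) (w₀ := w₀) (by simpa using h1)
        simpa using this)
    have i2 := intervalIntegral.norm_integral_le_of_norm_le_const (a := -Real.pi) (b := Real.pi)
      (f := fun y : ℝ => stripKernel F w₀ ((-L : ℝ) + y * Complex.I))
      (C := 2 / ‖Complex.exp w₀‖ * (M * Real.exp ((1 - α) * -L) + Real.exp (-L) * ‖F w₀‖)) (by
        intro y hy
        have := norm_stripKernel_le hb (hside (-L) y (hmem y hy)) (w₀ := w₀)
          (by simp; linarith)
        simpa using this)
    rw [hlen] at i1 i2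
    have : ∀ a b c : E, a - b + c - a = c - b := fun a b c => by abel
    rw [this]
    refine (norm_sub_le _ _).trans ?_
    rw [norm_smul, norm_smul, Complex.norm_I, one_mul, one_mul, add_comm]
    exact add_le_add i1 i2
  rw [tendsto_iff_norm_sub_tendsto_zero]
  refine squeeze_zero' (Eventually.of_forall fun _ => norm_nonneg _) hbound ?_
  have t0 : Tendsto (fun L : ℝ => Real.exp (-L)) atTop (𝓝 0) :=
    Real.tendsto_exp_neg_atTop_nhds_zero
  have t1 : Tendsto (fun L : ℝ => Real.exp (-α * L)) atTop (𝓝 0) := by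
    have := t0.comp (tendsto_id.const_mul_atTop hα0)
    refine this.congr fun L => ?_
    simp
  have t2 : Tendsto (fun L : ℝ => Real.exp ((1 - α) * -L)) atTop (𝓝 0) := by
    have := t0.comp (tendsto_id.const_mul_atTop (sub_pos.mpr hα1))
    refine this.congr fun L => ?_
    simp
  have := ((((t1.const_mul M).const_mul 2).add ((t0.const_mul (2 * ‖Complex.exp w₀‖)).mul_const
    ‖F w₀‖)).mul_const (2 * Real.pi)).add ((((t2.const_mul M).add (t0.mul_const ‖F w₀‖)).const_mul
    (2 / ‖Complex.exp w₀‖)).mul_const (2 * Real.pi))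
  simpa using this

end Strip

end GCQ

namespace GCQ

/-! ### The Stieltjes representation of the transfer operator -/

section Stieltjes

variable {X : Type u} {Y : Type v} [NormedAddCommGroup X] [NormedSpace ℂ X]
  [NormedAddCommGroup Y] [NormedSpace ℂ Y]
  {K Kp Km : ℂ → X →L[ℂ] Y} {M α : ℝ}

theorem exp_mem_slitPlane_of_strip {w : ℂ} (hw : |w.im| < Real.pi) :
    Complex.exp w ∈ Complex.slitPlane := by
  rw [Complex.mem_slitPlane_iff_arg]
  refine ⟨?_, Complex.exp_ne_zero w⟩
  have h := abs_lt.mp hw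
  rw [← Complex.log_im, Complex.log_exp h.1 h.2.le]
  exact h.2.ne

theorem exp_im_nonneg {w : ℂ} (h0 : 0 ≤ w.im) (h1 : w.im ≤ Real.pi) : 0 ≤ (Complex.exp w).im := by
  rw [Complex.exp_im]
  exact mul_nonneg (Real.exp_pos _).le (Real.sin_nonneg_of_nonneg_of_le_pi h0 h1)

theorem exp_im_nonpos {w : ℂ} (h0 : w.im ≤ 0) (h1 : -Real.pi ≤ w.im) :
    (Complex.exp w).im ≤ 0 := by
  rw [Complex.exp_im]
  exact mul_nonpos_of_nonneg_of_nonpos (Real.exp_pos _).le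
    (Real.sin_nonpos_of_nonpos_of_neg_pi_le h0 h1)

open Classical in
/-- The transfer operator in exponential coordinates, extended to both edges of the cut. -/
noncomputable def stripTransfer (Kp Km : ℂ → X →L[ℂ] Y) (w : ℂ) : X →L[ℂ] Y :=
  if 0 ≤ w.im then Kp (Complex.exp w) else Km (Complex.exp w)

theorem IsSectorial.stripTransfer_eq (h : IsSectorial K M α)
    (hpc : ContinuousOn Kp {z | 0 ≤ z.im ∧ z ≠ 0}) (hpe : EqOn Kp K {z | 0 < z.im})
    (hmc : ContinuousOn Km {z | z.im ≤ 0 ∧ z ≠ 0}) (hme : EqOn Km K {z | z.im < 0})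
    {w : ℂ} (hw : |w.im| < Real.pi) : stripTransfer Kp Km w = K (Complex.exp w) := by
  have hs := exp_mem_slitPlane_of_strip hw
  have ha := abs_lt.mp hw
  unfold stripTransfer
  split_ifs with h0
  · exact h.upper_eq hpc hpe (exp_im_nonneg h0 ha.2.le) hs
  · exact h.lower_eq hmc hme (exp_im_nonpos (not_le.mp h0).le ha.1.le) hs

theorem IsSectorial.stripTransfer_of_nonpos (h : IsSectorial K M α)
    (hpc : ContinuousOn Kp {z | 0 ≤ z.im ∧ z ≠ 0}) (hpe : EqOn Kp K {z | 0 < z.im})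
    (hmc : ContinuousOn Km {z | z.im ≤ 0 ∧ z ≠ 0}) (hme : EqOn Km K {z | z.im < 0})
    {w : ℂ} (hw : w.im ≤ 0) : stripTransfer Kp Km w = Km (Complex.exp w) := by
  rcases hw.lt_or_eq with h0 | h0
  · exact if_neg (not_le.mpr h0)
  · have hs : |w.im| < Real.pi := by rw [h0, abs_zero]; exact Real.pi_pos
    rw [h.stripTransfer_eq hpc hpe hmc hme hs, h.lower_eq hmc hme
      (exp_im_nonpos hw (by rw [h0]; linarith [Real.pi_pos])) (exp_mem_slitPlane_of_strip hs)]

/-- The two closed halves of the strip meet on the real line, where both edge extensions coincide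
with `K`. -/
theorem IsSectorial.continuousOn_stripTransfer (h : IsSectorial K M α)
    (hpc : ContinuousOn Kp {z | 0 ≤ z.im ∧ z ≠ 0}) (hpe : EqOn Kp K {z | 0 < z.im})
    (hmc : ContinuousOn Km {z | z.im ≤ 0 ∧ z ≠ 0}) (hme : EqOn Km K {z | z.im < 0}) :
    ContinuousOn (stripTransfer Kp Km) {w | |w.im| ≤ Real.pi} := by
  have h1 : ContinuousOn (stripTransfer Kp Km) {w | 0 ≤ w.im ∧ w.im ≤ Real.pi} :=
    (hpc.comp Complex.continuous_exp.continuousOn fun w (hw : 0 ≤ w.im ∧ w.im ≤ Real.pi) =>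
      ⟨exp_im_nonneg hw.1 hw.2, Complex.exp_ne_zero w⟩).congr fun w hw => if_pos hw.1
  have h2 : ContinuousOn (stripTransfer Kp Km) {w | w.im ≤ 0 ∧ -Real.pi ≤ w.im} :=
    (hmc.comp Complex.continuous_exp.continuousOn fun w (hw : w.im ≤ 0 ∧ -Real.pi ≤ w.im) =>
      ⟨exp_im_nonpos hw.1 hw.2, Complex.exp_ne_zero w⟩).congr fun w hw =>
        h.stripTransfer_of_nonpos hpc hpe hmc hme hw.1
  refine (h1.union_of_isClosed h2
    ((isClosed_le continuous_const Complex.continuous_im).inter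
      (isClosed_le Complex.continuous_im continuous_const))
    ((isClosed_le Complex.continuous_im continuous_const).inter
      (isClosed_le continuous_const Complex.continuous_im))).mono fun w (hw : |w.im| ≤ _) => ?_
  have ha := abs_le.mp hw
  rcases le_total 0 w.im with h0 | h0
  · exact Or.inl ⟨h0, ha.2⟩
  · exact Or.inr ⟨h0, ha.1⟩

theorem IsSectorial.norm_stripTransfer_le (h : IsSectorial K M α)
    (hpc : ContinuousOn Kp {z | 0 ≤ z.im ∧ z ≠ 0}) (hpe : EqOn Kp K {z | 0 < z.im})
    (hmc : ContinuousOn Km {z | z.im ≤ 0 ∧ z ≠ 0}) (hme : EqOn Km K {z | z.im < 0})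
    {w : ℂ} (hw : |w.im| ≤ Real.pi) :
    ‖stripTransfer Kp Km w‖ ≤ M * Real.exp (-α * w.re) := by
  have ha := abs_le.mp hw
  have he : ‖Complex.exp w‖ ^ (-α) = Real.exp (-α * w.re) := by
    rw [Complex.norm_exp, ← Real.exp_mul, mul_comm]
  rw [← he]
  unfold stripTransfer
  split_ifs with h0
  · exact h.norm_upper_le hpc hpe (exp_im_nonneg h0 ha.2) (Complex.exp_ne_zero w)
  · exact h.norm_lower_le hmc hme (exp_im_nonpos (not_le.mp h0).le ha.1) (Complex.exp_ne_zero w)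

theorem add_re_le_norm_add {x : ℝ} {z : ℂ} (hx : 0 ≤ x) (hz : 0 < z.re) :
    x + z.re ≤ ‖(x : ℂ) + z‖ := by
  have := Complex.abs_re_le_norm ((x : ℂ) + z)
  rw [Complex.add_re, Complex.ofReal_re, abs_of_pos (by linarith)] at this
  exact this

theorem IsSectorial.norm_density_div_le (h : IsSectorial K M α) {x r : ℝ} (hx : 0 < x)
    (hr : 0 < r) : ‖density K x‖ / (x + r) ≤ M * r⁻¹ * (x ^ (-α) * (1 / (1 + r⁻¹ * x))) := by
  have h1 := h.norm_density_le hx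
  have h2 : M * r⁻¹ * (x ^ (-α) * (1 / (1 + r⁻¹ * x))) = M * x ^ (-α) / (x + r) := by
    field_simp; ring
  rw [h2]; gcongr

theorem IsSectorial.integrableOn_norm_density_div (h : IsSectorial K M α) (hα0 : 0 < α)
    (hα1 : α < 1) {r : ℝ} (hr : 0 < r) :
    IntegrableOn (fun x : ℝ => ‖density K x‖ / (x + r)) (Ioi 0) := by
  refine Integrable.mono'
    ((integrableOn_rpow_div_one_add_mul hα0 hα1 (inv_pos.mpr hr)).const_mul (M * r⁻¹)) ?_ ?_
  · refine ContinuousOn.aestronglyMeasurable ?_ measurableSet_Ioi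
    exact h.continuousOn_density.norm.div (continuousOn_id.add continuousOn_const)
      fun x hx => (add_pos (mem_Ioi.mp hx) hr).ne'
  · filter_upwards [ae_restrict_mem measurableSet_Ioi] with x (hx : 0 < x)
    rw [Real.norm_of_nonneg (by positivity)]
    exact h.norm_density_div_le hx hr

theorem IsSectorial.integrableOn_density_div (h : IsSectorial K M α) (hα0 : 0 < α)
    (hα1 : α < 1) {z : ℂ} (hz : 0 < z.re) :
    IntegrableOn (fun x : ℝ => ((x : ℂ) + z)⁻¹ • density K x) (Ioi 0) := by
  refine Integrable.mono' (h.integrableOn_norm_density_div hα0 hα1 hz) ?_ ?_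
  · refine ContinuousOn.aestronglyMeasurable ?_ measurableSet_Ioi
    have hc : ContinuousOn (fun x : ℝ => (x : ℂ) + z) (Ioi 0) := by fun_prop
    exact (hc.inv₀ fun x hx => norm_pos_iff.mp ((add_pos (mem_Ioi.mp hx) hz).trans_le
        (add_re_le_norm_add (mem_Ioi.mp hx).le hz))).smul h.continuousOn_density
  · filter_upwards [ae_restrict_mem measurableSet_Ioi] with x (hx : 0 < x)
    rw [norm_smul, norm_inv, div_eq_inv_mul]
    have h1 := add_re_le_norm_add hx.le hz
    gcongr

/-- `K z = ∫₀^∞ G(x) / (x + z) dx` in the right half-plane. -/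
theorem IsSectorial.eq_stieltjes [CompleteSpace Y] (h : IsSectorial K M α) (hα0 : 0 < α)
    (hα1 : α < 1) {z : ℂ} (hz : 0 < z.re) :
    K z = ∫ x in Ioi (0 : ℝ), ((x : ℂ) + z)⁻¹ • density K x := by
  obtain ⟨Kp, hpc, hpe⟩ := h.upper
  obtain ⟨Km, hmc, hme⟩ := h.lower
  have hpi := Real.pi_pos
  have hz0 : z ≠ 0 := by rintro rfl; simp at hz
  have hw₀ : |(Complex.log z).im| < Real.pi := by
    rw [Complex.log_im]
    exact (Complex.abs_arg_lt_pi_div_two_iff.mpr (Or.inl hz)).trans (by linarith)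
  have hd : DifferentiableOn ℂ (stripTransfer Kp Km) {w | |w.im| < Real.pi} :=
    (h.holomorphic.comp Complex.differentiable_exp.differentiableOn fun w hw =>
      exp_mem_slitPlane_of_strip hw).congr fun w hw => h.stripTransfer_eq hpc hpe hmc hme hw
  have hlim := tendsto_strip_integral hα0 hα1
    (h.continuousOn_stripTransfer hpc hpe hmc hme) hd
    (fun w hw => h.norm_stripTransfer_le hpc hpe hmc hme hw) hw₀
  rw [h.stripTransfer_eq hpc hpe hmc hme hw₀, Complex.exp_log hz0] at hlim
  have hint : ∀ x : ℝ, (Complex.exp x / (Complex.exp x + z)) •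
        (stripTransfer Kp Km (x + (-Real.pi : ℝ) * Complex.I)
          - stripTransfer Kp Km (x + Real.pi * Complex.I))
      = (2 * Real.pi * Complex.I) •
        (Real.exp x • (((Real.exp x : ℝ) : ℂ) + z)⁻¹ • density K (Real.exp x)) := by
    intro x
    have e1 : stripTransfer Kp Km (x + (-Real.pi : ℝ) * Complex.I) = Km (-(Real.exp x : ℂ)) := by
      rw [h.stripTransfer_of_nonpos hpc hpe hmc hme (by simp [hpi.le]), Complex.exp_add]
      push_cast
      rw [neg_mul, Complex.exp_neg, Complex.exp_pi_mul_I]; norm_num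
    have e2 : stripTransfer Kp Km (x + Real.pi * Complex.I) = Kp (-(Real.exp x : ℂ)) := by
      rw [stripTransfer, if_pos (by simp [hpi.le]), Complex.exp_add, Complex.exp_pi_mul_I]
      simp
    have h2 : (2 * (Real.pi : ℂ) * Complex.I) ≠ 0 := by simp [hpi.ne']
    rw [e1, e2, density, upperEdge_eq hpc hpe (Real.exp_pos x),
      lowerEdge_eq hmc hme (Real.exp_pos x), ← Complex.coe_smul, smul_smul, smul_smul, smul_smul]
    congr 1
    push_cast
    field_simp
  simp_rw [hint] at hlim
  have hder : ∀ x ∈ (univ : Set ℝ), HasDerivWithinAt Real.exp (Real.exp x) univ x :=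
    fun x _ => (Real.hasDerivAt_exp x).hasDerivWithinAt
  have himg : Real.exp '' univ = Ioi 0 := by rw [image_univ, Real.range_exp]
  -- Cauchy's formula yields only a symmetric limit; absolute integrability, transported by `x =
  -- e^s`, identifies it with the integral over `(0, ∞)`.
  have hI : Integrable fun x : ℝ =>
      Real.exp x • (((Real.exp x : ℝ) : ℂ) + z)⁻¹ • density K (Real.exp x) := by
    have := h.integrableOn_density_div hα0 hα1 hz
    rw [← himg, integrableOn_image_iff_integrableOn_abs_deriv_smul MeasurableSet.univ hder
      Real.exp_injective.injOn, integrableOn_univ] at this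
    simpa using this
  have hlim2 := intervalIntegral_tendsto_integral (hI.smul (2 * Real.pi * Complex.I))
    tendsto_neg_atTop_atBot tendsto_id
  have huniq := tendsto_nhds_unique hlim hlim2
  rw [← himg, integral_image_eq_integral_abs_deriv_smul MeasurableSet.univ hder
      Real.exp_injective.injOn]
  simp only [Pi.smul_apply, Real.abs_exp, Measure.restrict_univ] at huniq ⊢
  rw [integral_smul] at huniq
  exact smul_right_injective _ (by simp [hpi.ne'] : (2 * (Real.pi : ℂ) * Complex.I) ≠ 0) huniq

end Stieltjes

end GCQ

namespace GCQ

/-! ### Uniqueness of the Laplace transform -/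

section Laplace

open scoped FourierTransform ContDiff

variable {E : Type*} [NormedAddCommGroup E] [NormedSpace ℂ E] [CompleteSpace E]

/-- A test function is the Fourier transform of a Schwartz function, and by self-adjointness the
transform passes to `ψ`. Inversion is thus used only for scalar Schwartz functions. -/
theorem ae_eq_zero_of_fourier_eq_zero {ψ : ℝ → E} (hψ : Integrable ψ) (h : ∀ ξ, 𝓕 ψ ξ = 0) :
    ∀ᵐ t, ψ t = 0 := by
  refine ae_eq_zero_of_integral_contDiff_smul_eq_zero hψ.locallyIntegrable fun g hg hgs => ?_
  have hgc : ContDiff ℝ ∞ (fun x => (g x : ℂ)) := Complex.ofRealCLM.contDiff.comp hg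
  have hgs' : HasCompactSupport (fun x => (g x : ℂ)) := hgs.comp_left Complex.ofReal_zero
  set G := hgs'.toSchwartzMap hgc with hG
  have h1 := VectorFourier.integral_fourierIntegral_smul_eq_flip (L := innerₗ ℝ)
    (f := (FourierTransformInv.fourierInv G : SchwartzMap ℝ ℂ)) Real.continuous_fourierChar
    continuous_inner (SchwartzMap.integrable (μ := volume) _) hψ
  have h2 : ∀ x : ℝ, VectorFourier.fourierIntegral Real.fourierChar volume (innerₗ ℝ)
      (FourierTransformInv.fourierInv G : SchwartzMap ℝ ℂ) x = (g x : ℂ) := by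
    intro x
    have := congrArg (fun S : SchwartzMap ℝ ℂ => S x) 
      (FourierTransform.fourier_fourierInv_eq (F := SchwartzMap ℝ ℂ) G)
    simp only [SchwartzMap.fourier_coe] at this
    exact this
  have h3 : ∀ x : ℝ, VectorFourier.fourierIntegral Real.fourierChar volume (innerₗ ℝ).flip ψ x
      = 0 := by
    intro x
    rw [flip_innerₗ]
    exact h x
  simp_rw [h2, h3, smul_zero, integral_zero, Complex.coe_smul] at h1
  exact h1

/-- A function on `(0,∞)` whose Laplace transform vanishes is zero almost everywhere. -/
theorem ae_eq_zero_of_laplace_eq_zero {D : ℝ → E}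
    (hi : ∀ z : ℂ, 0 < z.re → IntegrableOn (fun t : ℝ => Complex.exp (-z * t) • D t) (Ioi 0))
    (h0 : ∀ z : ℂ, 0 < z.re → ∫ t in Ioi (0 : ℝ), Complex.exp (-z * t) • D t = 0) :
    ∀ᵐ t ∂volume.restrict (Ioi (0 : ℝ)), D t = 0 := by
  have hint : Integrable ((Ioi (0 : ℝ)).indicator fun t : ℝ => Complex.exp (-1 * t) • D t) :=
    (integrable_indicator_iff measurableSet_Ioi).mpr (hi 1 (by simp))
  have hz := ae_eq_zero_of_fourier_eq_zero hint fun ξ => by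
    rw [Real.fourier_real_eq_integral_exp_smul]
    -- On the line `Re z = 1` the Laplace transform of `D` is the Fourier transform of `e^{-t}
    -- D(t)`.
    have := h0 (1 + 2 * Real.pi * ξ * Complex.I) (by simp)
    rw [← integral_indicator measurableSet_Ioi] at this
    rw [← this]
    congr 1
    ext t
    by_cases ht : t ∈ Ioi (0 : ℝ)
    · rw [indicator_of_mem ht, indicator_of_mem ht, smul_smul, ← Complex.exp_add]
      congr 2
      push_cast
      ring
    · rw [indicator_of_notMem ht, indicator_of_notMem ht, smul_zero]
  rw [ae_restrict_iff' measurableSet_Ioi]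
  filter_upwards [hz] with t ht hmem
  rw [indicator_of_mem hmem] at ht
  exact (smul_eq_zero.mp ht).resolve_left (Complex.exp_ne_zero _)

end Laplace

/-! ### The convolution kernel as a superposition of exponentials -/

section Kernel

variable {X : Type u} {Y : Type v} [NormedAddCommGroup X] [NormedSpace ℂ X]
  [NormedAddCommGroup Y] [NormedSpace ℂ Y]
  {k : ℝ → X →L[ℂ] Y} {K : ℂ → X →L[ℂ] Y} {M α : ℝ}

/-- `∫₀^∞ e^{-xt} G(x) dx`. -/
noncomputable def realKernel (K : ℂ → X →L[ℂ] Y) (t : ℝ) : X →L[ℂ] Y :=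
  ∫ x in Ioi (0 : ℝ), Real.exp (-(x * t)) • density K x

theorem integrableOn_exp_neg_mul_Ioi {z : ℂ} {x : ℝ} (hx : 0 < x) (hz : 0 < z.re) :
    IntegrableOn (fun t : ℝ => Complex.exp (-z * t) * Real.exp (-(x * t))) (Ioi 0) := by
  have := integrableOn_exp_mul_complex_Ioi (a := -(x + z)) (by simp; linarith) 0
  refine IntegrableOn.congr_fun this (fun t _ => ?_) measurableSet_Ioi
  push_cast
  rw [← Complex.exp_add]; ring_nf

theorem integral_exp_neg_mul_Ioi {z : ℂ} {x : ℝ} (hx : 0 < x) (hz : 0 < z.re) :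
    ∫ t in Ioi (0 : ℝ), Complex.exp (-z * t) * Real.exp (-(x * t)) = ((x : ℂ) + z)⁻¹ := by
  have := integral_exp_mul_complex_Ioi (a := -(x + z)) (by simp; linarith) 0
  have h2 : ∀ t : ℝ, Complex.exp (-z * t) * Real.exp (-(x * t)) = Complex.exp (-(x + z) * t) := by
    intro t
    push_cast
    rw [← Complex.exp_add]; ring_nf
  simp_rw [h2, this]
  rw [Complex.ofReal_zero, mul_zero, Complex.exp_zero, neg_div_neg_eq, one_div]

/-- Integrating the norm first in `t` leaves `‖G(x)‖ / (x + Re z)`, which is integrable in `x` since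
`0 < α < 1`. -/
theorem IsSectorial.integrable_prod_exp_density (h : IsSectorial K M α) (hα0 : 0 < α)
    (hα1 : α < 1) {z : ℂ} (hz : 0 < z.re) :
    Integrable (fun w : ℝ × ℝ =>
        (Complex.exp (-z * w.2) * Real.exp (-(w.1 * w.2))) • density K w.1)
      ((volume.restrict (Ioi 0)).prod (volume.restrict (Ioi 0))) := by
  have hmeas : AEStronglyMeasurable (fun w : ℝ × ℝ =>
        (Complex.exp (-z * w.2) * Real.exp (-(w.1 * w.2))) • density K w.1)
      ((volume.restrict (Ioi 0)).prod (volume.restrict (Ioi 0))) := by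
    rw [Measure.prod_restrict]
    refine ContinuousOn.aestronglyMeasurable ?_ (measurableSet_Ioi.prod measurableSet_Ioi)
    have hc : ContinuousOn (fun w : ℝ × ℝ => density K w.1) (Ioi 0 ×ˢ Ioi 0) :=
      h.continuousOn_density.comp continuousOn_fst fun w hw => hw.1
    fun_prop
  refine (integrable_prod_iff hmeas).mpr ⟨?_, ?_⟩
  · filter_upwards [ae_restrict_mem measurableSet_Ioi] with x hx
    exact (integrableOn_exp_neg_mul_Ioi hx hz).smul_const _
  · refine IntegrableOn.congr_fun (h.integrableOn_norm_density_div hα0 hα1 hz) (fun x hx => ?_)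
      measurableSet_Ioi
    have hx' : 0 < x := hx
    simp only [norm_smul]
    rw [integral_mul_const]
    have : ∀ t : ℝ, ‖Complex.exp (-z * t) * Real.exp (-(x * t))‖
        = Real.exp (-(x + z.re) * t) := by
      intro t
      rw [norm_mul, Complex.norm_exp, Complex.norm_real, Real.norm_of_nonneg (Real.exp_pos _).le,
        ← Real.exp_add]
      congr 1; simp; ring
    simp_rw [this]
    rw [integral_exp_mul_Ioi (by linarith), mul_zero, Real.exp_zero, neg_div_neg_eq, one_div,
      div_eq_inv_mul]

theorem IsSectorial.laplace_realKernel [CompleteSpace Y] (h : IsSectorial K M α) (hα0 : 0 < α)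
    (hα1 : α < 1) {z : ℂ} (hz : 0 < z.re) :
    IntegrableOn (fun t : ℝ => Complex.exp (-z * t) • realKernel K t) (Ioi 0) ∧
      ∫ t in Ioi (0 : ℝ), Complex.exp (-z * t) • realKernel K t = K z := by
  have hp := h.integrable_prod_exp_density hα0 hα1 hz
  have heq : ∀ t : ℝ, ∫ x in Ioi (0 : ℝ),
      (Complex.exp (-z * t) * Real.exp (-(x * t))) • density K x
        = Complex.exp (-z * t) • realKernel K t := by
    intro t
    simp_rw [mul_smul]
    rw [integral_smul]
    simp_rw [Complex.coe_smul]
    rfl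
  refine ⟨?_, ?_⟩
  · have := hp.integral_prod_right
    simp_rw [heq] at this
    exact this
  · have := integral_integral_swap (f := fun x t : ℝ =>
      (Complex.exp (-z * t) * Real.exp (-(x * t))) • density K x) hp
    simp_rw [heq] at this
    rw [← this, h.eq_stieltjes hα0 hα1 hz]
    refine setIntegral_congr_fun measurableSet_Ioi fun x hx => ?_
    rw [integral_smul_const, integral_exp_neg_mul_Ioi hx hz]

/-- Both kernels have the Laplace transform `K`. Equality almost everywhere is enough, since `k`
occurs only under the convolution integral. -/
theorem IsLaplaceTransform.ae_eq_realKernel [CompleteSpace Y] (hk : IsLaplaceTransform k K)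
    (h : IsSectorial K M α) (hα0 : 0 < α) (hα1 : α < 1) :
    ∀ᵐ t ∂volume.restrict (Ioi (0 : ℝ)), k t = realKernel K t := by
  have := ae_eq_zero_of_laplace_eq_zero (D := fun t => k t - realKernel K t)
    (fun z hz => by
      simp_rw [smul_sub]
      exact (hk z hz).1.sub (h.laplace_realKernel hα0 hα1 hz).1)
    (fun z hz => by
      simp_rw [smul_sub]
      rw [integral_sub (hk z hz).1 (h.laplace_realKernel hα0 hα1 hz).1,
        (h.laplace_realKernel hα0 hα1 hz).2, ← (hk z hz).2, sub_self])
  filter_upwards [this] with t ht using sub_eq_zero.mp ht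

end Kernel

end GCQ

namespace GCQ

/-! ### The convolution as a superposition of scalar initial value problems -/

theorem intervalIntegrable_of_norm_le_rpow {E : Type*} [NormedAddCommGroup E] {b C t : ℝ}
    {f : ℝ → E} (hb : -1 < b) (ht : 0 < t)
    (hf : ContinuousOn f (Ioc 0 t)) (hC : ∀ s ∈ Ioc 0 t, ‖f s‖ ≤ C * s ^ b) :
    IntervalIntegrable f volume 0 t := by
  rw [intervalIntegrable_iff_integrableOn_Ioc_of_le ht.le]
  have h1 := (intervalIntegral.intervalIntegrable_rpow' (a := 0) (b := t) hb).const_mul C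
  rw [intervalIntegrable_iff_integrableOn_Ioc_of_le ht.le] at h1
  refine Integrable.mono' h1 (hf.aestronglyMeasurable measurableSet_Ioc) ?_
  filter_upwards [ae_restrict_mem measurableSet_Ioc] with s hs using hC s hs

section Fubini

variable {X : Type u} {Y : Type v} [NormedAddCommGroup X] [NormedSpace ℂ X]
  [NormedAddCommGroup Y] [NormedSpace ℂ Y]
  {k : ℝ → X →L[ℂ] Y} {K : ℂ → X →L[ℂ] Y} {M α b C t : ℝ} {f : ℝ → X}

theorem IsSectorial.integrableOn_exp_smul_density (h : IsSectorial K M α) (hα0 : 0 < α)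
    (hα1 : α < 1) (ht : 0 < t) :
    IntegrableOn (fun x : ℝ => Real.exp (-(x * t)) • density K x) (Ioi 0) := by
  refine Integrable.mono' ((integrableOn_rpow_div_one_add_mul hα0 hα1 ht).const_mul M) ?_ ?_
  · refine ContinuousOn.aestronglyMeasurable ?_ measurableSet_Ioi
    have hc : ContinuousOn (fun x : ℝ => Real.exp (-(x * t))) (Ioi 0) := by fun_prop
    exact hc.smul h.continuousOn_density
  · filter_upwards [ae_restrict_mem measurableSet_Ioi] with x (hx : 0 < x)
    rw [norm_smul, Real.norm_of_nonneg (Real.exp_pos _).le, Real.exp_neg]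
    have h1 := Real.add_one_le_exp (x * t)
    have h2 := h.norm_density_le hx
    have h3 : (Real.exp (x * t))⁻¹ ≤ (1 + t * x)⁻¹ := by
      apply inv_anti₀ (by positivity); linarith
    calc (Real.exp (x * t))⁻¹ * ‖density K x‖ ≤ (1 + t * x)⁻¹ * (M * x ^ (-α)) := by gcongr
      _ = _ := by ring

/-- The inner integral of the norms is at most `M C x^{-α}` times the solution for data `s^b`, which
is of size `t^{b+1} / (1 + x t)`, and this is integrable in `x`. -/
theorem IsSectorial.integrable_prod_expConv (h : IsSectorial K M α) (hα0 : 0 < α) (hα1 : α < 1)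
    (hb : -1 < b) (ht : 0 < t) (hf : ContinuousOn f (Ioc 0 t))
    (hC : ∀ s ∈ Ioc 0 t, ‖f s‖ ≤ C * s ^ b) :
    Integrable (fun w : ℝ × ℝ => Real.exp (-(w.1 * (t - w.2))) • density K w.1 (f w.2))
      ((volume.restrict (Ioi 0)).prod (volume.restrict (Ioc 0 t))) := by
  have hC0 : 0 ≤ C := nonneg_of_mul_nonneg_left ((norm_nonneg _).trans (hC t ⟨ht, le_rfl⟩))
    (Real.rpow_pos_of_pos ht b)
  have hM0 : 0 ≤ M := by
    have := (norm_nonneg _).trans (h.norm_density_le one_pos)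
    simpa using this
  have hmeas : AEStronglyMeasurable
      (fun w : ℝ × ℝ => Real.exp (-(w.1 * (t - w.2))) • density K w.1 (f w.2))
      ((volume.restrict (Ioi 0)).prod (volume.restrict (Ioc 0 t))) := by
    rw [Measure.prod_restrict]
    refine ContinuousOn.aestronglyMeasurable ?_ (measurableSet_Ioi.prod measurableSet_Ioc)
    have hc1 : ContinuousOn (fun w : ℝ × ℝ => density K w.1) (Ioi 0 ×ˢ Ioc 0 t) :=
      h.continuousOn_density.comp continuousOn_fst fun w hw => hw.1
    have hc2 : ContinuousOn (fun w : ℝ × ℝ => f w.2) (Ioi 0 ×ˢ Ioc 0 t) :=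
      hf.comp continuousOn_snd fun w hw => hw.2
    have hc3 : ContinuousOn (fun w : ℝ × ℝ => Real.exp (-(w.1 * (t - w.2))))
      (Ioi 0 ×ˢ Ioc 0 t) := by fun_prop
    exact hc3.smul (hc1.clm_apply hc2)
  obtain ⟨B, hB, hbd⟩ := exists_powSol_bound hb 0
  have hfi := intervalIntegrable_of_norm_le_rpow hb ht hf hC
  have hei : ∀ x : ℝ, IntegrableOn (fun s => Real.exp (-(x * (t - s))) • f s) (Ioc 0 t) := by
    intro x
    rw [← intervalIntegrable_iff_integrableOn_Ioc_of_le ht.le]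
    exact hfi.continuousOn_smul (by fun_prop)
  refine (integrable_prod_iff hmeas).mpr ⟨?_, ?_⟩
  · refine ae_of_all _ fun x => ?_
    have := (density K x).integrable_comp (hei x)
    simpa only [ContinuousLinearMap.map_smul_of_tower] using this
  · refine Integrable.mono' ((integrableOn_rpow_div_one_add_mul hα0 hα1 ht).const_mul
      (M * C * B * t ^ (b + 1))) hmeas.norm.integral_prod_right' ?_
    filter_upwards [ae_restrict_mem measurableSet_Ioi] with x (hx : 0 < x)
    have hpi : IntervalIntegrable (fun s : ℝ => Real.exp (-(x * (t - s))) • s ^ b) volume 0 t :=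
      (intervalIntegral.intervalIntegrable_rpow' hb).continuousOn_smul (by fun_prop)
    have h1 : ‖∫ s in Ioc 0 t, ‖Real.exp (-(x * (t - s))) • density K x (f s)‖‖ ≤
        ∫ s in Ioc 0 t, M * x ^ (-α) * C * (Real.exp (-(x * (t - s))) • s ^ b) := by
      refine norm_integral_le_of_norm_le
        (((intervalIntegrable_iff_integrableOn_Ioc_of_le ht.le).mp hpi).const_mul _) ?_
      filter_upwards [ae_restrict_mem measurableSet_Ioc] with s hs
      rw [norm_norm, norm_smul, Real.norm_of_nonneg (Real.exp_pos _).le, smul_eq_mul]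
      have h2 := ((density K x).le_opNorm (f s)).trans
        (mul_le_mul (h.norm_density_le hx) (hC s hs) (norm_nonneg _) (by positivity))
      calc _ ≤ Real.exp (-(x * (t - s))) * (M * x ^ (-α) * (C * s ^ b)) := by gcongr
        _ = _ := by ring
    refine h1.trans ?_
    rw [integral_const_mul, ← intervalIntegral.integral_of_le ht.le]
    have h3 := (le_abs_self _).trans (hbd x t hx.le ht)
    simp only [Nat.cast_zero, sub_zero] at h3
    change ∫ s in (0 : ℝ)..t, Real.exp (-(x * (t - s))) • s ^ b ≤ _ at h3
    calc _ ≤ M * x ^ (-α) * C * (B * (t ^ (b + 1) / (1 + x * t))) := by gcongr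
      _ = _ := by rw [mul_comm x t]; ring

theorem IsSectorial.integral_density_expConv [CompleteSpace X] [CompleteSpace Y]
    (h : IsSectorial K M α) (hk : IsLaplaceTransform k K) (hα0 : 0 < α) (hα1 : α < 1)
    (hb : -1 < b) (ht : 0 < t) (hf : ContinuousOn f (Ioc 0 t))
    (hC : ∀ s ∈ Ioc 0 t, ‖f s‖ ≤ C * s ^ b) :
    IntervalIntegrable (fun s => k (t - s) (f s)) volume 0 t ∧
      IntegrableOn (fun x => density K x (expConv x f t)) (Ioi 0) ∧
      conv k f t = ∫ x in Ioi (0 : ℝ), density K x (expConv x f t) := by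
  have hp := h.integrable_prod_expConv hα0 hα1 hb ht hf hC
  have hfi := intervalIntegrable_of_norm_le_rpow hb ht hf hC
  have hx : ∀ x : ℝ, ∫ s in Ioc 0 t, Real.exp (-(x * (t - s))) • density K x (f s)
      = density K x (expConv x f t) := by
    intro x
    rw [expConv, intervalIntegral.integral_of_le ht.le, ← ContinuousLinearMap.integral_comp_comm]
    · simp only [ContinuousLinearMap.map_smul_of_tower]
    · rw [← IntegrableOn, ← intervalIntegrable_iff_integrableOn_Ioc_of_le ht.le]
      exact hfi.continuousOn_smul (by fun_prop)
  have hs : ∀ᵐ s ∂volume.restrict (Ioc 0 t),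
      ∫ x in Ioi (0 : ℝ), Real.exp (-(x * (t - s))) • density K x (f s) = k (t - s) (f s) := by
    have hk1 := hk.ae_eq_realKernel h hα0 hα1
    rw [ae_restrict_iff' measurableSet_Ioi] at hk1
    -- The exceptional null set of `k` is carried to one in `s` by the reflection `s ↦ t - s`.
    have hk2 := (Measure.measurePreserving_sub_left volume t).quasiMeasurePreserving.ae hk1
    have hne : ∀ᵐ s : ℝ, s ≠ t := by simp [ae_iff]
    rw [ae_restrict_iff' measurableSet_Ioc]
    filter_upwards [hk2, hne] with s h1 h2 hst
    have hlt : 0 < t - s := sub_pos.mpr (lt_of_le_of_ne hst.2 h2)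
    rw [h1 hlt, realKernel,
      ContinuousLinearMap.integral_apply (h.integrableOn_exp_smul_density hα0 hα1 hlt)]
    rfl
  refine ⟨?_, ?_, ?_⟩
  · rw [intervalIntegrable_iff_integrableOn_Ioc_of_le ht.le]
    exact hp.integral_prod_right.congr hs
  · have := hp.integral_prod_left
    simp_rw [hx] at this
    exact this
  · have := integral_integral_swap (f := fun x s : ℝ =>
      Real.exp (-(x * (t - s))) • density K x (f s)) hp
    simp_rw [hx] at this
    rw [this, conv, intervalIntegral.integral_of_le ht.le]
    exact integral_congr_ae (hs.mono fun s h => h.symm)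

end Fubini

end GCQ

namespace GCQ

/-! ### Linearity and continuity of the scalar solvers -/

section Linearity

variable {E : Type*} [NormedAddCommGroup E] [NormedSpace ℂ E] {s : ℕ}

theorem rkSol_add (rk : RungeKutta s) (t : ℕ → ℝ) (f g : ℝ → E) (x : ℝ) (n : ℕ) :
    rkSol rk t (fun t => f t + g t) x n = rkSol rk t f x n + rkSol rk t g x n := by
  simp only [rkSol, smul_add, Finset.sum_add_distrib]

theorem rkSol_sum {ι : Type*} (rk : RungeKutta s) (t : ℕ → ℝ) (S : Finset ι) (f : ι → ℝ → E)
    (x : ℝ) (n : ℕ) :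
    rkSol rk t (fun t => ∑ l ∈ S, f l t) x n = ∑ l ∈ S, rkSol rk t (f l) x n := by
  classical
  induction S using Finset.induction_on with
  | empty => simp [rkSol]
  | insert a S ha ih => simp only [Finset.sum_insert ha, rkSol_add, ih]

theorem rkSol_congr (rk : RungeKutta s) (t : ℕ → ℝ) {f g : ℝ → E} (x : ℝ) (n : ℕ)
    (h : ∀ j ∈ Finset.Icc 1 n, ∀ i, f (t (j - 1) + rk.c i * (t j - t (j - 1))) =
      g (t (j - 1) + rk.c i * (t j - t (j - 1)))) :
    rkSol rk t f x n = rkSol rk t g x n := by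
  unfold rkSol
  refine Finset.sum_congr rfl fun j hj => ?_
  simp only [h j hj]

theorem expConv_add {x t : ℝ} {f g : ℝ → E} (hf : IntervalIntegrable f volume 0 t)
    (hg : IntervalIntegrable g volume 0 t) :
    expConv x (fun s => f s + g s) t = expConv x f t + expConv x g t := by
  unfold expConv
  simp only [smul_add]
  exact intervalIntegral.integral_add (hf.continuousOn_smul (by fun_prop))
    (hg.continuousOn_smul (by fun_prop))

theorem expConv_sum {ι : Type*} {x t : ℝ} (S : Finset ι) {f : ι → ℝ → E}
    (hf : ∀ l ∈ S, IntervalIntegrable (f l) volume 0 t) :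
    expConv x (fun s => ∑ l ∈ S, f l s) t = ∑ l ∈ S, expConv x (f l) t := by
  unfold expConv
  simp only [Finset.smul_sum]
  exact intervalIntegral.integral_finsetSum fun l hl => (hf l hl).continuousOn_smul (by fun_prop)

theorem expConv_congr {x t : ℝ} (ht : 0 ≤ t) {f g : ℝ → E} (h : ∀ s ∈ Ioc 0 t, f s = g s) :
    expConv x f t = expConv x g t := by
  unfold expConv
  rw [intervalIntegral.integral_of_le ht, intervalIntegral.integral_of_le ht]
  refine setIntegral_congr_fun measurableSet_Ioc fun s hs => ?_
  simp only [h s hs]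

theorem RungeKutta.continuousOn_resolventRow {rk : RungeKutta s}
    (h : ∀ μ ∈ spectrum ℂ rk.matC, 0 < μ.re) (i : Fin s) :
    ContinuousOn (fun z => rk.resolventRow z i) {z : ℂ | z.re ≤ 0} := by
  have h1 : ContinuousOn (fun z => ∑ j, (rk.b j : ℂ) * rk.stageInv z j i) {z : ℂ | z.re ≤ 0} := by
    refine continuousOn_finsetSum _ fun j _ => continuousOn_const.mul ?_
    exact (continuous_id.matrix_elem j i).comp_continuousOn (continuousOn_stageInv h)
  exact h1.congr fun z _ => rfl

theorem continuousOn_rkSol {rk : RungeKutta s} (h : ∀ μ ∈ spectrum ℂ rk.matC, 0 < μ.re)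
    {t : ℕ → ℝ} (ht : Monotone t) (f : ℝ → E) (n : ℕ) :
    ContinuousOn (fun x => rkSol rk t f x n) (Ici 0) := by
  have hrow : ∀ j i, ContinuousOn
      (fun x : ℝ => rk.resolventRow (-((t j - t (j - 1)) * x : ℝ)) i) (Ici 0) := fun j i =>
    (RungeKutta.continuousOn_resolventRow h i).comp (by fun_prop) fun x hx => by
      have h1 := mul_nonneg (sub_nonneg.mpr (ht (Nat.sub_le j 1))) (mem_Ici.mp hx)
      simpa only [mem_ofPred_eq, Complex.neg_re, Complex.ofReal_re, neg_nonpos] using h1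
  have hstab : ∀ j, ContinuousOn
      (fun x : ℝ => rk.stab (-((t j - t (j - 1)) * x : ℝ))) (Ici 0) := fun j => by
    refine continuousOn_const.add (ContinuousOn.mul (by fun_prop) ?_)
    exact continuousOn_finsetSum _ fun i _ => hrow j i
  refine continuousOn_finsetSum _ fun j _ => ?_
  refine (continuousOn_finsetProd _ fun l _ => hstab l).smul (ContinuousOn.const_smul ?_ _)
  exact continuousOn_finsetSum _ fun i _ => (hrow j i).smul continuousOn_const

end Linearity

/-! ### Error of the scalar problems, integrated against the density -/

section ScalarError

variable {r : ℕ} {rk : RungeKutta (r + 1)} {p q : ℕ} {α γ T : ℝ}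

theorem RungeKutta.Admissible.exists_powError (h : rk.Admissible p q) (hα0 : 0 < α) (hα1 : α < 1)
    {β : ℝ} (hβ : -1 < β) (hγ : 1 ≤ γ) (hT : 0 < T) :
    ∃ C : ℝ, 0 < C ∧ ∀ N n : ℕ, 2 ≤ N → 1 ≤ n → n ≤ N → ∃ W : ℝ → ℝ,
      IntegrableOn (fun x => x ^ (-α) * W x) (Ioi 0) ∧
      ∫ x in Ioi (0 : ℝ), x ^ (-α) * W x ≤
        C * (Real.log N * (N : ℝ) ^ (-(min (γ * (α + β)) (min (p : ℝ) (q + 1 + α))))) ∧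
      ∀ (E : Type u) [NormedAddCommGroup E] [NormedSpace ℂ E] [CompleteSpace E] (a : E) (x : ℝ),
        0 ≤ x → ‖expConv x (fun s => (s ^ β : ℝ) • a) (gradedMesh T γ N n) -
          rkSol rk (gradedMesh T γ N) (fun s => (s ^ β : ℝ) • a) x n‖ ≤ ‖a‖ * W x := by
  -- Orders above `q + 2` do not improve the rate because `q + 1 + α < q + 2`; lowering `p` to `min
  -- p (q + 2)` brings the defect analysis within reach.
  obtain ⟨p', hp', hpp, hqp, hmin⟩ : ∃ p' : ℕ, p' ≤ q + 2 ∧ p' ≤ p ∧ q ≤ p' ∧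
      min (p' : ℝ) (q + 1 + α) = min (p : ℝ) (q + 1 + α) := by
    refine ⟨min p (q + 2), min_le_right _ _, min_le_left _ _, le_min h.q_le_p (by omega), ?_⟩
    push_cast
    rw [min_assoc, min_eq_right (by linarith : (q : ℝ) + 1 + α ≤ q + 2)]
  have h' := h.mono hqp hpp
  obtain ⟨C₁, hC₁, hsol⟩ := h'.exists_powSol_solutionBounds.{u} hβ
  obtain ⟨C₂, c, hC₂, hc, herr⟩ := h'.exists_globalError_bound.{u} hp' β hγ
  obtain ⟨C₃, hC₃, hint⟩ := exists_integral_sum_errorWeight_le α β γ T p' q hα0 hα1 hT hγ hc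
  refine ⟨C₂ * C₁ * C₃, by positivity, fun N n hN hn hnN => ?_⟩
  obtain ⟨hi, hle⟩ := hint N n hN hn hnN
  refine ⟨fun x => C₂ * C₁ * ∑ j ∈ Finset.Icc 1 n, errorWeight T γ β c p' q N n j x, ?_, ?_, ?_⟩
  · refine (hi.const_mul (C₂ * C₁)).congr (ae_of_all _ fun x => ?_)
    simp only; ring
  · rw [hmin] at hle
    have : ∀ x : ℝ, x ^ (-α) * (C₂ * C₁ * ∑ j ∈ Finset.Icc 1 n, errorWeight T γ β c p' q N n j x)
        = C₂ * C₁ * (x ^ (-α) * ∑ j ∈ Finset.Icc 1 n, errorWeight T γ β c p' q N n j x) :=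
      fun x => by ring
    simp_rw [this]
    rw [integral_const_mul, mul_assoc (C₂ * C₁)]
    gcongr
  · intro E _ _ _ a x hx
    have h1 := herr E T x (C₁ * ‖a‖) N n _ _ hT hx (by omega) hn
      (hsol E a x (gradedMesh T γ N n) hx)
    have h2 : powSol β x 0 (gradedMesh T γ N n) • a =
        expConv x (fun s => (s ^ β : ℝ) • a) (gradedMesh T γ N n) := by
      rw [powSol, expConv, expConv, ← intervalIntegral.integral_smul_const]
      simp only [smul_smul, smul_eq_mul]
    rw [← h2]
    refine h1.trans (le_of_eq ?_)
    ring

theorem RungeKutta.Admissible.exists_rlError (h : rk.Admissible p q) (hα0 : 0 < α) (hα1 : α < 1)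
    {μ : ℝ} (hμ : (p : ℝ) ≤ μ) (hγ : 1 ≤ γ) (hT : 0 < T) :
    ∃ C : ℝ, 0 < C ∧ ∀ N n : ℕ, 2 ≤ N → 1 ≤ n → n ≤ N → ∃ W : ℝ → ℝ,
      IntegrableOn (fun x => x ^ (-α) * W x) (Ioi 0) ∧
      ∫ x in Ioi (0 : ℝ), x ^ (-α) * W x ≤
        C * (Real.log N * (N : ℝ) ^ (-(min (p : ℝ) (q + 1 + α)))) ∧
      ∀ (E : Type u) [NormedAddCommGroup E] [NormedSpace ℂ E] [CompleteSpace E] (g : ℝ → E)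
        (G x : ℝ), Continuous g → (∀ s, ‖g s‖ ≤ G) → 0 ≤ x →
        ‖expConv x (rlChain μ g 0) (gradedMesh T γ N n) -
          rkSol rk (gradedMesh T γ N) (rlChain μ g 0) x n‖ ≤ G * W x := by
  obtain ⟨p', hp', hpp, hqp, hmin⟩ : ∃ p' : ℕ, p' ≤ q + 2 ∧ p' ≤ p ∧ q ≤ p' ∧
      min (p' : ℝ) (q + 1 + α) = min (p : ℝ) (q + 1 + α) := by
    refine ⟨min p (q + 2), min_le_right _ _, min_le_left _ _, le_min h.q_le_p (by omega), ?_⟩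
    push_cast
    rw [min_assoc, min_eq_right (by linarith : (q : ℝ) + 1 + α ≤ q + 2)]
  have h' := h.mono hqp hpp
  have hppR : (p' : ℝ) ≤ p := by exact_mod_cast hpp
  obtain ⟨C₁, hC₁, hsol⟩ := h'.exists_rlSol_solutionBounds.{u} (hppR.trans hμ) hT
  obtain ⟨C₂, c, hC₂, hc, herr⟩ := h'.exists_globalError_bound.{u} hp' p' hγ
  obtain ⟨C₃, hC₃, hint⟩ := exists_integral_sum_errorWeight_le α p' γ T p' q hα0 hα1 hT hγ hc
  -- The remainder behaves like `t^{p'}` at the origin, and `γ (α + p') ≥ p'`, so grading is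
  -- irrelevant to its rate.
  have hrate : min (γ * (α + p')) (min (p' : ℝ) (q + 1 + α)) = min (p : ℝ) (q + 1 + α) := by
    rw [hmin]
    refine min_eq_right ?_
    rw [← hmin]
    have h0 : (0 : ℝ) ≤ p' := by positivity
    exact (min_le_left _ _).trans (by nlinarith)
  refine ⟨C₂ * C₁ * C₃, by positivity, fun N n hN hn hnN => ?_⟩
  obtain ⟨hi, hle⟩ := hint N n hN hn hnN
  refine ⟨fun x => C₂ * C₁ * ∑ j ∈ Finset.Icc 1 n, errorWeight T γ p' c p' q N n j x, ?_, ?_, ?_⟩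
  · refine (hi.const_mul (C₂ * C₁)).congr (ae_of_all _ fun x => ?_)
    simp only; ring
  · rw [hrate] at hle
    have : ∀ x : ℝ, x ^ (-α) * (C₂ * C₁ * ∑ j ∈ Finset.Icc 1 n, errorWeight T γ p' c p' q N n j x)
        = C₂ * C₁ * (x ^ (-α) * ∑ j ∈ Finset.Icc 1 n, errorWeight T γ p' c p' q N n j x) :=
      fun x => by ring
    simp_rw [this]
    rw [integral_const_mul, mul_assoc (C₂ * C₁)]
    gcongr
  · intro E _ _ _ g G x hg hG hx
    have h1 := herr E T x (C₁ * G) N n _ _ hT hx (by omega) hn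
      (hsol E g G x (gradedMesh T γ N n) hg hG hx (gradedMesh_le hT hγ hnN))
    refine h1.trans (le_of_eq ?_)
    ring

end ScalarError

/-! ### Integration against the density -/

section Assembly

variable {X : Type u} {Y : Type v} [NormedAddCommGroup X] [NormedSpace ℂ X] [CompleteSpace X]
  [NormedAddCommGroup Y] [NormedSpace ℂ Y] [CompleteSpace Y]
  {k : ℝ → X →L[ℂ] Y} {K : ℂ → X →L[ℂ] Y} {M α b C B : ℝ} {f : ℝ → X}

theorem IsSectorial.norm_conv_sub_gcq_le (h : IsSectorial K M α) (hk : IsLaplaceTransform k K)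
    (hα0 : 0 < α) (hα1 : α < 1) {s : ℕ} {rk : RungeKutta s}
    (hs : ∀ μ ∈ spectrum ℂ rk.matC, 0 < μ.re) {t : ℕ → ℝ} (hmono : Monotone t) {n : ℕ}
    (ht : 0 < t n) (hb : -1 < b) (hf : ContinuousOn f (Ioc 0 (t n)))
    (hC : ∀ s ∈ Ioc 0 (t n), ‖f s‖ ≤ C * s ^ b) {W : ℝ → ℝ}
    (hW : IntegrableOn (fun x => x ^ (-α) * W x) (Ioi 0))
    (hB : ∫ x in Ioi (0 : ℝ), x ^ (-α) * W x ≤ B)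
    (he : ∀ x, 0 ≤ x → ‖expConv x f (t n) - rkSol rk t f x n‖ ≤ W x) :
    IntervalIntegrable (fun s => k (t n - s) (f s)) volume 0 (t n) ∧
      IntegrableOn (fun x => density K x (rkSol rk t f x n)) (Ioi 0) ∧
      ‖conv k f (t n) - gcq rk K t f n‖ ≤ M * B := by
  obtain ⟨h1, h2, h3⟩ := h.integral_density_expConv hk hα0 hα1 hb ht hf hC
  have hM0 : 0 ≤ M := by
    have := (norm_nonneg _).trans (h.norm_density_le one_pos)
    simpa using this
  have hm : AEStronglyMeasurable (fun x => density K x (rkSol rk t f x n))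
      (volume.restrict (Ioi 0)) :=
    (h.continuousOn_density.clm_apply ((continuousOn_rkSol hs hmono f n).mono
      Ioi_subset_Ici_self)).aestronglyMeasurable measurableSet_Ioi
  have hbd : ∀ᵐ x ∂volume.restrict (Ioi (0 : ℝ)),
      ‖density K x (expConv x f (t n)) - density K x (rkSol rk t f x n)‖
        ≤ M * (x ^ (-α) * W x) := by
    filter_upwards [ae_restrict_mem measurableSet_Ioi] with x (hx : 0 < x)
    rw [← map_sub, ← mul_assoc]
    exact ((density K x).le_opNorm _).trans (mul_le_mul (h.norm_density_le hx) (he x hx.le)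
      (norm_nonneg _) (by positivity))
  -- The discrete integrand is integrable as the exact one minus the error, the latter dominated by
  -- `M x^{-α} W x`.
  have hd := Integrable.mono' (hW.const_mul M) (h2.aestronglyMeasurable.sub hm) hbd
  have h4 : IntegrableOn (fun x => density K x (rkSol rk t f x n)) (Ioi 0) := by
    refine (h2.sub hd).congr (ae_of_all _ fun x => ?_)
    simp
  refine ⟨h1, h4, ?_⟩
  rw [h3, gcq, ← integral_sub h2 h4]
  refine (norm_integral_le_of_norm_le (hW.const_mul M) hbd).trans ?_
  rw [integral_const_mul]
  gcongr

end Assembly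

end GCQ

namespace GCQ

/-! ### Splitting the data into powers and a fractional integral -/

section Clamp

variable {X : Type u} {g : ℝ → X} {S : ℝ}

/-- Extension of `g` from `[0,S]` by constants. -/
noncomputable def clamp (g : ℝ → X) (S s : ℝ) : X := g (max 0 (min S s))

theorem clamp_of_mem {s : ℝ} (hs : s ∈ Icc 0 S) : clamp g S s = g s := by
  rw [clamp, min_eq_right hs.2, max_eq_right hs.1]

theorem clamp_mem (hS : 0 ≤ S) (s : ℝ) : max 0 (min S s) ∈ Icc 0 S :=
  ⟨le_max_left _ _, max_le hS (min_le_left _ _)⟩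

variable [NormedAddCommGroup X]

theorem continuous_clamp (hS : 0 ≤ S) (hg : ContinuousOn g (Icc 0 S)) : Continuous (clamp g S) :=
  hg.comp_continuous (by fun_prop) (clamp_mem hS)

/-- The clamped function is controlled by the values on `[0, S]` alone, so with `S = t_n` the final
estimate sees only the norm over `[0, t_n]`. -/
theorem norm_clamp_le (hS : 0 ≤ S) (hg : ContinuousOn g (Icc 0 S)) (s : ℝ) :
    ‖clamp g S s‖ ≤ supNorm g S :=
  le_csSup (isCompact_Icc.image_of_continuousOn hg.norm).bddAbove
    (mem_image_of_mem _ (clamp_mem hS s))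

end Clamp

section Expansion

variable {X : Type u} [NormedAddCommGroup X] [NormedSpace ℂ X] {f g : ℝ → X} {a : ℤ → X}
  {T β S t : ℝ} {m : ℤ}

theorem HasFracExpansion.eq_add_rlChain (h : HasFracExpansion f T β m a g) (hST : S ≤ T)
    (ht : t ∈ Icc 0 S) (h0 : t = 0 → 0 ≤ β) :
    f t = ∑ l ∈ Finset.Icc (0 : ℤ) m,
        (t ^ ((l : ℝ) + β)) • ((1 / Real.Gamma ((l : ℝ) + β + 1)) • a l)
      + rlChain ((m : ℝ) + β + 1) (clamp g S) 0 t := by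
  rw [h.expansion t ⟨ht.1, ht.2.trans hST⟩ h0, rlChain, fracInt]
  congr 1
  · refine Finset.sum_congr rfl fun l _ => ?_
    rw [smul_smul, mul_comm]
  · rw [Nat.cast_zero, sub_zero, add_sub_cancel_right, one_div]
    congr 1
    refine intervalIntegral.integral_congr fun s hs => ?_
    rw [uIcc_of_le ht.1] at hs
    simp only [clamp_of_mem (g := g) (⟨hs.1, hs.2.trans ht.2⟩ : s ∈ Icc 0 S)]

/-- Only integrability of `f` at the origin is at stake: the constant may depend on the data, as it
never enters the error bound. -/
theorem exists_norm_le_rpow {ψ : ℝ → X} (hS : 0 < S) (hψ : ContinuousOn ψ (Icc 0 S))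
    (hβ : β ≤ 0) (A : Finset ℤ) (hA : ∀ l ∈ A, 0 ≤ l) {δ : ℝ} (hδ : β ≤ δ) (c : ℤ → X) :
    ∃ C : ℝ, ∀ s ∈ Ioc 0 S, ‖∑ l ∈ A, (s ^ ((l : ℝ) + δ)) • c l + ψ s‖ ≤ C * s ^ β := by
  obtain ⟨B, hB⟩ := isCompact_Icc.exists_bound_of_continuousOn hψ
  have hpow : ∀ e s : ℝ, s ∈ Ioc 0 S → 0 ≤ e → s ^ (e + β) ≤ S ^ e * s ^ β := by
    intro e s hs he
    rw [Real.rpow_add hs.1]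
    exact mul_le_mul_of_nonneg_right (Real.rpow_le_rpow hs.1.le hs.2 he)
      (Real.rpow_nonneg hs.1.le _)
  refine ⟨∑ l ∈ A, S ^ ((l : ℝ) + δ - β) * ‖c l‖ + S ^ (-β) * B, fun s hs => ?_⟩
  have hB0 : 0 ≤ B := (norm_nonneg _).trans (hB S ⟨hS.le, le_rfl⟩)
  rw [add_mul, Finset.sum_mul]
  refine (norm_add_le _ _).trans (add_le_add ((norm_sum_le _ _).trans
    (Finset.sum_le_sum fun l hl => ?_)) ?_)
  · have hl0 : (0 : ℝ) ≤ l := by exact_mod_cast hA l hl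
    have := hpow ((l : ℝ) + δ - β) s hs (by linarith)
    rw [sub_add_cancel] at this
    rw [norm_smul, Real.norm_of_nonneg (Real.rpow_nonneg hs.1.le _), mul_right_comm]
    gcongr
  · have := hpow (-β) s hs (by linarith)
    rw [neg_add_cancel, Real.rpow_zero] at this
    calc ‖ψ s‖ ≤ 1 * B := by rw [one_mul]; exact hB s ⟨hs.1.le, hs.2⟩
      _ ≤ S ^ (-β) * s ^ β * B := by gcongr
      _ = _ := by ring

end Expansion

end GCQ
-- The main theorem: superposition of power terms and remainder
theorem mainTheorem2 {r : ℕ} (rk : GCQ.RungeKutta (r + 1)) (p q : ℕ)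
    (hrk : rk.Admissible p q)
    (α β γ T : ℝ) (hα0 : 0 < α) (hα1 : α < 1) (hβ : -1 < β)
    (hc : β < 0 → ∀ i, 0 < rk.c i) (hγ : 1 ≤ γ) (hT : 0 < T) :
    ∃ C : ℝ, 0 < C ∧
      ∀ (X : Type u) (Y : Type v)
        [NormedAddCommGroup X] [NormedSpace ℂ X] [CompleteSpace X]
        [NormedAddCommGroup Y] [NormedSpace ℂ Y] [CompleteSpace Y]
        (k : ℝ → X →L[ℂ] Y) (K : ℂ → X →L[ℂ] Y) (M : ℝ)
        (f : ℝ → X) (m : ℤ) (a : ℤ → X) (g : ℝ → X),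
        GCQ.IsLaplaceTransform k K → 0 < M → GCQ.IsSectorial K M α →
        m = ⌈(p : ℝ) - β - 1⌉ → GCQ.HasFracExpansion f T β m a g →
        ∀ N n : ℕ, 2 ≤ N → 1 ≤ n → n ≤ N →
          IntervalIntegrable
            (fun s => k (GCQ.gradedMesh T γ N n - s) (f s)) volume 0 (GCQ.gradedMesh T γ N n) ∧
          IntegrableOn
            (fun x => GCQ.density K x (GCQ.rkSol rk (GCQ.gradedMesh T γ N) f x n)) (Ioi 0) ∧
          ‖GCQ.conv k f (GCQ.gradedMesh T γ N n) - GCQ.gcq rk K (GCQ.gradedMesh T γ N) f n‖ ≤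
            C * M * ∑ l ∈ Finset.Icc (0 : ℤ) m,
                Real.log N *
                  (N : ℝ) ^ (-(min (γ * (α + l + β)) (min (p : ℝ) ((q : ℝ) + 1 + α)))) * ‖a l‖
              + C * M * Real.log N * (N : ℝ) ^ (-(min (p : ℝ) ((q : ℝ) + 1 + α))) *
                  GCQ.supNorm g (GCQ.gradedMesh T γ N n) ∧
          (min (p : ℝ) ((q : ℝ) + 1 + α) ≤ γ * (α + β) →
            ‖GCQ.conv k f (GCQ.gradedMesh T γ N n) -
                GCQ.gcq rk K (GCQ.gradedMesh T γ N) f n‖ ≤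
              C * M * Real.log N * (N : ℝ) ^ (-(min (p : ℝ) ((q : ℝ) + 1 + α))) *
                (∑ l ∈ Finset.Icc (0 : ℤ) m, ‖a l‖ +
                  GCQ.supNorm g (GCQ.gradedMesh T γ N n))) := by
  -- The number of power terms depends on `p` and `β` only, so the constant can be fixed before the
  -- data. The ceiling makes the order `m₀ + β + 1` of the remainder integral at least `p`.
  obtain ⟨m₀, hm₀⟩ : ∃ m₀ : ℤ, m₀ = ⌈(p : ℝ) - β - 1⌉ := ⟨_, rfl⟩
  have hm1 : (p : ℝ) ≤ m₀ + β + 1 := by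
    have := Int.le_ceil ((p : ℝ) - β - 1)
    rw [← hm₀] at this; linarith
  have hp1 : (1 : ℝ) ≤ p := by exact_mod_cast hrk.one_le_p
  have hΓ : ∀ l : ℤ, 0 ≤ l → 0 < 1 / Real.Gamma ((l : ℝ) + β + 1) := fun l hl => by
    have : (0 : ℝ) ≤ l := by exact_mod_cast hl
    exact one_div_pos.mpr (Real.Gamma_pos_of_pos (by linarith))
  -- Negative indices receive the dummy constant `1`, so that a constant can be chosen for every
  -- integer.
  have hpow : ∀ l : ℤ, ∃ C : ℝ, 0 < C ∧ (0 ≤ l → ∀ N n : ℕ, 2 ≤ N → 1 ≤ n → n ≤ N → ∃ W : ℝ → ℝ,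
      IntegrableOn (fun x => x ^ (-α) * W x) (Ioi 0) ∧
      ∫ x in Ioi (0 : ℝ), x ^ (-α) * W x ≤
        C * (Real.log N * (N : ℝ) ^ (-(min (γ * (α + (l + β))) (min (p : ℝ) (q + 1 + α))))) ∧
      ∀ (E : Type u) [NormedAddCommGroup E] [NormedSpace ℂ E] [CompleteSpace E] (a : E) (x : ℝ),
        0 ≤ x → ‖GCQ.expConv x (fun s => (s ^ ((l : ℝ) + β) : ℝ) • a) (GCQ.gradedMesh T γ N n) -
          GCQ.rkSol rk (GCQ.gradedMesh T γ N) (fun s => (s ^ ((l : ℝ) + β) : ℝ) • a) x n‖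
            ≤ ‖a‖ * W x) := fun l => by
    by_cases hl : 0 ≤ l
    · have hl' : (0 : ℝ) ≤ l := by exact_mod_cast hl
      obtain ⟨C, hC, h⟩ := hrk.exists_powError.{u} hα0 hα1 (β := l + β) (by linarith) hγ hT
      exact ⟨C, hC, fun _ => h⟩
    · exact ⟨1, one_pos, fun h => absurd h hl⟩
  choose Cp hCp hWp using hpow
  obtain ⟨Cr, hCr, hWr⟩ := hrk.exists_rlError.{u} hα0 hα1 hm1 hγ hT
  have hterm : ∀ l ∈ Finset.Icc (0 : ℤ) m₀, 0 ≤ 1 / Real.Gamma ((l : ℝ) + β + 1) * Cp l :=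
    fun l hl => mul_nonneg (hΓ l (Finset.mem_Icc.mp hl).1).le (hCp l).le
  obtain ⟨C, hCdef⟩ : ∃ C : ℝ,
      C = ∑ l ∈ Finset.Icc (0 : ℤ) m₀, 1 / Real.Gamma ((l : ℝ) + β + 1) * Cp l + Cr := ⟨_, rfl⟩
  have hCrC : Cr ≤ C := by
    have := Finset.sum_nonneg hterm
    linarith
  have hClC : ∀ l ∈ Finset.Icc (0 : ℤ) m₀, 1 / Real.Gamma ((l : ℝ) + β + 1) * Cp l ≤ C :=
    fun l hl => by
      have := Finset.single_le_sum hterm hl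
      linarith
  refine ⟨C, hCr.trans_le hCrC, ?_⟩
  intro X Y _ _ _ _ _ _ k K M f m a g hk hM hK hm hf N n hN hn hnN
  obtain rfl : m = m₀ := hm.trans hm₀.symm
  set S := GCQ.gradedMesh T γ N n with hS
  have hS0 : 0 < S := GCQ.gradedMesh_pos hT hγ (by omega) hn
  have hST : S ≤ T := GCQ.gradedMesh_le hT hγ hnN
  have hmono : Monotone (GCQ.gradedMesh T γ N) := GCQ.gradedMesh_mono hT hγ
  have hgc : ContinuousOn g (Icc 0 S) := hf.deriv_cont.mono (Icc_subset_Icc_right hST)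
  have hcc := GCQ.continuous_clamp hS0.le hgc
  have hcn := GCQ.norm_clamp_le hS0.le hgc
  have hG0 : 0 ≤ GCQ.supNorm g S := (norm_nonneg _).trans (hcn 0)
  have hL0 : 0 ≤ Real.log N := Real.log_natCast_nonneg N
  have hkμ : ((0 : ℕ) : ℝ) + 1 ≤ (m : ℝ) + β + 1 := by push_cast; linarith
  set ψ := GCQ.rlChain ((m : ℝ) + β + 1) (GCQ.clamp g S) 0 with hψ
  set c : ℤ → X := fun l => (1 / Real.Gamma ((l : ℝ) + β + 1)) • a l with hcdef
  set φ : ℝ → X := fun t => ∑ l ∈ Finset.Icc (0 : ℤ) m, (t ^ ((l : ℝ) + β)) • c l + ψ t with hφ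
  have hψc : ContinuousOn ψ (Icc 0 S) := GCQ.continuousOn_rlChain hcc hcn hkμ S
  have hfφ : ∀ t ∈ Icc 0 S, (t = 0 → 0 ≤ β) → f t = φ t := fun t ht h0 =>
    hf.eq_add_rlChain hST ht h0
  have hfφ' : ∀ t ∈ Ioc 0 S, f t = φ t := fun t ht =>
    hfφ t ⟨ht.1.le, ht.2⟩ fun h => absurd h ht.1.ne'
  have hφc : ContinuousOn φ (Ioc 0 S) := by
    refine ContinuousOn.add (continuousOn_finsetSum _ fun l _ => ?_)
      (hψc.mono Ioc_subset_Icc_self)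
    exact (continuousOn_id.rpow_const fun t ht => Or.inl (mem_Ioc.mp ht).1.ne').smul
      continuousOn_const
  have hfc : ContinuousOn f (Ioc 0 S) := hφc.congr hfφ'
  obtain ⟨B, hB⟩ := GCQ.exists_norm_le_rpow hS0 hψc (min_le_right β 0) (Finset.Icc (0 : ℤ) m)
    (fun l hl => (Finset.mem_Icc.mp hl).1) (min_le_left β 0) c
  have hfB : ∀ s ∈ Ioc 0 S, ‖f s‖ ≤ B * s ^ min β 0 := fun s hs => by
    rw [hfφ' s hs]; exact hB s hs
  have hW : ∀ l : ℤ, ∃ W : ℝ → ℝ, 0 ≤ l →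
      IntegrableOn (fun x => x ^ (-α) * W x) (Ioi 0) ∧
      ∫ x in Ioi (0 : ℝ), x ^ (-α) * W x ≤
        Cp l * (Real.log N * (N : ℝ) ^ (-(min (γ * (α + (l + β))) (min (p : ℝ) (q + 1 + α))))) ∧
      ∀ x, 0 ≤ x → ‖GCQ.expConv x (fun s => (s ^ ((l : ℝ) + β) : ℝ) • c l) S -
          GCQ.rkSol rk (GCQ.gradedMesh T γ N) (fun s => (s ^ ((l : ℝ) + β) : ℝ) • c l) x n‖
            ≤ ‖c l‖ * W x := fun l => by
    by_cases hl : 0 ≤ l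
    · obtain ⟨W, h1, h2, h3⟩ := hWp l hl N n hN hn hnN
      exact ⟨W, fun _ => ⟨h1, h2, h3 X (c l)⟩⟩
    · exact ⟨0, fun h => absurd h hl⟩
  choose W hW using hW
  obtain ⟨V, hV1, hV2, hV3⟩ := hWr N n hN hn hnN
  have hnode : ∀ j ∈ Finset.Icc 1 n, ∀ i,
      f (GCQ.gradedMesh T γ N (j - 1) + rk.c i *
        (GCQ.gradedMesh T γ N j - GCQ.gradedMesh T γ N (j - 1))) =
      φ (GCQ.gradedMesh T γ N (j - 1) + rk.c i *
        (GCQ.gradedMesh T γ N j - GCQ.gradedMesh T γ N (j - 1))) := by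
    intro j hj i
    have hj' := Finset.mem_Icc.mp hj
    have hci := hrk.c_mem i
    have h1 : 0 ≤ GCQ.gradedMesh T γ N (j - 1) := GCQ.gradedMesh_nonneg hT hγ _
    have h2 : GCQ.gradedMesh T γ N j ≤ S := hmono hj'.2
    have h4 : 0 < GCQ.gradedMesh T γ N j := GCQ.gradedMesh_pos hT hγ (by omega) hj'.1
    have h5 : 0 < GCQ.gradedMesh T γ N j - GCQ.gradedMesh T γ N (j - 1) :=
      (div_pos h4 (by exact_mod_cast hj'.1)).trans_le (GCQ.gradedMesh_step_ge hT hγ hj'.1)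
    -- A node can be `0` only if `c_i = 0`. When `β < 0` this is excluded by `c_i > 0`, so the
    -- expansion is never evaluated at the singularity.
    refine hfφ _ ⟨by nlinarith [hci.1], by nlinarith [hci.2]⟩ fun h0 => ?_
    by_contra! hneg
    nlinarith [mul_pos (hc hneg i) h5]
  have hpi : ∀ l ∈ Finset.Icc (0 : ℤ) m,
      IntervalIntegrable (fun s : ℝ => (s ^ ((l : ℝ) + β)) • c l) volume 0 S := fun l hl => by
    have : (0 : ℝ) ≤ l := by exact_mod_cast (Finset.mem_Icc.mp hl).1
    have h := intervalIntegral.intervalIntegrable_rpow' (a := 0) (b := S) (r := l + β) (by linarith)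
    exact ⟨h.1.smul_const _, h.2.smul_const _⟩
  have hsi : IntervalIntegrable
      (fun s : ℝ => ∑ l ∈ Finset.Icc (0 : ℤ) m, (s ^ ((l : ℝ) + β)) • c l) volume 0 S := by
    have := IntervalIntegrable.sum (μ := volume) (a := 0) (b := S) (Finset.Icc (0 : ℤ) m) hpi
    rwa [Finset.sum_fn] at this
  have herr : ∀ x, 0 ≤ x →
      ‖GCQ.expConv x f S - GCQ.rkSol rk (GCQ.gradedMesh T γ N) f x n‖ ≤
        ∑ l ∈ Finset.Icc (0 : ℤ) m, ‖c l‖ * W l x + GCQ.supNorm g S * V x := by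
    intro x hx
    rw [GCQ.expConv_congr hS0.le hfφ', GCQ.rkSol_congr rk _ x n hnode, hφ,
      GCQ.expConv_add hsi (GCQ.intervalIntegrable_rlChain hcc hcn hkμ hS0.le), GCQ.rkSol_add,
      GCQ.expConv_sum _ hpi, GCQ.rkSol_sum, add_sub_add_comm, ← Finset.sum_sub_distrib]
    refine (norm_add_le _ _).trans (add_le_add ((norm_sum_le _ _).trans
      (Finset.sum_le_sum fun l hl => ?_)) (hV3 X _ _ x hcc hcn hx))
    exact (hW l (Finset.mem_Icc.mp hl).1).2.2 x hx
  have hsplit : ∀ x : ℝ, x ^ (-α) *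
      (∑ l ∈ Finset.Icc (0 : ℤ) m, ‖c l‖ * W l x + GCQ.supNorm g S * V x) =
      ∑ l ∈ Finset.Icc (0 : ℤ) m, ‖c l‖ * (x ^ (-α) * W l x)
        + GCQ.supNorm g S * (x ^ (-α) * V x) := fun x => by
    rw [mul_add, Finset.mul_sum]
    congr 1
    · exact Finset.sum_congr rfl fun l _ => by ring
    · ring
  have hint1 : ∀ l ∈ Finset.Icc (0 : ℤ) m,
      IntegrableOn (fun x => ‖c l‖ * (x ^ (-α) * W l x)) (Ioi 0) := fun l hl =>
    (hW l (Finset.mem_Icc.mp hl).1).1.const_mul _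
  have hint : IntegrableOn (fun x => x ^ (-α) *
      (∑ l ∈ Finset.Icc (0 : ℤ) m, ‖c l‖ * W l x + GCQ.supNorm g S * V x)) (Ioi 0) := by
    simp_rw [hsplit]
    exact (integrable_finsetSum _ hint1).add (hV1.const_mul _)
  have hbound : ∫ x in Ioi (0 : ℝ), x ^ (-α) *
      (∑ l ∈ Finset.Icc (0 : ℤ) m, ‖c l‖ * W l x + GCQ.supNorm g S * V x) ≤
      C * ∑ l ∈ Finset.Icc (0 : ℤ) m, Real.log N *
          (N : ℝ) ^ (-(min (γ * (α + l + β)) (min (p : ℝ) ((q : ℝ) + 1 + α)))) * ‖a l‖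
        + C * Real.log N * (N : ℝ) ^ (-(min (p : ℝ) ((q : ℝ) + 1 + α))) * GCQ.supNorm g S := by
    simp_rw [hsplit]
    rw [integral_add (integrable_finsetSum _ hint1) (hV1.const_mul _),
      integral_finsetSum _ hint1, Finset.mul_sum]
    refine add_le_add (Finset.sum_le_sum fun l hl => ?_) ?_
    · have hl0 := (Finset.mem_Icc.mp hl).1
      rw [integral_const_mul, hcdef]
      simp only
      rw [norm_smul, Real.norm_of_nonneg (hΓ l hl0).le]
      have h1 := (hW l hl0).2.1
      rw [← add_assoc] at h1
      have h2 : 0 ≤ Real.log N *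
          (N : ℝ) ^ (-(min (γ * (α + l + β)) (min (p : ℝ) ((q : ℝ) + 1 + α)))) * ‖a l‖ := by
        positivity
      have h3 := (hΓ l hl0).le
      calc _ ≤ 1 / Real.Gamma ((l : ℝ) + β + 1) * ‖a l‖ * (Cp l * (Real.log N *
            (N : ℝ) ^ (-(min (γ * (α + l + β)) (min (p : ℝ) ((q : ℝ) + 1 + α)))))) := by gcongr
        _ = 1 / Real.Gamma ((l : ℝ) + β + 1) * Cp l * (Real.log N *
            (N : ℝ) ^ (-(min (γ * (α + l + β)) (min (p : ℝ) ((q : ℝ) + 1 + α)))) * ‖a l‖) := by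
          ring
        _ ≤ _ := mul_le_mul_of_nonneg_right (hClC l hl) h2
    · rw [integral_const_mul]
      calc _ ≤ GCQ.supNorm g S *
            (Cr * (Real.log N * (N : ℝ) ^ (-(min (p : ℝ) ((q : ℝ) + 1 + α))))) := by gcongr
        _ = Cr * Real.log N * (N : ℝ) ^ (-(min (p : ℝ) ((q : ℝ) + 1 + α))) *
            GCQ.supNorm g S := by ring
        _ ≤ _ := by gcongr
  obtain ⟨h1, h2, h3⟩ := hK.norm_conv_sub_gcq_le hk hα0 hα1 hrk.spectrum_re_pos hmono hS0
    (lt_min hβ (by norm_num)) hfc hfB hint hbound herr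
  have hmain : ‖GCQ.conv k f S - GCQ.gcq rk K (GCQ.gradedMesh T γ N) f n‖ ≤
      C * M * ∑ l ∈ Finset.Icc (0 : ℤ) m, Real.log N *
          (N : ℝ) ^ (-(min (γ * (α + l + β)) (min (p : ℝ) ((q : ℝ) + 1 + α)))) * ‖a l‖
        + C * M * Real.log N * (N : ℝ) ^ (-(min (p : ℝ) ((q : ℝ) + 1 + α))) *
          GCQ.supNorm g S := by
    refine h3.trans (le_of_eq ?_)
    ring
  refine ⟨h1, h2, hmain, fun hγα => hmain.trans (le_of_eq ?_)⟩
  -- The term `ℓ = 0` is the most singular; if the grading resolves it, it resolves all others.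
  have hexp : ∀ l ∈ Finset.Icc (0 : ℤ) m,
      min (γ * (α + l + β)) (min (p : ℝ) ((q : ℝ) + 1 + α)) = min (p : ℝ) ((q : ℝ) + 1 + α) :=
    fun l hl => by
      have hl0 : (0 : ℝ) ≤ l := by exact_mod_cast (Finset.mem_Icc.mp hl).1
      exact min_eq_right (hγα.trans (by nlinarith))
  rw [Finset.sum_congr rfl fun l hl => by rw [hexp l hl], ← Finset.mul_sum]
  ring
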